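/- All manifolds are smooth, finite-dimensional, Hausdorff and second countable, without boundary. A contact form on a $(2n+1)$-dimensional manifold $M$ is a nowhere-vanishing one-form $\eta$ such that $\mathrm{d}\eta$ is nondegenerate on $\ker\eta$; a contact distribution is a distribution that is locally the kernel of a contact form. An exact symplectic manifold is a pair $(P,\theta)$ with $\theta$ a nowhere-vanishing one-form such that $\omega=-\mathrm{d}\theta$ is nondegenerate; its Liouville vector field $\Delta$ is given by $\iota_\Delta\omega=-\theta$. A symplectization of a contact distribution $\mathcal D$ on $M$ is a smooth locally trivial fiber bundle $\Sigma\colon M^\Sigma\to M$ with connected fibers, where $(M^\Sigma,\theta)$ is exact symplectic, such that $\mathrm{T}\Sigma(\ker\theta)=\mathcal D$. If $\mathcal D=\ker\eta$, its conformal factor is the smooth nowhere-vanishing function $\sigma$ with $\sigma\,\Sigma^*\eta=\theta$. A contactomorphism $F\colon(M_1,\eta_1)\to(M_2,\eta_2)$ is a diffeomorphism with $F^*\eta_2=f\eta_1$ for a smooth nowhere-vanishing function $f$, its conformal factor. A homogeneous symplectomorphism $\Phi\colon(P_1,\theta_1)\to(P_2,\theta_2)$ is a diffeomorphism with $\Phi^*\theta_2=\theta_1$.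 **Part I.** Let $(M_i,\eta_i)$ be contact manifolds with symplectizations $\Sigma_i\colon(M_i^\Sigma,\theta_i)\to M_i$ of $\ker\eta_i$, and let $\sigma_1,\sigma_2$ be the conformal factors of $\Sigma_1,\Sigma_2$. 1. For every homogeneous symplectomorphism $F^\Sigma\colon M_1^\Sigma\to M_2^\Sigma$ there is a unique map $F\colon M_1\to M_2$ with $\Sigma_2\circ F^\Sigma=F\circ\Sigma_1$, and $F$ is a contactomorphism. 2. Let $F\colon M_1\to M_2$ be a contactomorphism with conformal factor $f$. A diffeomorphism $F^\Sigma\colon M_1^\Sigma\to M_2^\Sigma$ with $\Sigma_2\circ F^\Sigma=F\circ\Sigma_1$ is a homogeneous symplectomorphism if and only if $$(F^\Sigma)^*\sigma_2=\frac{\sigma_1}{\Sigma_1^*f}.$$ In that case $F^\Sigma$ is called a symplectization of $F$. There is at most one symplectization of $F$, and there is one if and only if $\sigma_1(\Sigma_1^{-1}(x))=f(x)\cdot\sigma_2(\Sigma_2^{-1}(F(x)))$ as subsets of $\mathbb R$ for every $x\in M_1$. 3. The identity of $M_1^\Sigma$ is the symplectization of the identity of $M_1$. If $F\colon M_1\to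 M_2$ and $G\colon M_2\to M_3$ are contactomorphisms with symplectizations $F^\Sigma$ and $G^\Sigma$, then $G\circ F$ is a contactomorphism and $G^\Sigma\circ F^\Sigma$ is its unique symplectization, i.e. $(G\circ F)^\Sigma=G^\Sigma\circ F^\Sigma$. **Part II.** Let $\Sigma\colon(M^\Sigma,\theta)\to M$ be a symplectization of a contact distribution $\mathcal D$ on $M$. A smooth vector field $X$ on $M$ is an infinitesimal contactomorphism if, for every contact form $\eta$ defining $\mathcal D$ on an open set, $\mathcal L_X\eta=a\eta$ there for some function $a$. A smooth vector field $Y$ on $M^\Sigma$ is an infinitesimal homogeneous symplectomorphism if $\mathcal L_Y\theta=0$. Then there is a bijection $X\mapsto X^\Sigma$ from the infinitesimal contactomorphisms on $M$ onto the infinitesimal homogeneous symplectomorphisms on $M^\Sigma$ such that $X$ and $Y$ correspond to each other if and only if $\Sigma_*Y=X$. Moreover: 1. Let $\eta$ be a contact form with $\ker\eta=\mathcal D$, let $\sigma$ be the conformal factor of $\Sigma$, and let $\mathcal L_X\eta=a_X\eta$. Then $X^\Sigma$ is the only smooth vector field that projects onto $X$ and satisfies $X^\Sigma(\sigma)=-(\Sigma^*a_X)\,\sigma$.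 Also $$X^\Sigma=X^\sigma-(\Sigma^*a_X)\,\Delta,$$ where $X^\sigma$ is the unique smooth vector field that projects onto $X$ and satisfies $X^\sigma(\sigma)=0$. In particular, the Reeb vector field $\mathcal R$ of $\eta$ (given by $\iota_{\mathcal R}\mathrm{d}\eta=0$, $\eta(\mathcal R)=1$) is an infinitesimal contactomorphism and $\mathcal R^\Sigma=\mathcal R^\sigma$. 2. For all infinitesimal contactomorphisms $X,Y$ on $M$, the bracket $[X,Y]$ is an infinitesimal contactomorphism and $[X,Y]^\Sigma=[X^\Sigma,Y^\Sigma]$. -/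

import Mathlib

open Set
open scoped Manifold ContDiff Topology

noncomputable section

namespace ContactSymp

universe u

section Calculus

variable {E : Type*} [NormedAddCommGroup E] [NormedSpace ℝ E]
  {M : Type*} [TopologicalSpace M] [ChartedSpace E M] [IsManifold 𝓘(ℝ, E) ∞ M]

variable (E M) in
/-- Vector fields (sections of the tangent bundle, smoothness is stated separately). -/
abbrev VField := Π x : M, TangentSpace 𝓘(ℝ, E) x

variable (E M) in
/-- One-forms (sections of the cotangent bundle, smoothness is stated separately). -/
abbrev OneForm := Π x : M, TangentSpace 𝓘(ℝ, E) x →L[ℝ] ℝ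

variable (E M) in
/-- Distributions (fields of subspaces of the tangent spaces). -/
abbrev Distrib := Π x : M, Submodule ℝ (TangentSpace 𝓘(ℝ, E) x)

/-- The vector field `X` is smooth. -/
def SmoothField (X : VField E M) : Prop :=
  ContMDiff 𝓘(ℝ, E) (𝓘(ℝ, E).prod 𝓘(ℝ, E)) ∞
    (fun x => Bundle.TotalSpace.mk' E (E := fun x : M => TangentSpace 𝓘(ℝ, E) x) x (X x))

/-- The one-form `α` is smooth on the set `U`. -/
def SmoothFormOn (α : OneForm E M) (U : Set M) : Prop :=
  ContMDiffOn 𝓘(ℝ, E) (𝓘(ℝ, E).prod 𝓘(ℝ, E →L[ℝ] ℝ)) ∞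
    (fun x => Bundle.TotalSpace.mk' (E →L[ℝ] ℝ)
      (E := fun x : M => TangentSpace 𝓘(ℝ, E) x →L[ℝ] ℝ) x (α x)) U

/-- The local representation on the model space `E` of the one-form `α`, in the preferred chart
`φ` around `x`: the pullback `(φ⁻¹)^* α`. -/
def chartRep (α : OneForm E M) (x : M) (y : E) : E →L[ℝ] ℝ :=
  (α ((extChartAt 𝓘(ℝ, E) x).symm y) ∘L
    mfderiv 𝓘(ℝ, E) 𝓘(ℝ, E) (extChartAt 𝓘(ℝ, E) x).symm y) ∘L
      (NormedSpace.fromTangentSpace (𝕜 := ℝ) y).symm.toContinuousLinearMap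

/-- The exterior derivative `dα` of a one-form, evaluated at the point `x` on two tangent vectors:
it is computed in the chart around `x`, with the convention
`dα(X, Y) = X(α(Y)) - Y(α(X)) - α([X, Y])`. -/
def extD (α : OneForm E M) (x : M) (v w : TangentSpace 𝓘(ℝ, E) x) : ℝ :=
  extDeriv
    (fun y => ContinuousAlternatingMap.ofSubsingleton ℝ E ℝ (0 : Fin 1) (chartRep α x y))
    (extChartAt 𝓘(ℝ, E) x x)
    ![mvfderiv 𝓘(ℝ, E) (extChartAt 𝓘(ℝ, E) x) x v,
      mvfderiv 𝓘(ℝ, E) (extChartAt 𝓘(ℝ, E) x) x w]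

/-- The derivative `X(f)` of a real function, here at the point `x` along the tangent vector `v`. -/
def dirD (f : M → ℝ) (x : M) (v : TangentSpace 𝓘(ℝ, E) x) : ℝ :=
  mvfderiv 𝓘(ℝ, E) f x v

/-- The Lie derivative `L_X α = i_X dα + d(α(X))` of a one-form along a vector field, evaluated
at the point `x` on the tangent vector `v`. -/
def lieD (X : VField E M) (α : OneForm E M) (x : M) (v : TangentSpace 𝓘(ℝ, E) x) : ℝ :=
  extD α x (X x) v + dirD (fun y => α y (X y)) x v

end Calculus

section Contact

variable {E : Type*} [NormedAddCommGroup E] [NormedSpace ℝ E]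
  {M : Type*} [TopologicalSpace M] [ChartedSpace E M] [IsManifold 𝓘(ℝ, E) ∞ M]

/-- `η` is a contact form on the set `U`: the dimension is odd, `η` is smooth and nowhere zero, and
`dη` is nondegenerate on `ker η`, i.e. `ker η` is a maximally non-integrable hyperplane field
(equivalently, `η ∧ (dη)^n` vanishes nowhere, where the dimension is `2n+1`). -/
structure IsContactFormOn (η : OneForm E M) (U : Set M) : Prop where
  odd_dim : ∃ n : ℕ, Module.finrank ℝ E = 2 * n + 1
  smooth : SmoothFormOn η U
  ne_zero : ∀ x ∈ U, η x ≠ 0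
  nondeg : ∀ x ∈ U, ∀ v, η x v = 0 → (∀ w, η x w = 0 → extD η x v w = 0) → v = 0

/-- `η` is a contact form on the whole manifold. -/
def IsContactForm (η : OneForm E M) : Prop := IsContactFormOn η univ

/-- The distribution `ker α`. -/
def kerDist (α : OneForm E M) : Distrib E M := fun x => LinearMap.ker (α x).toLinearMap

/-- `D` is a contact distribution: locally it is the kernel of a contact form. -/
def IsContactDistribution (D : Distrib E M) : Prop :=
  ∀ x : M, ∃ U : Set M, IsOpen U ∧ x ∈ U ∧ ∃ η : OneForm E M,
    IsContactFormOn η U ∧ ∀ y ∈ U, D y = kerDist η y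

/-- `X` is an infinitesimal contactomorphism of the contact distribution `D`: for all contact forms
`η` defining `D` on an open set `U`, one has `L_X η = a η` on `U` for a function `a`. -/
structure IsInfContact (D : Distrib E M) (X : VField E M) : Prop where
  smooth : SmoothField X
  lie : ∀ (U : Set M) (η : OneForm E M), IsOpen U → IsContactFormOn η U →
    (∀ y ∈ U, D y = kerDist η y) →
    ∃ a : M → ℝ, ∀ x ∈ U, ∀ v, lieD X η x v = a x * η x v

/-- `R` is the Reeb vector field of the contact form `η`. -/
structure IsReeb (η : OneForm E M) (R : VField E M) : Prop where
  smooth : SmoothField R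
  extD_eq : ∀ x v, extD η x (R x) v = 0
  eq_one : ∀ x, η x (R x) = 1

end Contact

section Symplectic

variable {V : Type*} [NormedAddCommGroup V] [NormedSpace ℝ V]
  {P : Type*} [TopologicalSpace P] [ChartedSpace V P] [IsManifold 𝓘(ℝ, V) ∞ P]

/-- `(P, θ)` is an exact symplectic manifold without singular points: `θ` is smooth, the closed
two-form `ω = -dθ` is nondegenerate, and `θ` vanishes nowhere. -/
structure IsExactSymplectic (θ : OneForm V P) : Prop where
  smooth : SmoothFormOn θ univ
  nondeg : ∀ p v, (∀ w, -extD θ p v w = 0) → v = 0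
  ne_zero : ∀ p, θ p ≠ 0

/-- `Δ` is the Liouville vector field of `(P, θ)`: `i_Δ ω = -θ`, where `ω = -dθ`. -/
structure IsLiouville (θ : OneForm V P) (Δ : VField V P) : Prop where
  smooth : SmoothField Δ
  contr : ∀ p v, -extD θ p (Δ p) v = -θ p v

/-- `Y` is an infinitesimal homogeneous symplectomorphism: `L_Y θ = 0`. -/
structure IsInfHomSympl (θ : OneForm V P) (Y : VField V P) : Prop where
  smooth : SmoothField Y
  lie : ∀ p v, lieD Y θ p v = 0

end Symplectic

section Maps

variable {E₁ : Type*} [NormedAddCommGroup E₁] [NormedSpace ℝ E₁]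
  {M₁ : Type*} [TopologicalSpace M₁] [ChartedSpace E₁ M₁]
  [IsManifold 𝓘(ℝ, E₁) ∞ M₁]
  {E₂ : Type*} [NormedAddCommGroup E₂] [NormedSpace ℝ E₂]
  {M₂ : Type*} [TopologicalSpace M₂] [ChartedSpace E₂ M₂]
  [IsManifold 𝓘(ℝ, E₂) ∞ M₂]

/-- The pullback `F^* α` of a one-form. -/
def pullForm (F : M₁ → M₂) (α : OneForm E₂ M₂) : OneForm E₁ M₁ :=
  fun x => α (F x) ∘L mfderiv 𝓘(ℝ, E₁) 𝓘(ℝ, E₂) F x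

/-- `f` is a conformal factor of `F`: a smooth nowhere-vanishing function with
`F^* η₂ = f η₁`. -/
structure IsContactFactor (η₁ : OneForm E₁ M₁) (η₂ : OneForm E₂ M₂) (F : M₁ → M₂)
    (f : M₁ → ℝ) : Prop where
  smooth : ContMDiff 𝓘(ℝ, E₁) 𝓘(ℝ, ℝ) ∞ f
  ne_zero : ∀ x, f x ≠ 0
  pull : ∀ x, pullForm F η₂ x = f x • η₁ x

/-- The diffeomorphism `F` is a contactomorphism. -/
def IsContactomorphism (η₁ : OneForm E₁ M₁) (η₂ : OneForm E₂ M₂)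
    (F : M₁ ≃ₘ⟮𝓘(ℝ, E₁), 𝓘(ℝ, E₂)⟯ M₂) : Prop :=
  ∃ f : M₁ → ℝ, IsContactFactor η₁ η₂ F f

/-- The diffeomorphism `Φ` is a homogeneous symplectomorphism: `Φ^* θ₂ = θ₁`. -/
def IsHomSympl (θ₁ : OneForm E₁ M₁) (θ₂ : OneForm E₂ M₂)
    (Φ : M₁ ≃ₘ⟮𝓘(ℝ, E₁), 𝓘(ℝ, E₂)⟯ M₂) : Prop :=
  ∀ p, pullForm Φ θ₂ p = θ₁ p

end Maps

section Symplectization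

variable {E : Type*} [NormedAddCommGroup E] [NormedSpace ℝ E]
  {M : Type*} [TopologicalSpace M] [ChartedSpace E M] [IsManifold 𝓘(ℝ, E) ∞ M]
  {V : Type*} [NormedAddCommGroup V] [NormedSpace ℝ V]
  {P : Type u} [TopologicalSpace P] [ChartedSpace V P] [IsManifold 𝓘(ℝ, V) ∞ P]

/-- The map `pr : P → M` is a smooth locally trivial fiber bundle: around each point of `M` there
is a trivialization, whose fiber is a smooth manifold, that is smooth together with its inverse. -/
def IsSmoothFiberBundle (pr : P → M) : Prop :=
  ContMDiff 𝓘(ℝ, V) 𝓘(ℝ, E) ∞ pr ∧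
  ∀ x : M, ∃ (k : ℕ) (F : Type u) (_ : TopologicalSpace F)
    (_ : ChartedSpace (EuclideanSpace ℝ (Fin k)) F) (_ : IsManifold (𝓡 k) ∞ F)
    (e : Bundle.Trivialization F pr), x ∈ e.baseSet ∧
      ContMDiffOn 𝓘(ℝ, V) (𝓘(ℝ, E).prod (𝓡 k)) ∞ e e.source ∧
      ContMDiffOn (𝓘(ℝ, E).prod (𝓡 k)) 𝓘(ℝ, V) ∞ e.toOpenPartialHomeomorph.symm e.target

/-- The fiber bundle `pr : P → M` is a symplectization of the contact distribution `D`: the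
Liouville distribution `ker θ` is mapped by `T pr` onto `D`. -/
structure IsSymplectization (D : Distrib E M) (θ : OneForm V P) (pr : P → M) : Prop where
  bundle : IsSmoothFiberBundle (E := E) (V := V) pr
  map_ker : ∀ p, (kerDist θ p).map (mfderiv 𝓘(ℝ, V) 𝓘(ℝ, E) pr p).toLinearMap = D (pr p)

/-- `σ` is the conformal factor of the symplectization `pr`: a smooth nowhere-vanishing function
with `σ (pr^* η) = θ`. -/
structure IsConformalFactor (η : OneForm E M) (θ : OneForm V P) (pr : P → M)
    (σ : P → ℝ) : Prop where
  smooth : ContMDiff 𝓘(ℝ, V) 𝓘(ℝ, ℝ) ∞ σ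
  ne_zero : ∀ p, σ p ≠ 0
  eq : ∀ p, σ p • pullForm pr η p = θ p

/-- The vector field `Y` on `P` projects onto the vector field `X` on `M`. -/
def ProjectsTo (pr : P → M) (Y : VField V P) (X : VField E M) : Prop :=
  ∀ p, mfderiv 𝓘(ℝ, V) 𝓘(ℝ, E) pr p (Y p) = X (pr p)

/-- `Y` is the vector field `X^σ`: it projects onto `X` and satisfies `Y(σ) = 0`. -/
structure IsSigmaLift (pr : P → M) (σ : P → ℝ) (X : VField E M) (Y : VField V P) : Prop where
  smooth : SmoothField Y
  proj : ProjectsTo pr Y X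
  eq_zero : ∀ p, dirD σ p (Y p) = 0

end Symplectization

section Lift

variable {E₁ : Type*} [NormedAddCommGroup E₁] [NormedSpace ℝ E₁]
  {M₁ : Type*} [TopologicalSpace M₁] [ChartedSpace E₁ M₁]
  [IsManifold 𝓘(ℝ, E₁) ∞ M₁]
  {V₁ : Type*} [NormedAddCommGroup V₁] [NormedSpace ℝ V₁]
  {P₁ : Type*} [TopologicalSpace P₁] [ChartedSpace V₁ P₁]
  [IsManifold 𝓘(ℝ, V₁) ∞ P₁]
  {E₂ : Type*} [NormedAddCommGroup E₂] [NormedSpace ℝ E₂]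
  {M₂ : Type*} [TopologicalSpace M₂] [ChartedSpace E₂ M₂]
  [IsManifold 𝓘(ℝ, E₂) ∞ M₂]
  {V₂ : Type*} [NormedAddCommGroup V₂] [NormedSpace ℝ V₂]
  {P₂ : Type*} [TopologicalSpace P₂] [ChartedSpace V₂ P₂]
  [IsManifold 𝓘(ℝ, V₂) ∞ P₂]

/-- `Φ` covers `F`: the square with vertical arrows `pr₁`, `pr₂` commutes. -/
def Covers (pr₁ : P₁ → M₁) (pr₂ : P₂ → M₂) (F : M₁ → M₂) (Φ : P₁ → P₂) : Prop :=
  ∀ p, pr₂ (Φ p) = F (pr₁ p)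

/-- `Φ` is a symplectization (a lift) of `F`: a homogeneous symplectomorphism covering `F`. -/
structure IsLift (θ₁ : OneForm V₁ P₁) (θ₂ : OneForm V₂ P₂) (pr₁ : P₁ → M₁) (pr₂ : P₂ → M₂)
    (F : M₁ → M₂) (Φ : P₁ ≃ₘ⟮𝓘(ℝ, V₁), 𝓘(ℝ, V₂)⟯ P₂) : Prop where
  covers : Covers pr₁ pr₂ F Φ
  homSympl : IsHomSympl θ₁ θ₂ Φ

end Lift

end ContactSymp

end

/-! Everything rests on one formula. Over an open set where the contact distribution is `ker η`, the
condition on the kernels makes `θ` a nonvanishing multiple `σ pr^*η`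
(`IsSymplectization.exists_factor`), so `dθ = dσ ∧ pr^*η + σ pr^*dη`. Nondegeneracy of `dη` on `ker
η` then forces the Liouville field to be vertical with `Δ(σ) = σ`, and nondegeneracy of `dθ` shows
that a tangent vector `v` of the total space is the same thing as the pair of `T pr(v)` and `v(σ)`.
Hence `(pr, σ)` is a local diffeomorphism into `M × ℝ`; because the fibers are connected and the
total space is Hausdorff, it is even injective (`injective_of_localHomeomorph`). A point upstairs is
thus determined by its base point and its value of `σ`.

Maps. A homogeneous symplectomorphism carries one Liouville field to the other, hence vertical
vectors to vertical vectors, so it descends along the connected fibers. For a map `Φ` over a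
contactomorphism with factor `f`, both `Φ^*θ₂` and `θ₁` are multiples of the nonzero form `pr₁^*η₁`,
and comparing coefficients gives the criterion on `σ₂ ∘ Φ`. The criterion prescribes base point and
`σ₂`-value of `Φ p`, so a lift is unique, and it exists exactly when the prescribed values are
attained, in both directions.

Fields. An infinitesimal contactomorphism `X` lifts to the field `Y` with `dθ(Y, ·) = -dh`, where `h
= θ(Y) = σ η(X)`. Conversely, `L_Y θ = 0` makes `h = θ(Y)` satisfy `Δ(h) = h`, so `h/σ` descends to
the base, and this contact Hamiltonian determines `T pr(Y)`. The formula
`IsConformalFactorOn.lieD_eq` for `L_Y θ` yields `Y(σ) = -aσ`, from which the statements on `X^σ`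
follow. The Reeb field is the projection of the field with Hamiltonian `σ`. Brackets are compatible
because they preserve both relatedness and the equation `L_Y θ = 0`. -/

noncomputable section

namespace ContactSymp

universe u

set_option linter.unusedSectionVars false

/-! ### Coordinate expressions of fields, forms and functions -/

section ChartCalculus

variable {E : Type*} [NormedAddCommGroup E] [NormedSpace ℝ E]
  {M : Type*} [TopologicalSpace M] [ChartedSpace E M] [IsManifold 𝓘(ℝ, E) ∞ M]

/-- The differential of the chart around `x₀`, as a map into the model space. -/
def dChart (x₀ x : M) : TangentSpace 𝓘(ℝ, E) x →L[ℝ] E :=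
  mvfderiv 𝓘(ℝ, E) (extChartAt 𝓘(ℝ, E) x₀) x

/-- The differential of the inverse of the chart around `x₀`. -/
def dChartSymm (x₀ x : M) : E →L[ℝ] TangentSpace 𝓘(ℝ, E) x :=
  (trivializationAt E (fun x : M => TangentSpace 𝓘(ℝ, E) x) x₀).symmL ℝ x

/-- The coordinate expression of a vector field in the chart around `x₀`. -/
def fieldRep (X : VField E M) (x₀ : M) (y : E) : E :=
  dChart x₀ ((extChartAt 𝓘(ℝ, E) x₀).symm y) (X ((extChartAt 𝓘(ℝ, E) x₀).symm y))

/-- Passing to the trivialization of the tangent bundle makes the inverse `dChartSymm` and its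
smoothness available. -/
theorem dChart_eq {x₀ x : M} (hx : x ∈ (chartAt E x₀).source) :
    dChart x₀ x = (trivializationAt E (fun x : M => TangentSpace 𝓘(ℝ, E) x) x₀).continuousLinearMapAt
      ℝ x := by
  rw [TangentBundle.continuousLinearMapAt_trivializationAt hx]
  rfl

theorem dChart_dChartSymm {x₀ x : M} (hx : x ∈ (chartAt E x₀).source) (v : E) :
    dChart x₀ x (dChartSymm x₀ x v) = v := by
  rw [dChart_eq hx, dChartSymm]
  exact Bundle.Trivialization.continuousLinearMapAt_symmL _ (by simpa using hx) v

theorem dChartSymm_dChart {x₀ x : M} (hx : x ∈ (chartAt E x₀).source)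
    (v : TangentSpace 𝓘(ℝ, E) x) :
    dChartSymm x₀ x (dChart x₀ x v) = v := by
  rw [dChart_eq hx, dChartSymm]
  exact Bundle.Trivialization.symmL_continuousLinearMapAt _ (by simpa using hx) v

theorem dChart_injective {x₀ x : M} (hx : x ∈ (chartAt E x₀).source) :
    Function.Injective (dChart (E := E) x₀ x) :=
  Function.LeftInverse.injective (dChartSymm_dChart hx)

theorem dChart_surjective {x₀ x : M} (hx : x ∈ (chartAt E x₀).source) :
    Function.Surjective (dChart (E := E) x₀ x) :=
  Function.RightInverse.surjective (dChart_dChartSymm hx)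

theorem chartRep_apply {α : OneForm E M} {x₀ x : M} (hx : x ∈ (chartAt E x₀).source) (w : E) :
    chartRep α x₀ (extChartAt 𝓘(ℝ, E) x₀ x) w = α x (dChartSymm x₀ x w) := by
  have hx' : x ∈ (extChartAt 𝓘(ℝ, E) x₀).source := by simpa using hx
  have h := TangentBundle.symmL_trivializationAt (I := 𝓘(ℝ, E)) hx
  unfold dChartSymm
  rw [h]
  have : range 𝓘(ℝ, E) = univ := by simp
  rw [this, mfderivWithin_univ]
  unfold chartRep
  simp only [ContinuousLinearMap.comp_apply]
  -- The two sides now differ only in the base point, `φ⁻¹(φ x)` against `x`.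
  have e := (extChartAt 𝓘(ℝ, E) x₀).left_inv hx'
  congr!

theorem apply_eq_chartRep {α : OneForm E M} {x₀ x : M} (hx : x ∈ (chartAt E x₀).source)
    (v : TangentSpace 𝓘(ℝ, E) x) :
    α x v = chartRep α x₀ (extChartAt 𝓘(ℝ, E) x₀ x) (dChart x₀ x v) := by
  rw [chartRep_apply hx, dChartSymm_dChart hx]

theorem fieldRep_apply (X : VField E M) {x₀ x : M} (hx : x ∈ (chartAt E x₀).source) :
    fieldRep X x₀ (extChartAt 𝓘(ℝ, E) x₀ x) = dChart x₀ x (X x) := by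
  have hx' : x ∈ (extChartAt 𝓘(ℝ, E) x₀).source := by simpa using hx
  unfold fieldRep
  rw [(extChartAt 𝓘(ℝ, E) x₀).left_inv hx']

theorem eventually_symm_mem {x₀ x : M} (hx : x ∈ (chartAt E x₀).source) {U : Set M}
    (hU : U ∈ 𝓝 x) :
    ∀ᶠ y in 𝓝 (extChartAt 𝓘(ℝ, E) x₀ x), y ∈ (extChartAt 𝓘(ℝ, E) x₀).target ∧
      (extChartAt 𝓘(ℝ, E) x₀).symm y ∈ U := by
  have hx' : x ∈ (extChartAt 𝓘(ℝ, E) x₀).source := by simpa using hx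
  have h1 := extChartAt_target_mem_nhds' (I := 𝓘(ℝ, E)) (x := x₀)
    ((extChartAt 𝓘(ℝ, E) x₀).map_source hx')
  have h2 : ContinuousAt (extChartAt 𝓘(ℝ, E) x₀).symm (extChartAt 𝓘(ℝ, E) x₀ x) :=
    continuousAt_extChartAt_symm' hx'
  have h3 : U ∈ 𝓝 ((extChartAt 𝓘(ℝ, E) x₀).symm (extChartAt 𝓘(ℝ, E) x₀ x)) := by
    rwa [(extChartAt 𝓘(ℝ, E) x₀).left_inv hx']
  exact (Filter.eventually_of_mem h1 fun _ h => h).and (h2 h3)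

/-- A property that holds near `x` holds near `φ x` in the chart. -/
theorem eventually_chart {x₀ x : M} (hx : x ∈ (chartAt E x₀).source) {p : E → Prop}
    (h : ∀ᶠ x' in 𝓝 x, p (extChartAt 𝓘(ℝ, E) x₀ x')) :
    ∀ᶠ y in 𝓝 (extChartAt 𝓘(ℝ, E) x₀ x), p y := by
  filter_upwards [eventually_symm_mem hx h] with y hy
  have := hy.2
  rwa [(extChartAt 𝓘(ℝ, E) x₀).right_inv hy.1] at this

theorem contDiffAt_chart_of_contMDiffAt {F : Type*} [NormedAddCommGroup F] [NormedSpace ℝ F]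
    {x₀ x : M} (hx : x ∈ (chartAt E x₀).source) {f : M → F}
    (hf : ContMDiffAt 𝓘(ℝ, E) 𝓘(ℝ, F) ∞ f x) :
    ContDiffAt ℝ ∞ (f ∘ (extChartAt 𝓘(ℝ, E) x₀).symm) (extChartAt 𝓘(ℝ, E) x₀ x) := by
  have hx' : x ∈ (extChartAt 𝓘(ℝ, E) x₀).source := by simpa using hx
  rw [← contMDiffAt_iff_contDiffAt]
  refine ContMDiffAt.comp _ (I' := 𝓘(ℝ, E)) ?_ ?_
  · rwa [(extChartAt 𝓘(ℝ, E) x₀).left_inv hx']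
  · exact (contMDiffOn_extChartAt_symm x₀).contMDiffAt
      (extChartAt_target_mem_nhds' ((extChartAt 𝓘(ℝ, E) x₀).map_source hx'))

theorem contMDiffAt_of_contDiffAt_chart {F : Type*} [NormedAddCommGroup F] [NormedSpace ℝ F]
    {x₀ x : M} (hx : x ∈ (chartAt E x₀).source) {f : M → F} {g : E → F}
    (hg : ContDiffAt ℝ ∞ g (extChartAt 𝓘(ℝ, E) x₀ x))
    (h : ∀ᶠ x' in 𝓝 x, f x' = g (extChartAt 𝓘(ℝ, E) x₀ x')) :
    ContMDiffAt 𝓘(ℝ, E) 𝓘(ℝ, F) ∞ f x := by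
  have : ContMDiffAt 𝓘(ℝ, E) 𝓘(ℝ, F) ∞ (g ∘ extChartAt 𝓘(ℝ, E) x₀) x :=
    ContMDiffAt.comp x hg.contMDiffAt (contMDiffAt_extChartAt' hx)
  exact this.congr_of_eventuallyEq h

theorem eventually_mem_source {x₀ x : M} (hx : x ∈ (chartAt E x₀).source) :
    ∀ᶠ x' in 𝓝 x, x' ∈ (chartAt E x₀).source :=
  (chartAt E x₀).open_source.mem_nhds hx

theorem dirD_eq {x₀ x : M} (hx : x ∈ (chartAt E x₀).source) {f : M → ℝ}
    (hf : ContMDiffAt 𝓘(ℝ, E) 𝓘(ℝ, ℝ) ∞ f x) (v : TangentSpace 𝓘(ℝ, E) x) :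
    dirD f x v = fderiv ℝ (f ∘ (extChartAt 𝓘(ℝ, E) x₀).symm) (extChartAt 𝓘(ℝ, E) x₀ x)
      (dChart x₀ x v) := by
  have h1 := contDiffAt_chart_of_contMDiffAt hx hf
  have hx' : x ∈ (extChartAt 𝓘(ℝ, E) x₀).source := by simpa using hx
  have h2 : f =ᶠ[𝓝 x] (f ∘ (extChartAt 𝓘(ℝ, E) x₀).symm) ∘ extChartAt 𝓘(ℝ, E) x₀ := by
    filter_upwards [eventually_mem_source hx] with x' hx'
    simp only [Function.comp_apply]
    rw [(extChartAt 𝓘(ℝ, E) x₀).left_inv (by simpa using hx')]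
  unfold dirD mvfderiv
  rw [h2.mfderiv_eq]
  rw [mfderiv_comp (I' := 𝓘(ℝ, E)) x (h1.contMDiffAt.mdifferentiableAt (by simp))
    ((contMDiffAt_extChartAt' (n := 1) hx).mdifferentiableAt (by simp))]
  rw [mfderiv_eq_fderiv]
  rfl

theorem SmoothField.contDiffAt_fieldRep {X : VField E M} (hX : SmoothField X) {x₀ x : M}
    (hx : x ∈ (chartAt E x₀).source) :
    ContDiffAt ℝ ∞ (fieldRep X x₀) (extChartAt 𝓘(ℝ, E) x₀ x) := by
  have h1 := ((trivializationAt E (fun x : M => TangentSpace 𝓘(ℝ, E) x) x₀).contMDiffAt_section_iff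
    (IB := 𝓘(ℝ, E)) (n := ∞) (s := X) (x₀ := x) (by simpa using hx)).1 (hX x)
  refine (contDiffAt_chart_of_contMDiffAt hx h1).congr_of_eventuallyEq ?_
  refine eventually_chart hx ?_
  filter_upwards [eventually_mem_source hx] with x' hx'
  rw [fieldRep_apply X hx', dChart_eq hx']
  simp only [Function.comp_apply]
  rw [(extChartAt 𝓘(ℝ, E) x₀).left_inv (by simpa using hx')]
  rw [Bundle.Trivialization.continuousLinearMapAt_apply, Bundle.Trivialization.linearMapAt_apply,
    if_pos (by simpa using hx')]

theorem smoothField_of_fieldRep {X : VField E M}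
    (h : ∀ x, ContDiffAt ℝ ∞ (fieldRep X x) (extChartAt 𝓘(ℝ, E) x x)) : SmoothField X := by
  intro x
  have hx : x ∈ (chartAt E x).source := mem_chart_source E x
  refine ((trivializationAt E (fun x : M => TangentSpace 𝓘(ℝ, E) x) x).contMDiffAt_section_iff
    (IB := 𝓘(ℝ, E)) (n := ∞) (s := X) (x₀ := x) (by simp)).2 ?_
  refine contMDiffAt_of_contDiffAt_chart hx (h x) ?_
  filter_upwards [eventually_mem_source hx] with x' hx'
  rw [fieldRep_apply X hx', dChart_eq hx']
  rw [Bundle.Trivialization.continuousLinearMapAt_apply, Bundle.Trivialization.linearMapAt_apply,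
    if_pos (by simpa using hx')]

variable [FiniteDimensional ℝ E]

/-- In finite dimension a linear map is a fixed linear combination of its values on a basis, so
smoothness can be tested vector by vector. -/
theorem contDiffAt_clm_of_apply {D F : Type*} [NormedAddCommGroup D] [NormedSpace ℝ D]
    [NormedAddCommGroup F] [NormedSpace ℝ F]
    {f : D → E →L[ℝ] F} {x : D} (h : ∀ v, ContDiffAt ℝ ∞ (fun y => f y v) x) :
    ContDiffAt ℝ ∞ f x := by
  let b := Module.finBasis ℝ E
  let d := Module.finrank ℝ E
  have : f = fun y => ∑ i, (LinearMap.toContinuousLinearMap (b.coord i)).smulRight (f y (b i)) := by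
    ext y v
    simp only [sum_apply, ContinuousLinearMap.smulRight_apply]
    conv_lhs => rw [← b.sum_repr v, map_sum]
    simp
  rw [this]
  refine ContDiffAt.sum fun i _ => ?_
  exact ((ContinuousLinearMap.smulRightL ℝ E F (LinearMap.toContinuousLinearMap (b.coord i))).contDiff.contDiffAt).comp
    x (h (b i))

/-- For a constant vector `w` of the model space, the value is `α` applied to the smooth local
coordinate field with components `w`. -/
theorem contDiffAt_chartRep {α : OneForm E M} {U : Set M} (hU : IsOpen U)
    (hα : SmoothFormOn α U) {x₀ x : M} (hx : x ∈ (chartAt E x₀).source) (hxU : x ∈ U) :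
    ContDiffAt ℝ ∞ (chartRep α x₀) (extChartAt 𝓘(ℝ, E) x₀ x) := by
  refine contDiffAt_clm_of_apply fun w => ?_
  have h0 := ((hα x hxU).contMDiffAt (hU.mem_nhds hxU))
  have hs := (trivializationAt E (fun x : M => TangentSpace 𝓘(ℝ, E) x) x₀).contMDiffAt_symmL
    (IB := 𝓘(ℝ, E)) (n := ∞) (x := x) (by simpa using hx)
  have hw : ContMDiffAt 𝓘(ℝ, E) (𝓘(ℝ, E).prod 𝓘(ℝ, E)) ∞
    (fun x : M => Bundle.TotalSpace.mk' E (E := Bundle.Trivial M E) x w) x := by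
    rw [Bundle.contMDiffAt_section]; exact contMDiffAt_const
  have h1 := hs.clm_bundle_apply hw
  have h2 := ContMDiffAt.clm_bundle_apply (F₂ := ℝ) (E₂ := Bundle.Trivial M ℝ) h0 h1
  rw [Bundle.contMDiffAt_section] at h2
  refine (contDiffAt_chart_of_contMDiffAt hx h2).congr_of_eventuallyEq ?_
  refine eventually_chart hx ?_
  filter_upwards [eventually_mem_source hx] with x' hx'
  rw [chartRep_apply hx']
  simp only [Function.comp_apply]
  rw [(extChartAt 𝓘(ℝ, E) x₀).left_inv (by simpa using hx')]
  rfl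

end ChartCalculus

/-! ### Exterior derivatives on vector spaces -/

section VectorSpaceForms

variable {E : Type*} [NormedAddCommGroup E] [NormedSpace ℝ E]
  {F : Type*} [NormedAddCommGroup F] [NormedSpace ℝ F]

/-- The exterior derivative of a one-form on a vector space. -/
def curl (β : E → E →L[ℝ] ℝ) (y a b : E) : ℝ := fderiv ℝ β y a b - fderiv ℝ β y b a

theorem extDeriv_ofSubsingleton {β : E → E →L[ℝ] ℝ} {y : E} (h : DifferentiableAt ℝ β y)
    (a b : E) :
    extDeriv (fun y => ContinuousAlternatingMap.ofSubsingleton ℝ E ℝ (0 : Fin 1) (β y)) y ![a, b]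
      = curl β y a b := by
  have hd : DifferentiableAt ℝ
      (fun y => ContinuousAlternatingMap.ofSubsingleton ℝ E ℝ (0 : Fin 1) (β y)) y :=
    (ContinuousAlternatingMap.ofSubsingletonLIE (𝕜 := ℝ) (E := E) (F := ℝ) (ι := Fin 1)
      (i := 0)).differentiable.differentiableAt.comp y h
  have key : ∀ c d : E, fderiv ℝ (fun z => β z c) y d = fderiv ℝ β y d c := by
    intro c d
    rw [fderiv_clm_apply h (differentiableAt_const c)]
    simp
  rw [extDeriv_apply hd, Fin.sum_univ_two, curl, ← key, ← key]
  simp [ContinuousAlternatingMap.ofSubsingleton_apply_apply, sub_eq_add_neg, Fin.removeNth]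

/-- Differentiating `γ(g) ∘ Dg` produces the extra term `γ(D²g(a, b))`, which antisymmetrization
removes. -/
theorem curl_pullback {β : E → E →L[ℝ] ℝ} {γ : F → F →L[ℝ] ℝ} {g : E → F} {y : E}
    (hγ : DifferentiableAt ℝ γ (g y)) (hg : ContDiffAt ℝ ∞ g y)
    (h : ∀ᶠ z in 𝓝 y, β z = γ (g z) ∘L fderiv ℝ g z) (a b : E) :
    curl β y a b = curl γ (g y) (fderiv ℝ g y a) (fderiv ℝ g y b) := by
  have hg' : DifferentiableAt ℝ (fderiv ℝ g) y :=
    (hg.fderiv_right (m := 1) (by norm_cast)).differentiableAt (by simp)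
  have hgd : DifferentiableAt ℝ g y := hg.differentiableAt (by simp)
  have e1 : fderiv ℝ β y = fderiv ℝ (fun z => γ (g z) ∘L fderiv ℝ g z) y :=
    Filter.EventuallyEq.fderiv_eq h
  have hc : DifferentiableAt ℝ (fun z => γ (g z)) y := hγ.comp y hgd
  have e2 : fderiv ℝ (fun z => γ (g z)) y = fderiv ℝ γ (g y) ∘L fderiv ℝ g y :=
    fderiv_comp y hγ hgd
  have hs : fderiv ℝ (fderiv ℝ g) y a b = fderiv ℝ (fderiv ℝ g) y b a :=
    (hg.isSymmSndFDerivAt (by simpa using (WithTop.coe_le_coe.2 le_top : ((2 : ℕ∞) : ℕ∞ω) ≤ ∞))).eq a b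
  simp only [curl, e1]
  rw [fderiv_clm_comp hc hg', e2]
  simp [hs]

end VectorSpaceForms

/-! ### Pullback and chart independence of the exterior derivative -/

section Forms

variable {E : Type*} [NormedAddCommGroup E] [NormedSpace ℝ E]
  {M : Type*} [TopologicalSpace M] [ChartedSpace E M] [IsManifold 𝓘(ℝ, E) ∞ M]
  {E' : Type*} [NormedAddCommGroup E'] [NormedSpace ℝ E']
  {N : Type*} [TopologicalSpace N] [ChartedSpace E' N] [IsManifold 𝓘(ℝ, E') ∞ N]

/-- The coordinate expression of a map in the charts around `x₀` and `z₀`. -/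
def mapRep (f : M → N) (x₀ : M) (z₀ : N) : E → E' :=
  (extChartAt 𝓘(ℝ, E') z₀ ∘ f) ∘ (extChartAt 𝓘(ℝ, E) x₀).symm

theorem mapRep_apply (f : M → N) {x₀ x : M} {z₀ : N} (hx : x ∈ (chartAt E x₀).source) :
    mapRep (E := E) (E' := E') f x₀ z₀ (extChartAt 𝓘(ℝ, E) x₀ x) =
      extChartAt 𝓘(ℝ, E') z₀ (f x) := by
  simp only [mapRep, Function.comp_apply]
  rw [(extChartAt 𝓘(ℝ, E) x₀).left_inv (by simpa using hx)]

theorem contDiffAt_mapRep {f : M → N} {x₀ x : M} {z₀ : N} (hx : x ∈ (chartAt E x₀).source)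
    (hz : f x ∈ (chartAt E' z₀).source) (hf : ContMDiffAt 𝓘(ℝ, E) 𝓘(ℝ, E') ∞ f x) :
    ContDiffAt ℝ ∞ (mapRep (E := E) (E' := E') f x₀ z₀) (extChartAt 𝓘(ℝ, E) x₀ x) :=
  contDiffAt_chart_of_contMDiffAt hx ((contMDiffAt_extChartAt' hz).comp x hf)

theorem fderiv_mapRep {f : M → N} {x₀ x : M} {z₀ : N} (hx : x ∈ (chartAt E x₀).source)
    (hz : f x ∈ (chartAt E' z₀).source) (hf : ContMDiffAt 𝓘(ℝ, E) 𝓘(ℝ, E') ∞ f x)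
    (v : TangentSpace 𝓘(ℝ, E) x) :
    fderiv ℝ (mapRep (E := E) (E' := E') f x₀ z₀) (extChartAt 𝓘(ℝ, E) x₀ x) (dChart x₀ x v) =
      dChart z₀ (f x) (mfderiv 𝓘(ℝ, E) 𝓘(ℝ, E') f x v) := by
  have h1 := contDiffAt_mapRep hx hz hf
  have h2 : extChartAt 𝓘(ℝ, E') z₀ ∘ f =ᶠ[𝓝 x]
      mapRep (E := E) (E' := E') f x₀ z₀ ∘ extChartAt 𝓘(ℝ, E) x₀ := by
    filter_upwards [eventually_mem_source hx] with x' hx'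
    simp only [Function.comp_apply, mapRep_apply f hx']
  have h3 := h2.mfderiv_eq (I := 𝓘(ℝ, E)) (I' := 𝓘(ℝ, E'))
  rw [mfderiv_comp (I' := 𝓘(ℝ, E)) x (h1.contMDiffAt.mdifferentiableAt (by simp))
    ((contMDiffAt_extChartAt' (n := 1) hx).mdifferentiableAt (by simp)),
    mfderiv_comp (I' := 𝓘(ℝ, E')) x ((contMDiffAt_extChartAt' (n := 1) hz).mdifferentiableAt (by simp))
     (hf.mdifferentiableAt (by simp)), mfderiv_eq_fderiv] at h3
  exact (DFunLike.congr_fun h3 v).symm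

theorem chartRep_pullForm {f : M → N} {x₀ x : M} {z₀ : N} (hx : x ∈ (chartAt E x₀).source)
    (hz : f x ∈ (chartAt E' z₀).source) (hf : ContMDiffAt 𝓘(ℝ, E) 𝓘(ℝ, E') ∞ f x)
    (α : OneForm E' N) :
    chartRep (pullForm f α) x₀ (extChartAt 𝓘(ℝ, E) x₀ x) =
      chartRep α z₀ (mapRep (E := E) (E' := E') f x₀ z₀ (extChartAt 𝓘(ℝ, E) x₀ x)) ∘L
        fderiv ℝ (mapRep (E := E) (E' := E') f x₀ z₀) (extChartAt 𝓘(ℝ, E) x₀ x) := by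
  ext w
  obtain ⟨v, rfl⟩ := dChart_surjective hx w
  rw [← apply_eq_chartRep hx, ContinuousLinearMap.comp_apply, fderiv_mapRep hx hz hf,
    mapRep_apply f hx, ← apply_eq_chartRep hz]
  rfl

theorem curl_chartRep_pullForm {f : M → N} {x₀ x : M} {z₀ : N}
    (hx : x ∈ (chartAt E x₀).source) (hz : f x ∈ (chartAt E' z₀).source)
    {W : Set M} (hW : IsOpen W) (hxW : x ∈ W)
    (hf : ContMDiffOn 𝓘(ℝ, E) 𝓘(ℝ, E') ∞ f W)
    {α : OneForm E' N} (hα : DifferentiableAt ℝ (chartRep α z₀) (extChartAt 𝓘(ℝ, E') z₀ (f x)))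
    (v w : TangentSpace 𝓘(ℝ, E) x) :
    curl (chartRep (pullForm f α) x₀) (extChartAt 𝓘(ℝ, E) x₀ x) (dChart x₀ x v) (dChart x₀ x w) =
      curl (chartRep α z₀) (extChartAt 𝓘(ℝ, E') z₀ (f x))
        (dChart z₀ (f x) (mfderiv 𝓘(ℝ, E) 𝓘(ℝ, E') f x v))
        (dChart z₀ (f x) (mfderiv 𝓘(ℝ, E) 𝓘(ℝ, E') f x w)) := by
  have hfx := hf.contMDiffAt (hW.mem_nhds hxW)
  have hev : ∀ᶠ x' in 𝓝 x, x' ∈ (chartAt E x₀).source ∧ f x' ∈ (chartAt E' z₀).source ∧ x' ∈ W :=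
    (eventually_mem_source hx).and
      ((hfx.continuousAt.eventually (eventually_mem_source hz)).and (hW.mem_nhds hxW))
  rw [← fderiv_mapRep hx hz hfx, ← fderiv_mapRep hx hz hfx, ← mapRep_apply f hx]
  refine curl_pullback (by rwa [mapRep_apply f hx]) (contDiffAt_mapRep hx hz hfx)
    (eventually_chart hx ?_) _ _
  filter_upwards [hev] with x' h
  exact chartRep_pullForm h.1 h.2.1 (hf.contMDiffAt (hW.mem_nhds h.2.2)) α

theorem contDiffAt_chartRep_pullForm {f : M → N} {x₀ x : M} {z₀ : N}
    (hx : x ∈ (chartAt E x₀).source) (hz : f x ∈ (chartAt E' z₀).source)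
    {W : Set M} (hW : IsOpen W) (hxW : x ∈ W) (hf : ContMDiffOn 𝓘(ℝ, E) 𝓘(ℝ, E') ∞ f W)
    {α : OneForm E' N} (hα : ContDiffAt ℝ ∞ (chartRep α z₀) (extChartAt 𝓘(ℝ, E') z₀ (f x))) :
    ContDiffAt ℝ ∞ (chartRep (pullForm f α) x₀) (extChartAt 𝓘(ℝ, E) x₀ x) := by
  have hfx := hf.contMDiffAt (hW.mem_nhds hxW)
  have hg := contDiffAt_mapRep hx hz hfx
  rw [← mapRep_apply f hx] at hα
  refine (ContDiffAt.clm_comp (hα.comp (extChartAt 𝓘(ℝ, E) x₀ x) hg)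
      (hg.fderiv_right (by norm_cast))).congr_of_eventuallyEq (eventually_chart hx ?_)
  have hev : ∀ᶠ x' in 𝓝 x, x' ∈ (chartAt E x₀).source ∧ f x' ∈ (chartAt E' z₀).source ∧ x' ∈ W :=
    (eventually_mem_source hx).and
      ((hfx.continuousAt.eventually (eventually_mem_source hz)).and (hW.mem_nhds hxW))
  filter_upwards [hev] with x' h
  exact chartRep_pullForm h.1 h.2.1 (hf.contMDiffAt (hW.mem_nhds h.2.2)) α

theorem pullForm_id (α : OneForm E M) : pullForm id α = α := by
  funext x
  simp only [pullForm, mfderiv_id]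
  rfl

variable [FiniteDimensional ℝ E] [FiniteDimensional ℝ E']

/-- The exterior derivative of a one-form can be computed in any chart. -/
theorem extD_eq_curl {α : OneForm E M} {U : Set M} (hU : IsOpen U) (hα : SmoothFormOn α U)
    {x₀ x : M} (hx : x ∈ (chartAt E x₀).source) (hxU : x ∈ U) (v w : TangentSpace 𝓘(ℝ, E) x) :
    extD α x v w =
      curl (chartRep α x₀) (extChartAt 𝓘(ℝ, E) x₀ x) (dChart x₀ x v) (dChart x₀ x w) := by
  have hxx := mem_chart_source E x
  have h1 : extD α x v w =
      curl (chartRep α x) (extChartAt 𝓘(ℝ, E) x x) (dChart x x v) (dChart x x w) :=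
    extDeriv_ofSubsingleton
      ((contDiffAt_chartRep hU hα hxx hxU).differentiableAt (by simp)) _ _
  -- A change of charts is the coordinate expression of the identity, so chart independence is a
  -- case of naturality.
  have h2 := curl_chartRep_pullForm (f := (id : M → M)) hxx hx isOpen_univ (mem_univ x)
    contMDiff_id.contMDiffOn (α := α) ((contDiffAt_chartRep hU hα hx hxU).differentiableAt (by simp))
    v w
  rw [pullForm_id] at h2
  rw [h1, h2, mfderiv_id]
  rfl

theorem extD_pullForm {f : M → N} {U : Set N} (hU : IsOpen U) {α : OneForm E' N}
    (hα : SmoothFormOn α U) {W : Set M} (hW : IsOpen W) (hf : ContMDiffOn 𝓘(ℝ, E) 𝓘(ℝ, E') ∞ f W)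
    {x : M} (hx : x ∈ W) (hxU : f x ∈ U) (v w : TangentSpace 𝓘(ℝ, E) x) :
    extD (pullForm f α) x v w =
      extD α (f x) (mfderiv 𝓘(ℝ, E) 𝓘(ℝ, E') f x v) (mfderiv 𝓘(ℝ, E) 𝓘(ℝ, E') f x w) := by
  have hxx := mem_chart_source E x
  have hzz := mem_chart_source E' (f x)
  have hfx := hf.contMDiffAt (hW.mem_nhds hx)
  have hd := contDiffAt_chartRep hU hα hzz hxU
  rw [extD_eq_curl hU hα hzz hxU, ← curl_chartRep_pullForm hxx hzz hW hx hf
    (hd.differentiableAt (by simp))]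
  exact extDeriv_ofSubsingleton
    ((contDiffAt_chartRep_pullForm hxx hzz hW hx hf hd).differentiableAt (by simp)) _ _

end Forms

/-! ### Lie brackets on vector spaces -/

section VectorSpaceBracket

variable {E : Type*} [NormedAddCommGroup E] [NormedSpace ℝ E]

theorem hasFDerivAt_of_contDiffAt {F : Type*} [NormedAddCommGroup F] [NormedSpace ℝ F]
    {f : E → F} {y : E} (hf : ContDiffAt ℝ ∞ f y) : HasFDerivAt f (fderiv ℝ f y) y :=
  (hf.differentiableAt (by simp)).hasFDerivAt

theorem hasFDerivAt_fderiv_of_contDiffAt {F : Type*} [NormedAddCommGroup F] [NormedSpace ℝ F]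
    {f : E → F} {y : E} (hf : ContDiffAt ℝ ∞ f y) :
    HasFDerivAt (fderiv ℝ f) (fderiv ℝ (fderiv ℝ f) y) y :=
  hasFDerivAt_of_contDiffAt (hf.fderiv_right (m := ∞) (by norm_cast))

theorem fderiv_fderiv_symm {F : Type*} [NormedAddCommGroup F] [NormedSpace ℝ F]
    {f : E → F} {y : E} (hf : ContDiffAt ℝ ∞ f y) (a b : E) :
    fderiv ℝ (fderiv ℝ f) y a b = fderiv ℝ (fderiv ℝ f) y b a :=
  (hf.isSymmSndFDerivAt
    (by simpa using (WithTop.coe_le_coe.2 le_top : ((2 : ℕ∞) : ℕ∞ω) ≤ ∞))).eq a b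

/-- The hypotheses say `L_A β = 0` and `L_B β = 0` in coordinates. Differentiate the first along
`B`, the second along `A`, and subtract: symmetry cancels the second derivatives of `β`, and the
mixed first-order terms are rewritten by evaluating the hypotheses at `DB(w)` and `DA(w)`. -/
theorem lie_lieBracket_eq_zero {β : E → E →L[ℝ] ℝ} {A B : E → E} {y : E}
    (hβ : ContDiffAt ℝ ∞ β y) (hA : ContDiffAt ℝ ∞ A y) (hB : ContDiffAt ℝ ∞ B y)
    (h1 : ∀ᶠ z in 𝓝 y, ∀ w, fderiv ℝ β z (A z) w + β z (fderiv ℝ A z w) = 0)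
    (h2 : ∀ᶠ z in 𝓝 y, ∀ w, fderiv ℝ β z (B z) w + β z (fderiv ℝ B z w) = 0) (w : E) :
    fderiv ℝ β y (fderiv ℝ B y (A y) - fderiv ℝ A y (B y)) w +
      β y (fderiv ℝ (fun z => fderiv ℝ B z (A z) - fderiv ℝ A z (B z)) y w) = 0 := by
  have key : ∀ {C : E → E} (_ : ContDiffAt ℝ ∞ C y)
      (_ : ∀ᶠ z in 𝓝 y, ∀ w, fderiv ℝ β z (C z) w + β z (fderiv ℝ C z w) = 0) (u w : E),
      fderiv ℝ (fderiv ℝ β) y u (C y) w + fderiv ℝ β y (fderiv ℝ C y u) w +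
        fderiv ℝ β y u (fderiv ℝ C y w) + β y (fderiv ℝ (fderiv ℝ C) y u w) = 0 := by
    intro C hC h u w
    have e1 : HasFDerivAt (fun z => fderiv ℝ β z (C z) w + β z (fderiv ℝ C z w)) _ y :=
      (((hasFDerivAt_fderiv_of_contDiffAt hβ).clm_apply
        (hasFDerivAt_of_contDiffAt hC)).clm_apply (hasFDerivAt_const w y)).add
        ((hasFDerivAt_of_contDiffAt hβ).clm_apply
          ((hasFDerivAt_fderiv_of_contDiffAt hC).clm_apply (hasFDerivAt_const w y)))
    have e2 : HasFDerivAt (fun z => fderiv ℝ β z (C z) w + β z (fderiv ℝ C z w))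
        (0 : E →L[ℝ] ℝ) y :=
      (hasFDerivAt_const (0 : ℝ) y).congr_of_eventuallyEq (h.mono fun z hz => hz w)
    have e3 := DFunLike.congr_fun (e1.unique e2) u
    simp at e3
    linarith
  have e4 : HasFDerivAt (fun z => fderiv ℝ B z (A z) - fderiv ℝ A z (B z)) _ y :=
    ((hasFDerivAt_fderiv_of_contDiffAt hB).clm_apply (hasFDerivAt_of_contDiffAt hA)).sub
      ((hasFDerivAt_fderiv_of_contDiffAt hA).clm_apply (hasFDerivAt_of_contDiffAt hB))
  rw [e4.fderiv]
  have kA := key hA h1 (B y) w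
  have kB := key hB h2 (A y) w
  have a1 := h1.self_of_nhds (fderiv ℝ B y w)
  have b1 := h2.self_of_nhds (fderiv ℝ A y w)
  have s1 := fderiv_fderiv_symm hβ (A y) (B y)
  have s2 := fderiv_fderiv_symm hA (B y) w
  have s3 := fderiv_fderiv_symm hB (A y) w
  simp only [s1, s2, s3] at kA kB
  simp
  linarith

/-- Differentiating `Dg(A) = A' ∘ g` along `B`, and conversely, leaves only the symmetric terms
`D²g(A, B)`, which cancel in the difference. -/
theorem lieBracket_related {F : Type*} [NormedAddCommGroup F] [NormedSpace ℝ F]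
    {g : E → F} {A B : E → E} {A' B' : F → F} {y : E}
    (hg : ContDiffAt ℝ ∞ g y) (hA : ContDiffAt ℝ ∞ A y) (hB : ContDiffAt ℝ ∞ B y)
    (hA' : ContDiffAt ℝ ∞ A' (g y)) (hB' : ContDiffAt ℝ ∞ B' (g y))
    (h1 : ∀ᶠ z in 𝓝 y, fderiv ℝ g z (A z) = A' (g z))
    (h2 : ∀ᶠ z in 𝓝 y, fderiv ℝ g z (B z) = B' (g z)) :
    fderiv ℝ g y (fderiv ℝ B y (A y) - fderiv ℝ A y (B y)) =
      fderiv ℝ B' (g y) (A' (g y)) - fderiv ℝ A' (g y) (B' (g y)) := by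
  have key : ∀ {C : E → E} {C' : F → F} (_ : ContDiffAt ℝ ∞ C y) (_ : ContDiffAt ℝ ∞ C' (g y))
      (_ : ∀ᶠ z in 𝓝 y, fderiv ℝ g z (C z) = C' (g z)) (u : E),
      fderiv ℝ g y (fderiv ℝ C y u) + fderiv ℝ (fderiv ℝ g) y u (C y) =
        fderiv ℝ C' (g y) (fderiv ℝ g y u) := by
    intro C C' hC hC' h u
    have e1 : HasFDerivAt (fun z => fderiv ℝ g z (C z)) _ y :=
      (hasFDerivAt_fderiv_of_contDiffAt hg).clm_apply (hasFDerivAt_of_contDiffAt hC)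
    have e2 : HasFDerivAt (fun z => C' (g z)) _ y :=
      (hasFDerivAt_of_contDiffAt hC').comp y (hasFDerivAt_of_contDiffAt hg)
    have e3 := DFunLike.congr_fun (e1.unique (e2.congr_of_eventuallyEq h)) u
    simpa using e3
  have kA := key hA hA' h1 (B y)
  have kB := key hB hB' h2 (A y)
  rw [← h1.self_of_nhds, ← h2.self_of_nhds, ← kA, ← kB, map_sub, fderiv_fderiv_symm hg (A y)]
  abel

end VectorSpaceBracket

/-! ### Pointwise calculus of one-forms and Lie derivatives on manifolds -/

section

variable {E : Type*} [NormedAddCommGroup E] [NormedSpace ℝ E]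
  {M : Type*} [TopologicalSpace M] [ChartedSpace E M] [IsManifold 𝓘(ℝ, E) ∞ M]
  {E' : Type*} [NormedAddCommGroup E'] [NormedSpace ℝ E']
  {N : Type*} [TopologicalSpace N] [ChartedSpace E' N] [IsManifold 𝓘(ℝ, E') ∞ N]

/-- The one-form `α` is smooth at `x`, read in the preferred chart around `x`. -/
def SmoothFormAt (α : OneForm E M) (x : M) : Prop :=
  ContDiffAt ℝ ∞ (chartRep α x) (extChartAt 𝓘(ℝ, E) x x)

theorem SmoothFormOn.smoothFormAt [FiniteDimensional ℝ E] {α : OneForm E M} {U : Set M}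
    (hU : IsOpen U) (hα : SmoothFormOn α U) {x : M} (hx : x ∈ U) : SmoothFormAt α x :=
  contDiffAt_chartRep hU hα (mem_chart_source E x) hx

theorem SmoothFormAt.pullForm {f : M → N} {x : M} {W : Set M} (hW : IsOpen W) (hxW : x ∈ W)
    (hf : ContMDiffOn 𝓘(ℝ, E) 𝓘(ℝ, E') ∞ f W) {α : OneForm E' N} (hα : SmoothFormAt α (f x)) :
    SmoothFormAt (ContactSymp.pullForm (E₁ := E) f α) x :=
  contDiffAt_chartRep_pullForm (mem_chart_source E x) (mem_chart_source E' (f x)) hW hxW hf hα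

theorem extD_eq_curl_self {α : OneForm E M} {x : M} (hα : SmoothFormAt α x)
    (v w : TangentSpace 𝓘(ℝ, E) x) :
    extD α x v w =
      curl (chartRep α x) (extChartAt 𝓘(ℝ, E) x x) (dChart x x v) (dChart x x w) :=
  extDeriv_ofSubsingleton (ContDiffAt.differentiableAt hα (by simp)) _ _

theorem extD_swap {α : OneForm E M} {x : M} (hα : SmoothFormAt α x)
    (v w : TangentSpace 𝓘(ℝ, E) x) : extD α x v w = -extD α x w v := by
  rw [extD_eq_curl_self hα, extD_eq_curl_self hα, curl, curl]
  ring

theorem extD_self {α : OneForm E M} {x : M} (hα : SmoothFormAt α x)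
    (v : TangentSpace 𝓘(ℝ, E) x) : extD α x v v = 0 := by
  rw [extD_eq_curl_self hα, curl, sub_self]

theorem extD_sub_left {α : OneForm E M} {x : M} (hα : SmoothFormAt α x)
    (v v' w : TangentSpace 𝓘(ℝ, E) x) : extD α x (v - v') w = extD α x v w - extD α x v' w := by
  simp only [extD_eq_curl_self hα, curl, map_sub, sub_apply]
  ring

theorem extD_smul_left {α : OneForm E M} {x : M} (hα : SmoothFormAt α x) (c : ℝ)
    (v w : TangentSpace 𝓘(ℝ, E) x) : extD α x (c • v) w = c * extD α x v w := by
  simp only [extD_eq_curl_self hα, curl, map_smul, smul_apply, smul_eq_mul]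
  ring

theorem chartRep_congr {α β : OneForm E M} {x₀ x : M} (hx : x ∈ (chartAt E x₀).source)
    (h : ∀ᶠ x' in 𝓝 x, α x' = β x') :
    chartRep α x₀ =ᶠ[𝓝 (extChartAt 𝓘(ℝ, E) x₀ x)] chartRep β x₀ := by
  refine eventually_chart hx ?_
  filter_upwards [h, eventually_mem_source hx] with x' hx' hs
  ext w
  rw [chartRep_apply hs, chartRep_apply hs, hx']

theorem SmoothFormAt.congr {α β : OneForm E M} {x : M} (hα : SmoothFormAt α x)
    (h : ∀ᶠ x' in 𝓝 x, β x' = α x') : SmoothFormAt β x :=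
  ContDiffAt.congr_of_eventuallyEq hα (chartRep_congr (mem_chart_source E x) h)

theorem extD_congr {α β : OneForm E M} {x : M} (hα : SmoothFormAt α x)
    (h : ∀ᶠ x' in 𝓝 x, β x' = α x') (v w : TangentSpace 𝓘(ℝ, E) x) :
    extD β x v w = extD α x v w := by
  rw [extD_eq_curl_self hα, extD_eq_curl_self (hα.congr h), curl, curl,
    (chartRep_congr (mem_chart_source E x) h).fderiv_eq]

theorem dirD_congr {f g : M → ℝ} {x : M} (h : f =ᶠ[𝓝 x] g) (v : TangentSpace 𝓘(ℝ, E) x) :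
    dirD f x v = dirD g x v := by
  unfold dirD mvfderiv
  rw [h.mfderiv_eq]
  rfl

theorem chartRep_smul {f : M → ℝ} {α : OneForm E M} {x₀ x : M} (hx : x ∈ (chartAt E x₀).source) :
    chartRep (fun x => f x • α x) x₀ =ᶠ[𝓝 (extChartAt 𝓘(ℝ, E) x₀ x)]
      fun y => (f ∘ (extChartAt 𝓘(ℝ, E) x₀).symm) y • chartRep α x₀ y := by
  refine eventually_chart hx ?_
  filter_upwards [eventually_mem_source hx] with x' hs
  ext w
  simp only [Function.comp_apply]
  rw [(extChartAt 𝓘(ℝ, E) x₀).left_inv (by simpa using hs), smul_apply, chartRep_apply hs,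
    chartRep_apply hs, smul_apply]

theorem SmoothFormAt.smul {f : M → ℝ} {α : OneForm E M} {x : M}
    (hf : ContMDiffAt 𝓘(ℝ, E) 𝓘(ℝ, ℝ) ∞ f x) (hα : SmoothFormAt α x) :
    SmoothFormAt (fun x => f x • α x) x :=
  ((contDiffAt_chart_of_contMDiffAt (mem_chart_source E x) hf).smul hα).congr_of_eventuallyEq
    (chartRep_smul (mem_chart_source E x))

/-- The Leibniz rule `d(fα) = df ∧ α + f dα`. -/
theorem extD_smul {f : M → ℝ} {α : OneForm E M} {x : M}
    (hf : ContMDiffAt 𝓘(ℝ, E) 𝓘(ℝ, ℝ) ∞ f x) (hα : SmoothFormAt α x)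
    (v w : TangentSpace 𝓘(ℝ, E) x) :
    extD (fun x => f x • α x) x v w =
      dirD f x v * α x w - dirD f x w * α x v + f x * extD α x v w := by
  have hx := mem_chart_source E x
  have hf' := contDiffAt_chart_of_contMDiffAt hx hf
  rw [extD_eq_curl_self (hα.smul hf), extD_eq_curl_self hα, curl, curl,
    (chartRep_smul hx).fderiv_eq,
    fderiv_fun_smul (hf'.differentiableAt (by simp)) (ContDiffAt.differentiableAt hα (by simp)),
    dirD_eq hx hf, dirD_eq hx hf, apply_eq_chartRep hx w, apply_eq_chartRep hx v]
  simp
  ring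

theorem dirD_mul {f g : M → ℝ} {x : M} (hf : ContMDiffAt 𝓘(ℝ, E) 𝓘(ℝ, ℝ) ∞ f x)
    (hg : ContMDiffAt 𝓘(ℝ, E) 𝓘(ℝ, ℝ) ∞ g x) (v : TangentSpace 𝓘(ℝ, E) x) :
    dirD (fun x => f x * g x) x v = dirD f x v * g x + f x * dirD g x v := by
  unfold dirD
  rw [mvfderiv_fun_mul (hf.mdifferentiableAt (by simp)) (hg.mdifferentiableAt (by simp))]
  simp
  ring

theorem dirD_comp {f : M → N} {g : N → ℝ} {x : M} (hf : ContMDiffAt 𝓘(ℝ, E) 𝓘(ℝ, E') ∞ f x)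
    (hg : ContMDiffAt 𝓘(ℝ, E') 𝓘(ℝ, ℝ) ∞ g (f x)) (v : TangentSpace 𝓘(ℝ, E) x) :
    dirD (fun x => g (f x)) x v = dirD g (f x) (mfderiv 𝓘(ℝ, E) 𝓘(ℝ, E') f x v) :=
  mvfderiv_comp_apply x (hg.mdifferentiableAt (by simp)) (hf.mdifferentiableAt (by simp)) v

/-- The function `α(X)` in coordinates. -/
theorem apply_field_eq_chart (α : OneForm E M) (X : VField E M) {x₀ x : M}
    (hx : x ∈ (chartAt E x₀).source) :
    ((fun x => α x (X x)) ∘ (extChartAt 𝓘(ℝ, E) x₀).symm) =ᶠ[𝓝 (extChartAt 𝓘(ℝ, E) x₀ x)]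
      fun y => chartRep α x₀ y (fieldRep X x₀ y) := by
  refine eventually_chart hx ?_
  filter_upwards [eventually_mem_source hx] with x' hs
  simp only [Function.comp_apply]
  rw [(extChartAt 𝓘(ℝ, E) x₀).left_inv (by simpa using hs), fieldRep_apply X hs,
    ← apply_eq_chartRep hs]

theorem contMDiffAt_apply_field {α : OneForm E M} {X : VField E M} {x : M}
    (hα : SmoothFormAt α x) (hX : SmoothField X) :
    ContMDiffAt 𝓘(ℝ, E) 𝓘(ℝ, ℝ) ∞ (fun x => α x (X x)) x := by
  have hx := mem_chart_source E x
  refine contMDiffAt_of_contDiffAt_chart hx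
    (ContDiffAt.clm_apply hα (hX.contDiffAt_fieldRep hx)) ?_
  filter_upwards [eventually_mem_source hx] with x' hs
  rw [fieldRep_apply X hs, ← apply_eq_chartRep hs]

variable [FiniteDimensional ℝ E] [FiniteDimensional ℝ E']

/-- In Cartan's formula, the part of `d(α(X))(v)` that differentiates `α` cancels the second half of
`dα(X, v)`. -/
theorem lieD_eq_chart {α : OneForm E M} {X : VField E M} {U : Set M} (hU : IsOpen U)
    (hα : SmoothFormOn α U) (hX : SmoothField X) {x₀ x : M} (hx : x ∈ (chartAt E x₀).source)
    (hxU : x ∈ U) (v : TangentSpace 𝓘(ℝ, E) x) :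
    lieD X α x v = fderiv ℝ (chartRep α x₀) (extChartAt 𝓘(ℝ, E) x₀ x)
        (fieldRep X x₀ (extChartAt 𝓘(ℝ, E) x₀ x)) (dChart x₀ x v) +
      chartRep α x₀ (extChartAt 𝓘(ℝ, E) x₀ x)
        (fderiv ℝ (fieldRep X x₀) (extChartAt 𝓘(ℝ, E) x₀ x) (dChart x₀ x v)) := by
  have h1 := contDiffAt_chartRep hU hα hx hxU
  have h2 := hX.contDiffAt_fieldRep hx
  have h3 := contMDiffAt_apply_field (hα.smoothFormAt hU hxU) hX
  rw [lieD, extD_eq_curl hU hα hx hxU, dirD_eq hx h3, (apply_field_eq_chart α X hx).fderiv_eq,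
    fderiv_clm_apply (h1.differentiableAt (by simp)) (h2.differentiableAt (by simp)), curl,
    fieldRep_apply X hx]
  simp

/-- The bracket on the manifold is defined by pulling back to the chart centered at the point, which
is why the formula is stated only there. -/
theorem dChart_mlieBracket {X Y : VField E M} (x : M) :
    dChart x x (VectorField.mlieBracket 𝓘(ℝ, E) X Y x) =
      fderiv ℝ (fieldRep Y x) (extChartAt 𝓘(ℝ, E) x x) (fieldRep X x (extChartAt 𝓘(ℝ, E) x x)) -
      fderiv ℝ (fieldRep X x) (extChartAt 𝓘(ℝ, E) x x)
        (fieldRep Y x (extChartAt 𝓘(ℝ, E) x x)) := by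
  have hx := mem_chart_source E x
  have rep : ∀ Z : VField E M, VectorField.mpullbackWithin 𝓘(ℝ, E) 𝓘(ℝ, E)
      (extChartAt 𝓘(ℝ, E) x).symm Z (range 𝓘(ℝ, E)) =ᶠ[𝓝 (extChartAt 𝓘(ℝ, E) x x)]
        fieldRep Z x := by
    intro Z
    filter_upwards [(eventually_symm_mem hx Filter.univ_mem).mono fun _ h => h.1] with y hy
    rw [VectorField.mpullbackWithin_apply, fieldRep]
    have e1 := mfderivWithin_extChartAt_symm_comp_mfderiv_extChartAt (I := 𝓘(ℝ, E)) hy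
    have e2 := mfderiv_extChartAt_comp_mfderivWithin_extChartAt_symm (I := 𝓘(ℝ, E)) hy
    rw [ContinuousLinearMap.inverse_eq e1 e2]
    rfl
  have hinv : ∀ u : E, dChart x x
      ((mfderiv 𝓘(ℝ, E) 𝓘(ℝ, E) (extChartAt 𝓘(ℝ, E) x) x).inverse u) = u := fun u =>
    DFunLike.congr_fun (isInvertible_mfderiv_extChartAt (I := 𝓘(ℝ, E))
      (mem_extChartAt_source x)).self_comp_inverse u
  rw [← VectorField.mlieBracketWithin_univ, VectorField.mlieBracketWithin_apply]
  have hr : (extChartAt 𝓘(ℝ, E) x).symm ⁻¹' univ ∩ range 𝓘(ℝ, E) = univ := by simp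
  refine (hinv _).trans ?_
  rw [hr]
  refine (congrFun (VectorField.lieBracketWithin_univ (𝕜 := ℝ)) _).trans ?_
  exact Filter.EventuallyEq.lieBracket_vectorField_eq (𝕜 := ℝ) (rep X) (rep Y)

end

/-! ### Brackets of smooth fields, and solving `dθ(Y, ·) = α` -/

section Fields

variable {E : Type*} [NormedAddCommGroup E] [NormedSpace ℝ E] [FiniteDimensional ℝ E]
  {M : Type*} [TopologicalSpace M] [ChartedSpace E M] [IsManifold 𝓘(ℝ, E) ∞ M]
  {E' : Type*} [NormedAddCommGroup E'] [NormedSpace ℝ E'] [FiniteDimensional ℝ E']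
  {N : Type*} [TopologicalSpace N] [ChartedSpace E' N] [IsManifold 𝓘(ℝ, E') ∞ N]

theorem SmoothField.mlieBracket {X Y : VField E M} (hX : SmoothField X) (hY : SmoothField Y) :
    SmoothField (VectorField.mlieBracket 𝓘(ℝ, E) X Y) := by
  have := FiniteDimensional.complete ℝ E
  have : IsManifold 𝓘(ℝ, E) (((⊤ : ℕ∞) : ℕ∞ω) + 1) M := by
    have : (((⊤ : ℕ∞) : ℕ∞ω) + 1) = ∞ := by norm_cast
    rw [this]; infer_instance
  have : IsManifold 𝓘(ℝ, E) (minSmoothness ℝ 2) M := by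
    rw [minSmoothness_of_isRCLikeNormedField]
    exact IsManifold.of_le (n := ∞) (WithTop.coe_le_coe.2 le_top : ((2 : ℕ∞) : ℕ∞ω) ≤ ∞)
  intro x
  exact ContMDiffAt.mlieBracket_vectorField (n := ⊤) (m := ⊤) (hX x) (hY x)
    (by rw [minSmoothness_of_isRCLikeNormedField]; norm_cast)

theorem projectsTo_mlieBracket {f : M → N} (hf : ContMDiff 𝓘(ℝ, E) 𝓘(ℝ, E') ∞ f)
    {Y₁ Y₂ : VField E M} {X₁ X₂ : VField E' N} (hY₁ : SmoothField Y₁) (hY₂ : SmoothField Y₂)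
    (hX₁ : SmoothField X₁) (hX₂ : SmoothField X₂) (h₁ : ProjectsTo f Y₁ X₁)
    (h₂ : ProjectsTo f Y₂ X₂) :
    ProjectsTo f (VectorField.mlieBracket 𝓘(ℝ, E) Y₁ Y₂)
      (VectorField.mlieBracket 𝓘(ℝ, E') X₁ X₂) := by
  intro x
  have hx := mem_chart_source E x
  have hz := mem_chart_source E' (f x)
  have hev : ∀ᶠ x' in 𝓝 x, x' ∈ (chartAt E x).source ∧ f x' ∈ (chartAt E' (f x)).source :=
    (eventually_mem_source hx).and ((hf x).continuousAt.eventually (eventually_mem_source hz))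
  have rel : ∀ {Y : VField E M} {X : VField E' N}, ProjectsTo f Y X →
      ∀ᶠ z in 𝓝 (extChartAt 𝓘(ℝ, E) x x),
        fderiv ℝ (mapRep (E := E) (E' := E') f x (f x)) z (fieldRep Y x z) =
          fieldRep X (f x) (mapRep (E := E) (E' := E') f x (f x) z) := by
    intro Y X h
    refine eventually_chart hx ?_
    filter_upwards [hev] with x' hx'
    rw [fieldRep_apply Y hx'.1, fderiv_mapRep hx'.1 hx'.2 (hf x'), h x', mapRep_apply f hx'.1,
      fieldRep_apply X hx'.2]
  apply dChart_injective hz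
  rw [← fderiv_mapRep hx hz (hf x), dChart_mlieBracket, dChart_mlieBracket, ← mapRep_apply f hx]
  refine lieBracket_related (contDiffAt_mapRep hx hz (hf x)) (hY₁.contDiffAt_fieldRep hx)
    (hY₂.contDiffAt_fieldRep hx) ?_ ?_ (rel h₁) (rel h₂)
  · rw [mapRep_apply f hx]; exact hX₁.contDiffAt_fieldRep hz
  · rw [mapRep_apply f hx]; exact hX₂.contDiffAt_fieldRep hz

theorem lieD_mlieBracket_eq_zero {α : OneForm E M} (hα : SmoothFormOn α univ) {X Y : VField E M}
    (hX : SmoothField X) (hY : SmoothField Y) (h1 : ∀ x v, lieD X α x v = 0)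
    (h2 : ∀ x v, lieD Y α x v = 0) (x : M) (v : TangentSpace 𝓘(ℝ, E) x) :
    lieD (VectorField.mlieBracket 𝓘(ℝ, E) X Y) α x v = 0 := by
  have hx := mem_chart_source E x
  have key : ∀ {Z : VField E M}, SmoothField Z → (∀ x v, lieD Z α x v = 0) →
      ∀ᶠ z in 𝓝 (extChartAt 𝓘(ℝ, E) x x), ∀ w, fderiv ℝ (chartRep α x) z (fieldRep Z x z) w +
        chartRep α x z (fderiv ℝ (fieldRep Z x) z w) = 0 := by
    intro Z hZ h
    refine eventually_chart hx ?_
    filter_upwards [eventually_mem_source hx] with x' hx' w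
    obtain ⟨v, rfl⟩ := dChart_surjective hx' w
    rw [← lieD_eq_chart isOpen_univ hα hZ hx' (mem_univ _), h]
  -- The coordinate formula is needed at all points near `x` in the one chart around `x`. At `x'` it
  -- is known in the chart around `x'`, and is carried over by the transition map, along which the
  -- coordinate fields are related.
  have hbr : fieldRep (VectorField.mlieBracket 𝓘(ℝ, E) X Y) x
      =ᶠ[𝓝 (extChartAt 𝓘(ℝ, E) x x)]
      fun z => fderiv ℝ (fieldRep Y x) z (fieldRep X x z) -
        fderiv ℝ (fieldRep X x) z (fieldRep Y x z) := by
    refine eventually_chart hx ?_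
    filter_upwards [eventually_mem_source hx] with x' hx'
    have hx1 := mem_chart_source E x'
    have rel : ∀ Z : VField E M, ∀ᶠ z in 𝓝 (extChartAt 𝓘(ℝ, E) x' x'),
        fderiv ℝ (mapRep (E := E) (E' := E) (id : M → M) x' x) z (fieldRep Z x' z) =
          fieldRep Z x (mapRep (E := E) (E' := E) (id : M → M) x' x z) := by
      intro Z
      refine eventually_chart hx1 ?_
      filter_upwards [eventually_mem_source hx1, eventually_mem_source hx'] with x'' h1 h2
      rw [fieldRep_apply Z h1, fderiv_mapRep h1 (by exact h2) contMDiffAt_id,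
        mapRep_apply _ h1, mfderiv_id]
      exact (fieldRep_apply Z h2).symm
    have hX' : ContDiffAt ℝ ∞ (fieldRep X x)
        (mapRep (E := E) (E' := E) (id : M → M) x' x (extChartAt 𝓘(ℝ, E) x' x')) := by
      rw [mapRep_apply _ hx1]; exact hX.contDiffAt_fieldRep hx'
    have hY' : ContDiffAt ℝ ∞ (fieldRep Y x)
        (mapRep (E := E) (E' := E) (id : M → M) x' x (extChartAt 𝓘(ℝ, E) x' x')) := by
      rw [mapRep_apply _ hx1]; exact hY.contDiffAt_fieldRep hx'
    have := lieBracket_related (contDiffAt_mapRep hx1 (f := (id : M → M)) (by exact hx')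
      contMDiffAt_id) (hX.contDiffAt_fieldRep hx1)
      (hY.contDiffAt_fieldRep hx1) hX' hY' (rel X) (rel Y)
    rw [← dChart_mlieBracket, fderiv_mapRep hx1 (by exact hx') contMDiffAt_id, mfderiv_id,
      mapRep_apply _ hx1] at this
    rw [fieldRep_apply _ hx']
    exact this
  rw [lieD_eq_chart isOpen_univ hα (hX.mlieBracket hY) hx (mem_univ _), hbr.fderiv_eq, hbr.self_of_nhds]
  exact lie_lieBracket_eq_zero (contDiffAt_chartRep isOpen_univ hα hx (mem_univ _))
    (hX.contDiffAt_fieldRep hx) (hY.contDiffAt_fieldRep hx) (key hX h1) (key hY h2) _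

/-- The exterior derivative of a one-form on a vector space, as a bilinear map. -/
def curlL (β : E → E →L[ℝ] ℝ) (y : E) : E →L[ℝ] E →L[ℝ] ℝ :=
  fderiv ℝ β y - (fderiv ℝ β y).flip

theorem curlL_apply (β : E → E →L[ℝ] ℝ) (y a b : E) : curlL β y a b = curl β y a b := rfl

/-- Nondegeneracy makes `dθ` an isomorphism from the tangent to the cotangent space. The solution is
its inverse applied to `α`, and inversion of linear maps is smooth. -/
theorem exists_contraction_eq {θ α : OneForm E M} (hθ : SmoothFormOn θ univ)
    (hnd : ∀ p v, (∀ w, extD θ p v w = 0) → v = 0)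
    (hα : ∀ x, SmoothFormAt α x) :
    ∃ Y : VField E M, SmoothField Y ∧ ∀ p v, extD θ p (Y p) v = α p v := by
  have := FiniteDimensional.complete ℝ E
  have hinv : ∀ {x₀ x : M}, x ∈ (chartAt E x₀).source →
      ∃ e : E ≃L[ℝ] E →L[ℝ] ℝ, (e : E →L[ℝ] E →L[ℝ] ℝ) =
        curlL (chartRep θ x₀) (extChartAt 𝓘(ℝ, E) x₀ x) := by
    intro x₀ x hx
    set B := curlL (chartRep θ x₀) (extChartAt 𝓘(ℝ, E) x₀ x)
    have hinj : Function.Injective B.toLinearMap := by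
      rw [← LinearMap.ker_eq_bot, LinearMap.ker_eq_bot']
      intro a ha
      obtain ⟨v, rfl⟩ := dChart_surjective hx a
      have hv := hnd x v fun w => by
        rw [extD_eq_curl isOpen_univ hθ hx (mem_univ _), ← curlL_apply]
        exact DFunLike.congr_fun ha _
      rw [hv, map_zero]
    have hdim : Module.finrank ℝ E = Module.finrank ℝ (E →L[ℝ] ℝ) := by
      rw [← (LinearMap.toContinuousLinearMap (𝕜 := ℝ) (E := E) (F' := ℝ)).finrank_eq]
      exact (Subspace.dual_finrank_eq (K := ℝ) (V := E)).symm
    refine ⟨(LinearEquiv.ofInjectiveOfFinrankEq B.toLinearMap hinj hdim).toContinuousLinearEquiv, ?_⟩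
    ext a b
    rfl
  have hsol : ∀ p, ∃ y : TangentSpace 𝓘(ℝ, E) p, ∀ v, extD θ p y v = α p v := by
    intro p
    have hp := mem_chart_source E p
    obtain ⟨e, he⟩ := hinv hp
    refine ⟨dChartSymm p p (e.symm (chartRep α p (extChartAt 𝓘(ℝ, E) p p))), fun v => ?_⟩
    rw [extD_eq_curl isOpen_univ hθ hp (mem_univ _), ← curlL_apply, ← he, dChart_dChartSymm hp,
      apply_eq_chartRep hp]
    simp
  choose Y hY using hsol
  refine ⟨Y, smoothField_of_fieldRep fun x => ?_, hY⟩
  have hx := mem_chart_source E x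
  obtain ⟨e, he⟩ := hinv hx
  have hcurl : ContDiffAt ℝ ∞ (curlL (chartRep θ x)) (extChartAt 𝓘(ℝ, E) x x) := by
    have h1 : ContDiffAt ℝ ∞ (fderiv ℝ (chartRep θ x)) (extChartAt 𝓘(ℝ, E) x x) :=
      (contDiffAt_chartRep isOpen_univ hθ hx (mem_univ _)).fderiv_right (by norm_cast)
    -- The transposed half is tested entry by entry.
    exact h1.sub (contDiffAt_clm_of_apply fun v => contDiffAt_clm_of_apply fun w =>
      (h1.clm_apply contDiffAt_const).clm_apply contDiffAt_const)
  have h2 : ContDiffAt ℝ ∞ (fun y => (curlL (chartRep θ x) y).inverse (chartRep α x y))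
      (extChartAt 𝓘(ℝ, E) x x) := by
    have h3 : ContDiffAt ℝ ∞ ContinuousLinearMap.inverse
        (curlL (chartRep θ x) (extChartAt 𝓘(ℝ, E) x x)) := by
      rw [← he]
      exact contDiffAt_map_inverse e
    exact ContDiffAt.clm_apply (h3.comp (extChartAt 𝓘(ℝ, E) x x) hcurl) (hα x)
  refine h2.congr_of_eventuallyEq (eventually_chart hx ?_)
  filter_upwards [eventually_mem_source hx] with x' hx'
  obtain ⟨e', he'⟩ := hinv hx'
  rw [fieldRep_apply Y hx', ← he', ContinuousLinearMap.inverse_equiv]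
  symm
  simp only [ContinuousLinearEquiv.coe_coe]
  rw [ContinuousLinearEquiv.symm_apply_eq]
  ext w
  obtain ⟨v, rfl⟩ := dChart_surjective hx' w
  rw [← apply_eq_chartRep hx', ← hY, extD_eq_curl isOpen_univ hθ hx' (mem_univ _), ← curlL_apply,
    ← he']
  rfl

/-- The differential of a function, as a one-form. -/
def dForm (f : M → ℝ) : OneForm E M := fun x => mvfderiv 𝓘(ℝ, E) f x

theorem dForm_apply (f : M → ℝ) (x : M) (v : TangentSpace 𝓘(ℝ, E) x) :
    dForm f x v = dirD f x v := rfl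

theorem smoothFormAt_dForm {f : M → ℝ} (hf : ContMDiff 𝓘(ℝ, E) 𝓘(ℝ, ℝ) ∞ f) (x : M) :
    SmoothFormAt (dForm (E := E) f) x := by
  have hx := mem_chart_source E x
  have h : ContDiffAt ℝ ∞ (fderiv ℝ (f ∘ (extChartAt 𝓘(ℝ, E) x).symm)) (extChartAt 𝓘(ℝ, E) x x) :=
    (contDiffAt_chart_of_contMDiffAt hx (hf x)).fderiv_right (by norm_cast)
  refine h.congr_of_eventuallyEq (eventually_chart hx ?_)
  filter_upwards [eventually_mem_source hx] with x' hx'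
  ext w
  rw [chartRep_apply hx', dForm_apply, dirD_eq hx' (hf x'), dChart_dChartSymm hx']

theorem contMDiff_dirD {f : M → ℝ} (hf : ContMDiff 𝓘(ℝ, E) 𝓘(ℝ, ℝ) ∞ f) {X : VField E M}
    (hX : SmoothField X) : ContMDiff 𝓘(ℝ, E) 𝓘(ℝ, ℝ) ∞ (fun x => dirD f x (X x)) :=
  fun x => contMDiffAt_apply_field (smoothFormAt_dForm hf x) hX

theorem SmoothField.add_smul {X Y : VField E M} (hX : SmoothField X) (hY : SmoothField Y)
    {f : M → ℝ} (hf : ContMDiff 𝓘(ℝ, E) 𝓘(ℝ, ℝ) ∞ f) : SmoothField (fun x => X x + f x • Y x) :=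
  ContMDiff.add_section hX (ContMDiff.smul_section hf hY)

end Fields

/-! ### From local to global injectivity of `(pr, σ)` -/

section InjectiveOnFibers

/-- A local homeomorphism `(pr, σ) : P → M × ℝ` from a Hausdorff space with preconnected
fibers of `pr` is injective. -/
theorem injective_of_localHomeomorph {P M : Type*} [TopologicalSpace P] [T2Space P]
    [TopologicalSpace M] {pr : P → M} {σ : P → ℝ}
    (hloc : ∀ q : P, ∃ e : OpenPartialHomeomorph P (M × ℝ), q ∈ e.source ∧
      ∀ p ∈ e.source, e p = (pr p, σ p))
    (hconn : ∀ x, IsPreconnected (pr ⁻¹' {x})) :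
    Function.Injective fun p => (pr p, σ p) := by
  set κ : P → M × ℝ := fun p => (pr p, σ p) with hκ
  have hlocinj : IsLocallyInjective κ := by
    intro q
    obtain ⟨e, hq, he⟩ := hloc q
    refine ⟨e.source, e.open_source, hq, fun a ha b hb hab => e.injOn ha hb ?_⟩
    rw [he a ha, he b hb]
    exact hab
  have hsep : IsSeparatedMap κ := T2Space.isSeparatedMap κ
  intro a b hab
  have hpr : pr a = pr b := congrArg Prod.fst hab
  have hσ : σ a = σ b := congrArg Prod.snd hab
  -- the points of the fiber reached from `a` by a section of `σ` over an interval
  let S : P → Prop := fun q => ∃ (I : Set ℝ) (s : ℝ → P), IsOpen I ∧ IsPreconnected I ∧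
    ContinuousOn s I ∧ (∀ u ∈ I, κ (s u) = (pr a, u)) ∧ σ a ∈ I ∧ σ q ∈ I ∧ s (σ a) = a ∧
    s (σ q) = q
  -- Reachability is locally all or nothing on the fiber: near `q₀` the local inverse `t` is a
  -- section over an interval `J`, and any section reaching a nearby point extends across `J`.
  have step : ∀ q₀, pr q₀ = pr a → ∃ W : Set P, IsOpen W ∧ q₀ ∈ W ∧ ∀ q ∈ W, ∀ q' ∈ W,
      pr q = pr a → pr q' = pr a → S q → S q' := by
    intro q₀ h₀
    obtain ⟨e, hq, he⟩ := hloc q₀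
    have ht : {u : ℝ | (pr a, u) ∈ e.target} ∈ 𝓝 (σ q₀) := by
      have : ContinuousAt (fun u : ℝ => (pr a, u)) (σ q₀) := by fun_prop
      refine this (e.open_target.mem_nhds ?_)
      beta_reduce
      rw [← h₀, ← he q₀ hq]
      exact e.map_source hq
    obtain ⟨ε, hε, hball⟩ := Metric.mem_nhds_iff.1 ht
    set J := Metric.ball (σ q₀) ε
    have hJ : ∀ u ∈ J, (pr a, u) ∈ e.target := hball
    have hσe : ContinuousOn (fun p => (e p).2) e.source :=
      continuous_snd.comp_continuousOn e.continuousOn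
    refine ⟨e.source ∩ (fun p => (e p).2) ⁻¹' J, hσe.isOpen_inter_preimage e.open_source
      Metric.isOpen_ball, ⟨hq, ?_⟩, ?_⟩
    · simpa [he q₀ hq, J] using hε
    rintro q ⟨hqs, hqJ⟩ q' ⟨hqs', hqJ'⟩ hqa hqa' ⟨I, s, hI, hIc, hs, hsec, haI, hqI, hsa, hsq⟩
    have hqJ : σ q ∈ J := by simpa [he q hqs] using hqJ
    have hqJ' : σ q' ∈ J := by simpa [he q' hqs'] using hqJ'
    set t : ℝ → P := fun u => e.symm (pr a, u)
    have htc : ContinuousOn t J := e.continuousOn_symm.comp (by fun_prop) hJ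
    have htsec : ∀ u ∈ J, κ (t u) = (pr a, u) := fun u hu => by
      have := e.right_inv (hJ u hu)
      rwa [he _ (e.map_target (hJ u hu))] at this
    have htq : ∀ r ∈ e.source, pr r = pr a → t (σ r) = r := fun r hr hra => by
      have := e.left_inv hr
      rwa [he r hr, hra] at this
    -- Two continuous lifts over an interval through a separated, locally injective map agree once
    -- they agree at one point, here `σ q`.
    have hagree : EqOn s t (I ∩ J) := by
      have hp : IsPreconnected (I ∩ J) := by
        have h1 := hIc.ordConnected
        have h2 : J.OrdConnected := (convex_ball (σ q₀) ε).ordConnected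
        exact (h1.inter h2).isPreconnected
      refine hsep.eqOn_of_comp_eqOn hlocinj hp (hs.mono inter_subset_left)
        (htc.mono inter_subset_right) (fun u hu => ?_) ⟨hqI, hqJ⟩ ?_
      · exact (hsec u hu.1).trans (htsec u hu.2).symm
      · rw [hsq, htq q hqs hqa]
    classical
    set r : ℝ → P := fun u => if u ∈ I then s u else t u
    have hrI : EqOn r s I := fun u hu => by simp [r, hu]
    have hrJ : EqOn r t J := fun u hu => by
      by_cases h : u ∈ I
      · rw [hrI h]; exact hagree ⟨h, hu⟩
      · simp [r, h]
    refine ⟨I ∪ J, r, hI.union Metric.isOpen_ball, ?_, ?_, ?_, Or.inl haI, Or.inr hqJ', ?_, ?_⟩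
    · exact IsPreconnected.union (σ q) hqI hqJ hIc (convex_ball (σ q₀) ε).isPreconnected
    · exact (hs.congr hrI).union_of_isOpen (htc.congr hrJ) hI Metric.isOpen_ball
    · rintro u (hu | hu)
      · rw [hrI hu]; exact hsec u hu
      · rw [hrJ hu]; exact htsec u hu
    · rw [hrI haI, hsa]
    · rw [hrJ hqJ', htq q' hqs' hqa']
  have hSa : S a := by
    obtain ⟨e, hq, he⟩ := hloc a
    have ht : {u : ℝ | (pr a, u) ∈ e.target} ∈ 𝓝 (σ a) := by
      have : ContinuousAt (fun u : ℝ => (pr a, u)) (σ a) := by fun_prop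
      refine this (e.open_target.mem_nhds ?_)
      beta_reduce
      rw [← he a hq]
      exact e.map_source hq
    obtain ⟨ε, hε, hball⟩ := Metric.mem_nhds_iff.1 ht
    have hta : e.symm (pr a, σ a) = a := by
      rw [← he a hq]
      exact e.left_inv hq
    refine ⟨Metric.ball (σ a) ε, fun u => e.symm (pr a, u), Metric.isOpen_ball,
      (convex_ball _ _).isPreconnected, e.continuousOn_symm.comp (by fun_prop) hball,
      fun u hu => ?_, Metric.mem_ball_self hε, Metric.mem_ball_self hε, hta, hta⟩
    have := e.right_inv (hball hu)
    rwa [he _ (e.map_target (hball hu))] at this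
  -- Connectedness of the fiber spreads reachability from `a` to `b`.
  have hSb : S a → S b := by
    refine (hconn (pr a)).induction₂' (fun q q' => S q → S q') ?_ ?_ rfl hpr.symm
    · intro q hq
      obtain ⟨W, hW, hqW, h⟩ := step q hq
      filter_upwards [inter_mem_nhdsWithin _ (hW.mem_nhds hqW)] with q' hq'
      exact ⟨h q hqW q' hq'.2 hq hq'.1, h q' hq'.2 q hqW hq'.1 hq⟩
    · intro x y z _ _ _ h1 h2 h
      exact h2 (h1 h)
  -- A single section takes the values `a` and `b` at the same parameter `σ a = σ b`.
  obtain ⟨I, s, -, -, -, -, -, -, hsa, hsb⟩ := hSb hSa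
  rw [← hsa, hσ, hsb]

end InjectiveOnFibers

/-! ### `(pr, σ)` as a local diffeomorphism -/

section LocalInverse

variable {E : Type*} [NormedAddCommGroup E] [NormedSpace ℝ E]
  {M : Type*} [TopologicalSpace M] [ChartedSpace E M] [IsManifold 𝓘(ℝ, E) ∞ M]
  {V : Type*} [NormedAddCommGroup V] [NormedSpace ℝ V] [FiniteDimensional ℝ V]
  {P : Type*} [TopologicalSpace P] [ChartedSpace V P] [IsManifold 𝓘(ℝ, V) ∞ P]

/-- The inverse function theorem for the map `(pr, σ) : P → M × ℝ`. -/
theorem exists_localInverse {pr : P → M} {σ : P → ℝ}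
    (hpr : ContMDiff 𝓘(ℝ, V) 𝓘(ℝ, E) ∞ pr) (hσ : ContMDiff 𝓘(ℝ, V) 𝓘(ℝ, ℝ) ∞ σ) (q : P)
    (hinj : ∀ v : TangentSpace 𝓘(ℝ, V) q, mfderiv 𝓘(ℝ, V) 𝓘(ℝ, E) pr q v = 0 →
      dirD σ q v = 0 → v = 0)
    (hsurj : ∀ (u : TangentSpace 𝓘(ℝ, E) (pr q)) (c : ℝ), ∃ v : TangentSpace 𝓘(ℝ, V) q,
      mfderiv 𝓘(ℝ, V) 𝓘(ℝ, E) pr q v = u ∧ dirD σ q v = c) :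
    ∃ e : OpenPartialHomeomorph P (M × ℝ), q ∈ e.source ∧ (∀ p ∈ e.source, e p = (pr p, σ p)) ∧
      ContMDiffAt (𝓘(ℝ, E).prod 𝓘(ℝ, ℝ)) 𝓘(ℝ, V) ∞ e.symm (pr q, σ q) := by
  have := FiniteDimensional.complete ℝ V
  have hq := mem_chart_source V q
  have hm := mem_chart_source E (pr q)
  set y := extChartAt 𝓘(ℝ, V) q q
  set g := mapRep (E := V) (E' := E) pr q (pr q)
  set s := σ ∘ (extChartAt 𝓘(ℝ, V) q).symm
  have hg : ContDiffAt ℝ ∞ g y := contDiffAt_mapRep hq hm (hpr q)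
  have hs : ContDiffAt ℝ ∞ s y := contDiffAt_chart_of_contMDiffAt hq (hσ q)
  set G : V → E × ℝ := fun z => (g z, s z)
  have hG : ContDiffAt ℝ ∞ G y := hg.prodMk hs
  set L : V →L[ℝ] E × ℝ := (fderiv ℝ g y).prod (fderiv ℝ s y)
  have hL : HasFDerivAt G L y :=
    (hasFDerivAt_of_contDiffAt hg).prodMk (hasFDerivAt_of_contDiffAt hs)
  have hLv : ∀ v : TangentSpace 𝓘(ℝ, V) q, L (dChart q q v) =
      (dChart (pr q) (pr q) (mfderiv 𝓘(ℝ, V) 𝓘(ℝ, E) pr q v), dirD σ q v) := by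
    intro v
    rw [dirD_eq hq (hσ q), ← fderiv_mapRep hq hm (hpr q)]
    rfl
  have hbij : Function.Bijective L.toLinearMap := by
    constructor
    · rw [← LinearMap.ker_eq_bot, LinearMap.ker_eq_bot']
      intro a ha
      obtain ⟨v, rfl⟩ := dChart_surjective hq a
      have h0 : L (dChart q q v) = 0 := ha
      rw [hLv, Prod.mk_eq_zero] at h0
      rw [hinj v (dChart_injective hm (by rw [h0.1, map_zero])) h0.2, map_zero]
    · rintro ⟨a, c⟩
      obtain ⟨u, rfl⟩ := dChart_surjective hm a
      obtain ⟨v, hv, hc⟩ := hsurj u c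
      exact ⟨dChart q q v, by rw [← hv, ← hc]; exact hLv v⟩
  let L' : V ≃L[ℝ] E × ℝ := (LinearEquiv.ofBijective L.toLinearMap hbij).toContinuousLinearEquiv
  have hL' : HasFDerivAt G (L' : V →L[ℝ] E × ℝ) y := hL
  let Φ := hG.toOpenPartialHomeomorph G hL' (by simp)
  let c : OpenPartialHomeomorph (M × ℝ) (E × ℝ) :=
    (chartAt E (pr q)).prod (OpenPartialHomeomorph.refl ℝ)
  have hopen : IsOpen (pr ⁻¹' (chartAt E (pr q)).source) :=
    (chartAt E (pr q)).open_source.preimage hpr.continuous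
  -- The chart domain is shrunk so that `pr` lands in the base chart; only there does undoing that
  -- chart recover `pr p`.
  let e := ((chartAt V q).restrOpen _ hopen).trans (Φ.trans c.symm)
  have hyΦ : y ∈ Φ.source := hG.mem_toOpenPartialHomeomorph_source hL' (by simp)
  have hGφ : ∀ p ∈ (chartAt V q).source, Φ (chartAt V q p) = (chartAt E (pr q) (pr p), σ p) := by
    intro p hp
    have h1 : Φ (chartAt V q p) = (g (extChartAt 𝓘(ℝ, V) q p), s (extChartAt 𝓘(ℝ, V) q p)) := rfl
    have h2 : g (extChartAt 𝓘(ℝ, V) q p) = extChartAt 𝓘(ℝ, E) (pr q) (pr p) := mapRep_apply pr hp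
    rw [h1, h2]
    simp only [s, Function.comp_apply]
    rw [(extChartAt 𝓘(ℝ, V) q).left_inv (by simpa using hp)]
    rfl
  have hce : ∀ p ∈ (chartAt V q).source, pr p ∈ (chartAt E (pr q)).source →
      c.symm (Φ (chartAt V q p)) = (pr p, σ p) := by
    intro p hp hp'
    rw [hGφ p hp]
    exact Prod.ext ((chartAt E (pr q)).left_inv hp') rfl
  have hqe : q ∈ e.source := by
    refine ⟨⟨hq, hm⟩, hyΦ, ?_⟩
    have : Φ (chartAt V q q) ∈ c.target := by
      rw [hGφ q hq]
      exact ⟨(chartAt E (pr q)).map_source hm, mem_univ _⟩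
    exact this
  refine ⟨e, hqe, fun p hp => hce p hp.1.1 hp.1.2, ?_⟩
  have h1 : ContMDiffAt (𝓘(ℝ, E).prod 𝓘(ℝ, ℝ)) 𝓘(ℝ, E × ℝ) ∞
      (fun z : M × ℝ => (extChartAt 𝓘(ℝ, E) (pr q) z.1, z.2)) (pr q, σ q) :=
    ContMDiffAt.prodMk_space
      (ContMDiffAt.comp (x := (pr q, σ q)) (contMDiffAt_extChartAt' hm) contMDiffAt_fst)
      contMDiffAt_snd
  have hval : ((extChartAt 𝓘(ℝ, E) (pr q) (pr q), σ q) : E × ℝ) = G y :=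
    (hGφ q hq).symm
  have h2 : ContMDiffAt 𝓘(ℝ, E × ℝ) 𝓘(ℝ, V) ∞ Φ.symm
      (extChartAt 𝓘(ℝ, E) (pr q) (pr q), σ q) := by
    rw [hval]
    exact (hG.to_localInverse hL' (by simp)).contMDiffAt
  have hback : Φ.symm (extChartAt 𝓘(ℝ, E) (pr q) (pr q), σ q) = y := by
    rw [hval]
    exact Φ.left_inv hyΦ
  have h3 : ContMDiffAt 𝓘(ℝ, V) 𝓘(ℝ, V) ∞ (extChartAt 𝓘(ℝ, V) q).symm
      (Φ.symm (extChartAt 𝓘(ℝ, E) (pr q) (pr q), σ q)) := by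
    rw [hback]
    exact (contMDiffOn_extChartAt_symm q).contMDiffAt
      (extChartAt_target_mem_nhds q)
  have h4 : ContMDiffAt (𝓘(ℝ, E).prod 𝓘(ℝ, ℝ)) 𝓘(ℝ, V) ∞
      (fun z : M × ℝ => Φ.symm (extChartAt 𝓘(ℝ, E) (pr q) z.1, z.2)) (pr q, σ q) :=
    ContMDiffAt.comp (pr q, σ q) h2 h1
  have h5 : ContMDiffAt (𝓘(ℝ, E).prod 𝓘(ℝ, ℝ)) 𝓘(ℝ, V) ∞ (fun z : M × ℝ =>
      (extChartAt 𝓘(ℝ, V) q).symm (Φ.symm (extChartAt 𝓘(ℝ, E) (pr q) z.1, z.2))) (pr q, σ q) :=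
    ContMDiffAt.comp (g := (extChartAt 𝓘(ℝ, V) q).symm) (pr q, σ q) h3 h4
  exact h5

end LocalInverse

/-! ### Sections, submersivity and descent for smooth fiber bundles -/

section Bundle

variable {E : Type*} [NormedAddCommGroup E] [NormedSpace ℝ E] [FiniteDimensional ℝ E]
  {M : Type*} [TopologicalSpace M] [ChartedSpace E M] [IsManifold 𝓘(ℝ, E) ∞ M]
  {V : Type*} [NormedAddCommGroup V] [NormedSpace ℝ V] [FiniteDimensional ℝ V]
  {P : Type u} [TopologicalSpace P] [ChartedSpace V P] [IsManifold 𝓘(ℝ, V) ∞ P]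
  {E' : Type*} [NormedAddCommGroup E'] [NormedSpace ℝ E'] [FiniteDimensional ℝ E']
  {N : Type*} [TopologicalSpace N] [ChartedSpace E' N] [IsManifold 𝓘(ℝ, E') ∞ N]
  {pr : P → M}

/-- Keep the fiber coordinate of `p` constant in a trivialization. -/
theorem IsSmoothFiberBundle.exists_section (h : IsSmoothFiberBundle (E := E) (V := V) pr) (p : P) :
    ∃ (U : Set M) (s : M → P), IsOpen U ∧ pr p ∈ U ∧ ContMDiffOn 𝓘(ℝ, E) 𝓘(ℝ, V) ∞ s U ∧
      (∀ x ∈ U, pr (s x) = x) ∧ s (pr p) = p := by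
  obtain ⟨k, F, _, _, _, e, he, h1, h2⟩ := h.2 (pr p)
  refine ⟨e.baseSet, fun x => e.toOpenPartialHomeomorph.symm (x, (e p).2), e.open_baseSet, he,
    ?_, fun x hx => e.proj_symm_apply' hx, ?_⟩
  · exact h2.comp (contMDiffOn_id.prodMk contMDiffOn_const) fun x hx => e.mem_target.2 hx
  · exact e.symm_apply_mk_proj (e.mem_source.2 he)

theorem IsSmoothFiberBundle.mfderiv_surjective (h : IsSmoothFiberBundle (E := E) (V := V) pr)
    (p : P) : Function.Surjective (mfderiv 𝓘(ℝ, V) 𝓘(ℝ, E) pr p) := by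
  obtain ⟨U, s, hU, hp, hs, hsec, hsp⟩ := h.exists_section p
  intro u
  have hs' := (hs.contMDiffAt (hU.mem_nhds hp)).mdifferentiableAt (by simp)
  have hpr : MDifferentiableAt 𝓘(ℝ, V) 𝓘(ℝ, E) pr (s (pr p)) := (h.1 _).mdifferentiableAt (by simp)
  have hev : (pr ∘ s) =ᶠ[𝓝 (pr p)] id := Filter.eventually_of_mem (hU.mem_nhds hp) hsec
  have hc := mfderiv_comp_apply (pr p) hpr hs' u
  rw [hev.mfderiv_eq, mfderiv_id] at hc
  -- The section passes through `p` only up to a propositional equality, so the tangent vector at `s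
  -- (pr p)` has to be transported.
  have key : ∀ q, q = p → ∀ v : TangentSpace 𝓘(ℝ, V) q, ∃ w : TangentSpace 𝓘(ℝ, V) p,
      (mfderiv 𝓘(ℝ, V) 𝓘(ℝ, E) pr p w : E) = mfderiv 𝓘(ℝ, V) 𝓘(ℝ, E) pr q v := by
    rintro q rfl v
    exact ⟨v, rfl⟩
  obtain ⟨w, hw⟩ := key _ hsp (mfderiv 𝓘(ℝ, E) 𝓘(ℝ, V) s (pr p) u)
  exact ⟨w, hw.trans hc.symm⟩

/-- A map on the base is smooth if its lift to the total space is. -/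
theorem IsSmoothFiberBundle.contMDiffAt_of_comp (h : IsSmoothFiberBundle (E := E) (V := V) pr)
    {g : M → N} (p : P) (hg : ContMDiffAt 𝓘(ℝ, V) 𝓘(ℝ, E') ∞ (fun p => g (pr p)) p) :
    ContMDiffAt 𝓘(ℝ, E) 𝓘(ℝ, E') ∞ g (pr p) := by
  obtain ⟨U, s, hU, hp, hs, hsec, hsp⟩ := h.exists_section p
  rw [← hsp] at hg
  refine (hg.comp (pr p) (hs.contMDiffAt (hU.mem_nhds hp))).congr_of_eventuallyEq ?_
  filter_upwards [hU.mem_nhds hp] with x hx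
  simp [hsec x hx]

/-- A map whose differential vanishes on the vertical vectors is constant on connected fibers. -/
theorem IsSmoothFiberBundle.eq_of_vertical (h : IsSmoothFiberBundle (E := E) (V := V) pr)
    {x : M} (hconn : IsPreconnected (pr ⁻¹' {x})) {ψ : P → N}
    (hψ : ∀ p, pr p = x → ContMDiffAt 𝓘(ℝ, V) 𝓘(ℝ, E') ∞ ψ p)
    (hvert : ∀ p, pr p = x → ∀ v, mfderiv 𝓘(ℝ, V) 𝓘(ℝ, E) pr p v = 0 →
      mfderiv 𝓘(ℝ, V) 𝓘(ℝ, E') ψ p v = 0) {p q : P} (hp : pr p = x) (hq : pr q = x) :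
    ψ p = ψ q := by
  refine hconn.induction₂ (fun p q => ψ p = ψ q) ?_ (fun _ _ _ _ _ _ => Eq.trans)
    (fun _ _ _ _ => Eq.symm) hp hq
  rintro p₀ rfl
  obtain ⟨k, F, _, _, _, e, he, h1, h2⟩ := h.2 (pr p₀)
  set y₀ := (e p₀).2
  set φ := extChartAt (𝓡 k) y₀
  -- `c` parametrizes the fiber near `p₀` by a chart of the typical fiber. Its velocities are
  -- vertical, so `ψ ∘ c` has zero derivative and is constant on a ball.
  set c : EuclideanSpace ℝ (Fin k) → P := fun z => e.toOpenPartialHomeomorph.symm (pr p₀, φ.symm z)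
  have hpc : ∀ z, pr (c z) = pr p₀ := fun z => e.proj_symm_apply' he
  have hc : ∀ z ∈ φ.target, ContMDiffAt (𝓡 k) 𝓘(ℝ, V) ∞ c z := by
    intro z hz
    have h3 := h2.contMDiffAt (x := (pr p₀, φ.symm z)) (e.open_target.mem_nhds (e.mem_target.2 he))
    have h4 : ContMDiffAt (𝓡 k) (𝓡 k) ∞ φ.symm z :=
      (contMDiffOn_extChartAt_symm y₀).contMDiffAt ((isOpen_extChartAt_target y₀).mem_nhds hz)
    exact h3.comp z (contMDiffAt_const.prodMk h4)
  have hsrc : p₀ ∈ e.source := e.mem_source.2 he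
  have hc₀ : c (φ y₀) = p₀ := by
    simp only [c]
    rw [φ.left_inv (mem_extChartAt_source y₀)]
    exact e.symm_apply_mk_proj hsrc
  set ξ := extChartAt 𝓘(ℝ, E') (ψ p₀)
  have hψc : ∀ z ∈ φ.target, ContMDiffAt (𝓡 k) 𝓘(ℝ, E') ∞ (ψ ∘ c) z := fun z hz =>
    (hψ _ (hpc z)).comp z (hc z hz)
  have hz₀ : φ y₀ ∈ φ.target := mem_extChartAt_target y₀
  have hgood : ∀ᶠ z in 𝓝 (φ y₀), z ∈ φ.target ∧ ψ (c z) ∈ (chartAt E' (ψ p₀)).source := by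
    refine Filter.Eventually.and ((isOpen_extChartAt_target y₀).mem_nhds hz₀)
      ((hψc _ hz₀).continuousAt.eventually ((chartAt E' (ψ p₀)).open_source.mem_nhds ?_))
    simp [hc₀]
  obtain ⟨ε, hε, hball⟩ := Metric.eventually_nhds_iff_ball.1 hgood
  have hd : ∀ z ∈ Metric.ball (φ y₀) ε,
      MDifferentiableAt (𝓡 k) 𝓘(ℝ, E') (ξ ∘ (ψ ∘ c)) z ∧
        mfderiv (𝓡 k) 𝓘(ℝ, E') (ξ ∘ (ψ ∘ c)) z = 0 := by
    intro z hz
    obtain ⟨hz1, hz2⟩ := hball z hz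
    have d1 : MDifferentiableAt 𝓘(ℝ, E') 𝓘(ℝ, E') ξ (ψ (c z)) :=
      mdifferentiableAt_extChartAt hz2
    have d2 := (hψc z hz1).mdifferentiableAt (by simp)
    have d3 : MDifferentiableAt 𝓘(ℝ, V) 𝓘(ℝ, E') ψ (c z) :=
      (hψ _ (hpc z)).mdifferentiableAt (by simp)
    have d4 := (hc z hz1).mdifferentiableAt (by simp)
    refine ⟨d1.comp z d2, ?_⟩
    rw [mfderiv_comp z d1 d2, mfderiv_comp z d3 d4]
    ext v
    have hv : mfderiv 𝓘(ℝ, V) 𝓘(ℝ, E) pr (c z) (mfderiv (𝓡 k) 𝓘(ℝ, V) c z v) = 0 := by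
      rw [← mfderiv_comp_apply z ((h.1 _).mdifferentiableAt (by simp)) d4]
      have : pr ∘ c = fun _ => pr p₀ := funext hpc
      rw [this, mfderiv_const]
      rfl
    simp only [ContinuousLinearMap.comp_apply]
    rw [hvert _ (hpc z) _ hv, map_zero]
    rfl
  have hconst : ∀ z ∈ Metric.ball (φ y₀) ε, ψ (c z) = ψ p₀ := by
    intro z hz
    have h3 := Metric.isOpen_ball.is_const_of_fderiv_eq_zero (𝕜 := ℝ) (f := ξ ∘ (ψ ∘ c))
      (convex_ball (φ y₀) ε).isPreconnected
      (fun z hz => (mdifferentiableAt_iff_differentiableAt.1 (hd z hz).1).differentiableWithinAt)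
      (fun z hz => by rw [← mfderiv_eq_fderiv]; exact (hd z hz).2) hz (Metric.mem_ball_self hε)
    simp only [Function.comp_apply, hc₀] at h3
    exact ξ.injOn (by simpa [ξ] using (hball z hz).2) (by simp [ξ]) h3
  have hnear : ∀ᶠ q in 𝓝 p₀, q ∈ e.source ∧ (e q).2 ∈ φ.source ∧
      φ (e q).2 ∈ Metric.ball (φ y₀) ε := by
    have hec : ContinuousAt (fun q => (e q).2) p₀ :=
      continuous_snd.continuousAt.comp (e.toOpenPartialHomeomorph.continuousAt hsrc)
    have h3 : ContinuousAt φ y₀ := continuousAt_extChartAt y₀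
    refine Filter.Eventually.and (e.open_source.mem_nhds hsrc) ((hec.eventually
      ((isOpen_extChartAt_source y₀).mem_nhds (mem_extChartAt_source y₀))).and
      (hec.eventually (h3.eventually (Metric.isOpen_ball.mem_nhds (Metric.mem_ball_self hε)))))
  filter_upwards [self_mem_nhdsWithin, nhdsWithin_le_nhds hnear] with q hq hq'
  rw [← hconst _ hq'.2.2]
  congr 1
  simp only [c]
  rw [φ.left_inv hq'.2.1, ← show pr q = pr p₀ from hq]
  exact e.symm_apply_mk_proj hq'.1

end Bundle

/-! ### Consequences of `θ = σ pr^*η` -/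

section Factor

variable {E : Type*} [NormedAddCommGroup E] [NormedSpace ℝ E] [FiniteDimensional ℝ E]
  {M : Type*} [TopologicalSpace M] [ChartedSpace E M] [IsManifold 𝓘(ℝ, E) ∞ M]
  {V : Type*} [NormedAddCommGroup V] [NormedSpace ℝ V] [FiniteDimensional ℝ V]
  {P : Type u} [TopologicalSpace P] [ChartedSpace V P] [IsManifold 𝓘(ℝ, V) ∞ P]

/-- `σ` is a conformal factor over the set `U`: `σ (pr^* η) = θ` holds over `U`. -/
structure IsConformalFactorOn (η : OneForm E M) (θ : OneForm V P) (pr : P → M)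
    (σ : P → ℝ) (U : Set M) : Prop where
  smooth : ∀ p, pr p ∈ U → ContMDiffAt 𝓘(ℝ, V) 𝓘(ℝ, ℝ) ∞ σ p
  ne_zero : ∀ p, pr p ∈ U → σ p ≠ 0
  eq : ∀ p, pr p ∈ U → σ p • pullForm pr η p = θ p

theorem IsConformalFactor.on_univ {η : OneForm E M} {θ : OneForm V P} {pr : P → M} {σ : P → ℝ}
    (h : IsConformalFactor η θ pr σ) : IsConformalFactorOn η θ pr σ univ :=
  ⟨fun p _ => h.smooth p, fun p _ => h.ne_zero p, fun p _ => h.eq p⟩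

theorem IsExactSymplectic.eq_of_extD {θ : OneForm V P} (hθ : IsExactSymplectic θ) {p : P}
    {v v' : TangentSpace 𝓘(ℝ, V) p} (h : ∀ w, extD θ p v w = extD θ p v' w) : v = v' := by
  rw [← sub_eq_zero]
  refine hθ.nondeg p _ fun w => ?_
  rw [extD_sub_left (hθ.smooth.smoothFormAt isOpen_univ (mem_univ p)), h w, sub_self, neg_zero]

theorem IsExactSymplectic.exists_contraction {θ : OneForm V P} (hθ : IsExactSymplectic θ)
    {α : OneForm V P} (hα : ∀ x, SmoothFormAt α x) :
    ∃ Y : VField V P, SmoothField Y ∧ ∀ p v, extD θ p (Y p) v = α p v :=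
  exists_contraction_eq hθ.smooth
    (fun p v h => hθ.nondeg p v fun w => by rw [h w, neg_zero]) hα

theorem IsExactSymplectic.exists_liouville {θ : OneForm V P} (hθ : IsExactSymplectic θ) :
    ∃ Δ : VField V P, IsLiouville θ Δ := by
  obtain ⟨Δ, h1, h2⟩ := hθ.exists_contraction
    (fun x => hθ.smooth.smoothFormAt isOpen_univ (mem_univ x))
  exact ⟨Δ, h1, fun p v => by rw [h2]⟩

theorem IsLiouville.extD_eq {θ : OneForm V P} {Δ : VField V P} (h : IsLiouville θ Δ) (p : P)
    (v : TangentSpace 𝓘(ℝ, V) p) : extD θ p (Δ p) v = θ p v :=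
  neg_injective (h.contr p v)

variable {η : OneForm E M} {θ : OneForm V P} {pr : P → M} {σ : P → ℝ} {U : Set M}

theorem IsConformalFactorOn.apply (h : IsConformalFactorOn η θ pr σ U) {p : P} (hp : pr p ∈ U)
    (v : TangentSpace 𝓘(ℝ, V) p) :
    θ p v = σ p * η (pr p) (mfderiv 𝓘(ℝ, V) 𝓘(ℝ, E) pr p v) := by
  rw [← h.eq p hp]
  rfl

theorem IsConformalFactorOn.extD_eq (h : IsConformalFactorOn η θ pr σ U) (hU : IsOpen U)
    (hη : SmoothFormOn η U) (hpr : ContMDiff 𝓘(ℝ, V) 𝓘(ℝ, E) ∞ pr) {p : P} (hp : pr p ∈ U)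
    (v w : TangentSpace 𝓘(ℝ, V) p) :
    extD θ p v w =
      dirD σ p v * η (pr p) (mfderiv 𝓘(ℝ, V) 𝓘(ℝ, E) pr p w) -
        dirD σ p w * η (pr p) (mfderiv 𝓘(ℝ, V) 𝓘(ℝ, E) pr p v) +
        σ p * extD η (pr p) (mfderiv 𝓘(ℝ, V) 𝓘(ℝ, E) pr p v)
          (mfderiv 𝓘(ℝ, V) 𝓘(ℝ, E) pr p w) := by
  have h1 : SmoothFormAt (pullForm (E₁ := V) pr η) p :=
    (hη.smoothFormAt hU hp).pullForm isOpen_univ (mem_univ p) hpr.contMDiffOn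
  have hev : ∀ᶠ q in 𝓝 p, θ q = σ q • pullForm (E₁ := V) pr η q := by
    filter_upwards [(hU.preimage hpr.continuous).mem_nhds hp] with q hq
    exact (h.eq q hq).symm
  rw [extD_congr (h1.smul (h.smooth p hp)) hev, extD_smul (h.smooth p hp) h1,
    extD_pullForm hU hη isOpen_univ hpr.contMDiffOn (mem_univ p) hp]
  rfl

/-- The Lie derivative of `θ = σ (pr^* η)` along a vector field that projects onto `X`. -/
theorem IsConformalFactorOn.lieD_eq (h : IsConformalFactorOn η θ pr σ U) (hU : IsOpen U)
    (hη : SmoothFormOn η U) (hpr : ContMDiff 𝓘(ℝ, V) 𝓘(ℝ, E) ∞ pr) {X : VField E M}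
    {Y : VField V P} (hX : SmoothField X) (hYX : ProjectsTo pr Y X) {p : P} (hp : pr p ∈ U)
    (w : TangentSpace 𝓘(ℝ, V) p) :
    lieD Y θ p w = dirD σ p (Y p) * η (pr p) (mfderiv 𝓘(ℝ, V) 𝓘(ℝ, E) pr p w) +
      σ p * lieD X η (pr p) (mfderiv 𝓘(ℝ, V) 𝓘(ℝ, E) pr p w) := by
  have hg := contMDiffAt_apply_field (hη.smoothFormAt hU hp) hX
  have hg' : ContMDiffAt 𝓘(ℝ, V) 𝓘(ℝ, ℝ) ∞ (fun q => η (pr q) (X (pr q))) p :=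
    ContMDiffAt.comp (g := fun x => η x (X x)) p hg (hpr p)
  have hev : (fun q => θ q (Y q)) =ᶠ[𝓝 p] fun q => σ q * η (pr q) (X (pr q)) := by
    filter_upwards [(hU.preimage hpr.continuous).mem_nhds hp] with q hq
    rw [h.apply hq, hYX q]
  rw [lieD, lieD, h.extD_eq hU hη hpr hp, dirD_congr hev,
    dirD_mul (h.smooth p hp) hg', dirD_comp (g := fun y => η y (X y)) (hpr p) hg, hYX p]
  ring

variable (hU : IsOpen U) (hη : IsContactFormOn η U) (hθ : IsExactSymplectic θ)
  (hb : IsSmoothFiberBundle (E := E) (V := V) pr)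

include hU hη hθ hb

/-- Insert `Δ` into the formula for `dθ`. From `θ(Δ) = dθ(Δ, Δ) = 0`, the projection of `Δ` lies in
`ker η`; testing against lifts of `ker η` shows that `dη` annihilates it there, so it is zero. What
remains is `σ η(u) = Δ(σ) η(u)`. -/
theorem IsConformalFactorOn.liouville (h : IsConformalFactorOn η θ pr σ U) {Δ : VField V P}
    (hΔ : IsLiouville θ Δ) {p : P} (hp : pr p ∈ U) :
    mfderiv 𝓘(ℝ, V) 𝓘(ℝ, E) pr p (Δ p) = 0 ∧ dirD σ p (Δ p) = σ p := by
  have hd := h.extD_eq hU hη.smooth hb.1 hp (Δ p)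
  have hηp := hη.smooth.smoothFormAt hU hp
  have hσ := h.ne_zero p hp
  have hx : η (pr p) (mfderiv 𝓘(ℝ, V) 𝓘(ℝ, E) pr p (Δ p)) = 0 := by
    have h1 : θ p (Δ p) = 0 := by
      rw [← hΔ.extD_eq, extD_self (hθ.smooth.smoothFormAt isOpen_univ (mem_univ p))]
    rw [h.apply hp] at h1
    exact (mul_eq_zero.1 h1).resolve_left hσ
  have hx0 : mfderiv 𝓘(ℝ, V) 𝓘(ℝ, E) pr p (Δ p) = 0 := by
    refine hη.nondeg _ hp _ hx fun u hu => ?_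
    obtain ⟨w, rfl⟩ := hb.mfderiv_surjective p u
    have h1 := hd w
    rw [hΔ.extD_eq, h.apply hp, hu, hx] at h1
    simpa [hσ] using h1
  refine ⟨hx0, ?_⟩
  obtain ⟨u, hu⟩ : ∃ u, η (pr p) u ≠ 0 := by
    by_contra! hc
    exact hη.ne_zero _ hp (ContinuousLinearMap.ext hc)
  obtain ⟨w, rfl⟩ := hb.mfderiv_surjective p u
  have h1 := hd w
  -- Writing the zero vector as `0 • 0` lets homogeneity in the first slot kill the `dη` term.
  rw [hΔ.extD_eq, h.apply hp, hx0, ← zero_smul ℝ (0 : TangentSpace 𝓘(ℝ, E) (pr p)),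
    extD_smul_left hηp] at h1
  simp only [map_smul, smul_eq_mul, zero_mul, mul_zero, sub_zero, add_zero] at h1
  exact (mul_right_cancel₀ hu h1).symm

/-- Every term of `dθ(v, ·)` contains `T pr(v)` or `v(σ)`, so nondegeneracy of `dθ` applies. -/
theorem IsConformalFactorOn.eq_zero (h : IsConformalFactorOn η θ pr σ U) {p : P}
    (hp : pr p ∈ U) {v : TangentSpace 𝓘(ℝ, V) p} (hv : mfderiv 𝓘(ℝ, V) 𝓘(ℝ, E) pr p v = 0)
    (hσv : dirD σ p v = 0) : v = 0 := by
  refine hθ.nondeg p v fun w => ?_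
  rw [h.extD_eq hU hη.smooth hb.1 hp, hv, hσv,
    ← zero_smul ℝ (0 : TangentSpace 𝓘(ℝ, E) (pr p)), extD_smul_left (hη.smooth.smoothFormAt hU hp)]
  simp

theorem IsConformalFactorOn.eq_of_eq (h : IsConformalFactorOn η θ pr σ U) {p : P}
    (hp : pr p ∈ U) {v v' : TangentSpace 𝓘(ℝ, V) p}
    (hv : mfderiv 𝓘(ℝ, V) 𝓘(ℝ, E) pr p v = mfderiv 𝓘(ℝ, V) 𝓘(ℝ, E) pr p v')
    (hσv : dirD σ p v = dirD σ p v') : v = v' := by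
  rw [← sub_eq_zero]
  refine h.eq_zero hU hη hθ hb hp (by rw [map_sub, hv, sub_self]) ?_
  have : dirD σ p (v - v') = dirD σ p v - dirD σ p v' := map_sub _ _ _
  rw [this, hσv, sub_self]

theorem IsConformalFactorOn.exists_lift (h : IsConformalFactorOn η θ pr σ U) {p : P}
    (hp : pr p ∈ U) (u : TangentSpace 𝓘(ℝ, E) (pr p)) (c : ℝ) :
    ∃ v : TangentSpace 𝓘(ℝ, V) p, mfderiv 𝓘(ℝ, V) 𝓘(ℝ, E) pr p v = u ∧ dirD σ p v = c := by
  obtain ⟨Δ, hΔ⟩ := hθ.exists_liouville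
  obtain ⟨h1, h2⟩ := h.liouville hU hη hθ hb hΔ hp
  obtain ⟨w, rfl⟩ := hb.mfderiv_surjective p u
  -- Adding a multiple of `Δ` adjusts the derivative of `σ` without changing the projection.
  refine ⟨w + ((c - dirD σ p w) / σ p) • Δ p, by rw [map_add, map_smul, h1, smul_zero, add_zero], ?_⟩
  have : dirD σ p (w + ((c - dirD σ p w) / σ p) • Δ p) =
      dirD σ p w + ((c - dirD σ p w) / σ p) * dirD σ p (Δ p) := by
    simp [dirD]
  rw [this, h2, div_mul_cancel₀ _ (h.ne_zero p hp)]
  ring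

/-- The fibers are one-dimensional, spanned by `Δ`: both sides have the same projection and the same
derivative of `σ`. -/
theorem IsConformalFactorOn.vertical (h : IsConformalFactorOn η θ pr σ U) {Δ : VField V P}
    (hΔ : IsLiouville θ Δ) {p : P} (hp : pr p ∈ U) {v : TangentSpace 𝓘(ℝ, V) p}
    (hv : mfderiv 𝓘(ℝ, V) 𝓘(ℝ, E) pr p v = 0) : v = (dirD σ p v / σ p) • Δ p := by
  obtain ⟨h1, h2⟩ := h.liouville hU hη hθ hb hΔ hp
  refine h.eq_of_eq hU hη hθ hb hp (by rw [hv, map_smul, h1, smul_zero]) ?_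
  have : dirD σ p ((dirD σ p v / σ p) • Δ p) = (dirD σ p v / σ p) * dirD σ p (Δ p) := by
    simp [dirD]
  rw [this, h2, div_mul_cancel₀ _ (h.ne_zero p hp)]

end Factor

/-! ### Existence of conformal factors -/

section FactorExistence

variable {E : Type*} [NormedAddCommGroup E] [NormedSpace ℝ E] [FiniteDimensional ℝ E]
  {M : Type*} [TopologicalSpace M] [ChartedSpace E M] [IsManifold 𝓘(ℝ, E) ∞ M]
  {V : Type*} [NormedAddCommGroup V] [NormedSpace ℝ V] [FiniteDimensional ℝ V]
  {P : Type u} [TopologicalSpace P] [ChartedSpace V P] [IsManifold 𝓘(ℝ, V) ∞ P]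

/-- Two nonzero linear forms, one of which vanishes on the kernel of the other, are
proportional. -/
theorem exists_smul_eq_of_ker_le {W : Type*} [AddCommGroup W] [Module ℝ W] [TopologicalSpace W]
    {α β : W →L[ℝ] ℝ} (hβ : β ≠ 0) (h : ∀ v, α v = 0 → β v = 0) :
    ∃ c : ℝ, c ≠ 0 ∧ c • β = α := by
  obtain ⟨w, hw⟩ : ∃ w, β w ≠ 0 := by
    by_contra! hc
    exact hβ (ContinuousLinearMap.ext hc)
  have hαw : α w ≠ 0 := fun h0 => hw (h w h0)
  refine ⟨α w / β w, div_ne_zero hαw hw, ContinuousLinearMap.ext fun v => ?_⟩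
  -- This vector is the component of `v` in `ker α` along `w`.
  have h1 := h (v - (α v / α w) • w) (by simp [hαw])
  rw [map_sub, map_smul, smul_eq_mul, sub_eq_zero] at h1
  rw [smul_apply, smul_eq_mul, h1]
  field_simp

theorem IsSmoothFiberBundle.pullForm_ne_zero {pr : P → M}
    (hb : IsSmoothFiberBundle (E := E) (V := V) pr) {η : OneForm E M} {p : P}
    (h : η (pr p) ≠ 0) : pullForm (E₁ := V) pr η p ≠ 0 := by
  refine fun h0 => h (ContinuousLinearMap.ext fun u => ?_)
  obtain ⟨v, rfl⟩ := hb.mfderiv_surjective p u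
  exact DFunLike.congr_fun h0 v

/-- The condition on kernels gives `ker θ ⊆ ker pr^*η`, and both forms are nonzero over `U`.
Smoothness holds because near `p` the factor is the quotient of their values on one vector `w` held
constant in the chart. -/
theorem IsSymplectization.exists_factor {D : Distrib E M} {η : OneForm E M} {θ : OneForm V P}
    {pr : P → M} {U : Set M} (hs : IsSymplectization D θ pr) (hU : IsOpen U)
    (hη : IsContactFormOn η U) (hθ : IsExactSymplectic θ) (hD : ∀ y ∈ U, D y = kerDist η y) :
    ∃ σ : P → ℝ, IsConformalFactorOn η θ pr σ U := by
  have hex : ∀ p, ∃ c : ℝ, pr p ∈ U → c ≠ 0 ∧ c • pullForm (E₁ := V) pr η p = θ p := by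
    intro p
    by_cases hp : pr p ∈ U
    · obtain ⟨c, hc⟩ := exists_smul_eq_of_ker_le
        (hs.bundle.pullForm_ne_zero (hη.ne_zero _ hp)) (α := θ p) fun v hv => by
          have h1 : mfderiv 𝓘(ℝ, V) 𝓘(ℝ, E) pr p v ∈ kerDist η (pr p) := by
            rw [← hD _ hp, ← hs.map_ker p]
            exact Submodule.mem_map_of_mem (f := (mfderiv 𝓘(ℝ, V) 𝓘(ℝ, E) pr p).toLinearMap) hv
          exact h1
      exact ⟨c, fun _ => hc⟩
    -- An arbitrary value, since nothing is required outside `U`.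
    · exact ⟨0, fun h => absurd h hp⟩
  choose σ hσ using hex
  refine ⟨σ, ⟨fun p hp => ?_, fun p hp => (hσ p hp).1, fun p hp => (hσ p hp).2⟩⟩
  have hx := mem_chart_source V p
  have h1 : SmoothFormAt (pullForm (E₁ := V) pr η) p :=
    (hη.smooth.smoothFormAt hU hp).pullForm isOpen_univ (mem_univ p) hs.bundle.1.contMDiffOn
  have h2 : SmoothFormAt θ p := hθ.smooth.smoothFormAt isOpen_univ (mem_univ p)
  obtain ⟨w, hw⟩ : ∃ w, pullForm (E₁ := V) pr η p w ≠ 0 := by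
    by_contra! hc
    exact hs.bundle.pullForm_ne_zero (hη.ne_zero _ hp) (ContinuousLinearMap.ext hc)
  have h1' : ContDiffAt ℝ ∞ (fun y => chartRep (pullForm (E₁ := V) pr η) p y (dChart p p w))
      (extChartAt 𝓘(ℝ, V) p p) := ContDiffAt.clm_apply h1 contDiffAt_const
  have h2' : ContDiffAt ℝ ∞ (fun y => chartRep θ p y (dChart p p w))
      (extChartAt 𝓘(ℝ, V) p p) := ContDiffAt.clm_apply h2 contDiffAt_const
  have hne : chartRep (pullForm (E₁ := V) pr η) p (extChartAt 𝓘(ℝ, V) p p) (dChart p p w) ≠ 0 := by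
    rwa [← apply_eq_chartRep hx]
  refine contMDiffAt_of_contDiffAt_chart hx (h2'.div h1' hne) ?_
  have hcont : ∀ᶠ q in 𝓝 p, chartRep (pullForm (E₁ := V) pr η) p (extChartAt 𝓘(ℝ, V) p q)
      (dChart p p w) ≠ 0 := by
    have := ContinuousAt.comp (x := p) h1'.continuousAt (continuousAt_extChartAt (I := 𝓘(ℝ, V)) p)
    exact this.eventually_ne hne
  filter_upwards [hcont, eventually_mem_source hx,
    (hU.preimage hs.bundle.1.continuous).mem_nhds hp] with q hq1 hq2 hq3
  rw [Pi.div_apply, eq_div_iff hq1, chartRep_apply hq2, chartRep_apply hq2, ← (hσ q hq3).2]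
  rfl

end FactorExistence

/-! ### Points of the total space as pairs of base point and `σ`-value -/

section PartOne

/-- A symplectization with connected fibers of a contact form, with its conformal factor. -/
structure IsSymplectizationOfForm {E : Type*} [NormedAddCommGroup E] [NormedSpace ℝ E]
    {M : Type*} [TopologicalSpace M] [ChartedSpace E M] [IsManifold 𝓘(ℝ, E) ∞ M]
    {V : Type*} [NormedAddCommGroup V] [NormedSpace ℝ V]
    {P : Type u} [TopologicalSpace P] [ChartedSpace V P] [IsManifold 𝓘(ℝ, V) ∞ P]
    (η : OneForm E M) (θ : OneForm V P) (pr : P → M) (σ : P → ℝ) : Prop where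
  contact : IsContactForm η
  exact_sympl : IsExactSymplectic θ
  bundle : IsSmoothFiberBundle (E := E) (V := V) pr
  conn : ∀ x, IsConnected (pr ⁻¹' {x})
  factor : IsConformalFactor η θ pr σ

variable {E : Type*} [NormedAddCommGroup E] [NormedSpace ℝ E] [FiniteDimensional ℝ E]
  {M : Type*} [TopologicalSpace M] [ChartedSpace E M] [IsManifold 𝓘(ℝ, E) ∞ M]
  {V : Type*} [NormedAddCommGroup V] [NormedSpace ℝ V] [FiniteDimensional ℝ V]
  {P : Type*} [TopologicalSpace P] [ChartedSpace V P] [IsManifold 𝓘(ℝ, V) ∞ P]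
  {E' : Type*} [NormedAddCommGroup E'] [NormedSpace ℝ E'] [FiniteDimensional ℝ E']
  {N : Type*} [TopologicalSpace N] [ChartedSpace E' N] [IsManifold 𝓘(ℝ, E') ∞ N]

theorem IsSymplectizationOfForm.exists_localInverse {η : OneForm E M} {θ : OneForm V P}
    {pr : P → M} {σ : P → ℝ} (h : IsSymplectizationOfForm η θ pr σ) (q : P) :
    ∃ e : OpenPartialHomeomorph P (M × ℝ), q ∈ e.source ∧ (∀ p ∈ e.source, e p = (pr p, σ p)) ∧
      ContMDiffAt (𝓘(ℝ, E).prod 𝓘(ℝ, ℝ)) 𝓘(ℝ, V) ∞ e.symm (pr q, σ q) :=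
  ContactSymp.exists_localInverse h.bundle.1 h.factor.smooth q
    (fun _ h1 h2 => h.factor.on_univ.eq_zero isOpen_univ h.contact h.exact_sympl h.bundle
      (mem_univ _) h1 h2)
    (fun u c => h.factor.on_univ.exists_lift isOpen_univ h.contact h.exact_sympl h.bundle
      (mem_univ _) u c)

theorem IsSymplectizationOfForm.injective [T2Space P] {η : OneForm E M} {θ : OneForm V P}
    {pr : P → M} {σ : P → ℝ} (h : IsSymplectizationOfForm η θ pr σ) {p q : P}
    (h1 : pr p = pr q) (h2 : σ p = σ q) : p = q := by
  refine injective_of_localHomeomorph (pr := pr) (σ := σ) (fun q => ?_)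
    (fun x => (h.conn x).isPreconnected) (Prod.ext h1 h2)
  obtain ⟨e, he, he', -⟩ := h.exists_localInverse q
  exact ⟨e, he, he'⟩

theorem IsSymplectizationOfForm.surjective {η : OneForm E M} {θ : OneForm V P}
    {pr : P → M} {σ : P → ℝ} (h : IsSymplectizationOfForm η θ pr σ) (x : M) : ∃ p, pr p = x :=
  (h.conn x).nonempty

/-- A map into the total space is smooth if its base component and its `σ`-component are. -/
theorem IsSymplectizationOfForm.contMDiff_of_comp [T2Space P] {η : OneForm E M}
    {θ : OneForm V P} {pr : P → M} {σ : P → ℝ} (h : IsSymplectizationOfForm η θ pr σ)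
    {Φ : N → P} (h1 : ContMDiff 𝓘(ℝ, E') 𝓘(ℝ, E) ∞ fun y => pr (Φ y))
    (h2 : ContMDiff 𝓘(ℝ, E') 𝓘(ℝ, ℝ) ∞ fun y => σ (Φ y)) :
    ContMDiff 𝓘(ℝ, E') 𝓘(ℝ, V) ∞ Φ := by
  intro y
  obtain ⟨e, he, he', hsm⟩ := h.exists_localInverse (Φ y)
  have h3 : ContMDiffAt 𝓘(ℝ, E') (𝓘(ℝ, E).prod 𝓘(ℝ, ℝ)) ∞ (fun y => (pr (Φ y), σ (Φ y))) y :=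
    (h1 y).prodMk (h2 y)
  have h4 := ContMDiffAt.comp (f := fun y => (pr (Φ y), σ (Φ y))) y hsm h3
  refine h4.congr_of_eventuallyEq ?_
  have h5 : ∀ᶠ z in 𝓝 y, (pr (Φ z), σ (Φ z)) ∈ e.target := by
    refine h3.continuousAt.eventually (e.open_target.mem_nhds ?_)
    beta_reduce
    rw [← he' _ he]
    exact e.map_source he
  filter_upwards [h5] with z hz
  -- Continuity of `Φ` is not known, so `Φ z` need not be assumed to lie in `e.source`; global
  -- injectivity identifies it with the local inverse.
  have h6 := e.right_inv hz
  rw [he' _ (e.map_target hz)] at h6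
  exact h.injective (congrArg Prod.fst h6).symm (congrArg Prod.snd h6).symm

end PartOne

/-! ### Composition of pullbacks -/

section Pull

variable {E₁ : Type*} [NormedAddCommGroup E₁] [NormedSpace ℝ E₁]
  {M₁ : Type*} [TopologicalSpace M₁] [ChartedSpace E₁ M₁] [IsManifold 𝓘(ℝ, E₁) ∞ M₁]
  {E₂ : Type*} [NormedAddCommGroup E₂] [NormedSpace ℝ E₂]
  {M₂ : Type*} [TopologicalSpace M₂] [ChartedSpace E₂ M₂] [IsManifold 𝓘(ℝ, E₂) ∞ M₂]
  {E₃ : Type*} [NormedAddCommGroup E₃] [NormedSpace ℝ E₃]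
  {M₃ : Type*} [TopologicalSpace M₃] [ChartedSpace E₃ M₃] [IsManifold 𝓘(ℝ, E₃) ∞ M₃]

theorem pullForm_comp {g : M₂ → M₃} {f : M₁ → M₂} (hg : ContMDiff 𝓘(ℝ, E₂) 𝓘(ℝ, E₃) ∞ g)
    (hf : ContMDiff 𝓘(ℝ, E₁) 𝓘(ℝ, E₂) ∞ f) (α : OneForm E₃ M₃) :
    pullForm (E₁ := E₁) (g ∘ f) α = pullForm f (pullForm (E₁ := E₂) g α) := by
  funext x
  unfold pullForm
  rw [mfderiv_comp x ((hg _).mdifferentiableAt (by simp)) ((hf _).mdifferentiableAt (by simp))]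
  rfl

theorem IsHomSympl.pull_eq {θ₁ : OneForm E₁ M₁} {θ₂ : OneForm E₂ M₂}
    {Φ : M₁ ≃ₘ⟮𝓘(ℝ, E₁), 𝓘(ℝ, E₂)⟯ M₂} (h : IsHomSympl θ₁ θ₂ Φ) : pullForm Φ θ₂ = θ₁ :=
  funext h

theorem IsHomSympl.symm {θ₁ : OneForm E₁ M₁} {θ₂ : OneForm E₂ M₂}
    {Φ : M₁ ≃ₘ⟮𝓘(ℝ, E₁), 𝓘(ℝ, E₂)⟯ M₂} (h : IsHomSympl θ₁ θ₂ Φ) : IsHomSympl θ₂ θ₁ Φ.symm := by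
  intro q
  have : Φ ∘ Φ.symm = id := funext Φ.apply_symm_apply
  rw [← h.pull_eq, ← pullForm_comp Φ.contMDiff Φ.symm.contMDiff, this, pullForm_id]

theorem IsHomSympl.trans {θ₁ : OneForm E₁ M₁} {θ₂ : OneForm E₂ M₂} {θ₃ : OneForm E₃ M₃}
    {Φ : M₁ ≃ₘ⟮𝓘(ℝ, E₁), 𝓘(ℝ, E₂)⟯ M₂} {Ψ : M₂ ≃ₘ⟮𝓘(ℝ, E₂), 𝓘(ℝ, E₃)⟯ M₃}
    (h : IsHomSympl θ₁ θ₂ Φ) (h' : IsHomSympl θ₂ θ₃ Ψ) : IsHomSympl θ₁ θ₃ (Φ.trans Ψ) := by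
  intro p
  rw [Diffeomorph.coe_trans, pullForm_comp Ψ.contMDiff Φ.contMDiff, h'.pull_eq, h.pull_eq]

theorem IsContactFactor.trans {η₁ : OneForm E₁ M₁} {η₂ : OneForm E₂ M₂} {η₃ : OneForm E₃ M₃}
    {F : M₁ ≃ₘ⟮𝓘(ℝ, E₁), 𝓘(ℝ, E₂)⟯ M₂} {G : M₂ ≃ₘ⟮𝓘(ℝ, E₂), 𝓘(ℝ, E₃)⟯ M₃} {f : M₁ → ℝ}
    {g : M₂ → ℝ} (hf : IsContactFactor η₁ η₂ F f) (hg : IsContactFactor η₂ η₃ G g) :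
    IsContactFactor η₁ η₃ (F.trans G) fun x => g (F x) * f x where
  smooth := (hg.smooth.comp F.contMDiff).mul hf.smooth
  ne_zero x := mul_ne_zero (hg.ne_zero _) (hf.ne_zero _)
  pull x := by
    rw [Diffeomorph.coe_trans, pullForm_comp G.contMDiff F.contMDiff, mul_smul, ← hf.pull]
    unfold pullForm
    have := hg.pull (F x)
    unfold pullForm at this
    rw [this]
    rfl

end Pull

/-! ### Homogeneous symplectomorphisms and contactomorphisms -/

section PartOne

variable {E₁ : Type*} [NormedAddCommGroup E₁] [NormedSpace ℝ E₁] [FiniteDimensional ℝ E₁]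
  {M₁ : Type*} [TopologicalSpace M₁] [ChartedSpace E₁ M₁] [IsManifold 𝓘(ℝ, E₁) ∞ M₁]
  {V₁ : Type*} [NormedAddCommGroup V₁] [NormedSpace ℝ V₁] [FiniteDimensional ℝ V₁]
  {P₁ : Type*} [TopologicalSpace P₁] [ChartedSpace V₁ P₁] [IsManifold 𝓘(ℝ, V₁) ∞ P₁]
  {E₂ : Type*} [NormedAddCommGroup E₂] [NormedSpace ℝ E₂] [FiniteDimensional ℝ E₂]
  {M₂ : Type*} [TopologicalSpace M₂] [ChartedSpace E₂ M₂] [IsManifold 𝓘(ℝ, E₂) ∞ M₂]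
  {V₂ : Type*} [NormedAddCommGroup V₂] [NormedSpace ℝ V₂] [FiniteDimensional ℝ V₂]
  {P₂ : Type*} [TopologicalSpace P₂] [ChartedSpace V₂ P₂] [IsManifold 𝓘(ℝ, V₂) ∞ P₂]
  {η₁ : OneForm E₁ M₁} {θ₁ : OneForm V₁ P₁} {pr₁ : P₁ → M₁} {σ₁ : P₁ → ℝ}
  {η₂ : OneForm E₂ M₂} {θ₂ : OneForm V₂ P₂} {pr₂ : P₂ → M₂} {σ₂ : P₂ → ℝ}

/-- `Φ` preserves both `θ` and `dθ`, so the image of `Δ₁` solves the equation defining `Δ₂`. -/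
theorem IsHomSympl.mfderiv_liouville (hθ₂ : IsExactSymplectic θ₂)
    {Φ : P₁ ≃ₘ⟮𝓘(ℝ, V₁), 𝓘(ℝ, V₂)⟯ P₂} (h : IsHomSympl θ₁ θ₂ Φ) {Δ₁ : VField V₁ P₁}
    {Δ₂ : VField V₂ P₂} (h₁ : IsLiouville θ₁ Δ₁) (h₂ : IsLiouville θ₂ Δ₂) (p : P₁) :
    mfderiv 𝓘(ℝ, V₁) 𝓘(ℝ, V₂) Φ p (Δ₁ p) = Δ₂ (Φ p) := by
  refine hθ₂.eq_of_extD fun w => ?_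
  obtain ⟨v, rfl⟩ : ∃ v, mfderiv 𝓘(ℝ, V₁) 𝓘(ℝ, V₂) Φ p v = w := by
    rw [← Φ.mfderivToContinuousLinearEquiv_coe (by simp)]
    exact (Φ.mfderivToContinuousLinearEquiv (by simp) p).surjective w
  rw [← extD_pullForm isOpen_univ hθ₂.smooth isOpen_univ Φ.contMDiff.contMDiffOn (mem_univ p)
    (mem_univ _), h.pull_eq, h₁.extD_eq, h₂.extD_eq, ← h p]
  rfl

theorem pullForm_covers {Φ : P₁ → P₂} {F : M₁ → M₂} (hpr₁ : ContMDiff 𝓘(ℝ, V₁) 𝓘(ℝ, E₁) ∞ pr₁)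
    (hpr₂ : ContMDiff 𝓘(ℝ, V₂) 𝓘(ℝ, E₂) ∞ pr₂) (hΦ : ContMDiff 𝓘(ℝ, V₁) 𝓘(ℝ, V₂) ∞ Φ)
    (hF : ContMDiff 𝓘(ℝ, E₁) 𝓘(ℝ, E₂) ∞ F) (hc : Covers pr₁ pr₂ F Φ) (α : OneForm E₂ M₂) :
    pullForm (E₁ := V₁) Φ (pullForm (E₁ := V₂) pr₂ α) =
      pullForm pr₁ (pullForm (E₁ := E₁) F α) := by
  rw [← pullForm_comp hpr₂ hΦ, ← pullForm_comp hF hpr₁]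
  exact congrArg (fun g => pullForm g α) (funext hc)

variable (h₁ : IsSymplectizationOfForm η₁ θ₁ pr₁ σ₁) (h₂ : IsSymplectizationOfForm η₂ θ₂ pr₂ σ₂)

include h₁ h₂

theorem pullForm_theta_of_covers {Φ : P₁ → P₂} {F : M₁ → M₂}
    (hΦ : ContMDiff 𝓘(ℝ, V₁) 𝓘(ℝ, V₂) ∞ Φ)
    (hF : ContMDiff 𝓘(ℝ, E₁) 𝓘(ℝ, E₂) ∞ F) (hc : Covers pr₁ pr₂ F Φ) (p : P₁) :
    pullForm (E₁ := V₁) Φ θ₂ p =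
      σ₂ (Φ p) • pullForm (E₁ := V₁) pr₁ (pullForm (E₁ := E₁) F η₂) p := by
  rw [← pullForm_covers h₁.bundle.1 h₂.bundle.1 hΦ hF hc]
  unfold pullForm
  have := h₂.factor.eq (Φ p)
  unfold pullForm at this
  rw [← this]
  rfl

/-- Vertical vectors are multiples of `Δ₁`, sent to multiples of the vertical field `Δ₂`; thus `pr₂
∘ Φ` is constant on connected fibers. -/
theorem IsHomSympl.eq_of_pr_eq {Φ : P₁ ≃ₘ⟮𝓘(ℝ, V₁), 𝓘(ℝ, V₂)⟯ P₂} (h : IsHomSympl θ₁ θ₂ Φ)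
    {p q : P₁} (hpq : pr₁ p = pr₁ q) : pr₂ (Φ p) = pr₂ (Φ q) := by
  obtain ⟨Δ₁, hΔ₁⟩ := h₁.exact_sympl.exists_liouville
  obtain ⟨Δ₂, hΔ₂⟩ := h₂.exact_sympl.exists_liouville
  refine h₁.bundle.eq_of_vertical (h₁.conn (pr₁ q)).isPreconnected (ψ := fun p => pr₂ (Φ p))
    (fun p _ => (h₂.bundle.1.comp Φ.contMDiff) p) (fun p _ v hv => ?_) hpq rfl
  have hd : mfderiv 𝓘(ℝ, V₁) 𝓘(ℝ, E₂) (fun p => pr₂ (Φ p)) p v =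
      mfderiv 𝓘(ℝ, V₂) 𝓘(ℝ, E₂) pr₂ (Φ p) (mfderiv 𝓘(ℝ, V₁) 𝓘(ℝ, V₂) Φ p v) :=
    mfderiv_comp_apply p ((h₂.bundle.1 _).mdifferentiableAt (by simp))
      ((Φ.contMDiff _).mdifferentiableAt (by simp)) v
  rw [hd, h₁.factor.on_univ.vertical isOpen_univ h₁.contact h₁.exact_sympl h₁.bundle hΔ₁
    (mem_univ _) hv, map_smul, h.mfderiv_liouville h₂.exact_sympl hΔ₁ hΔ₂, map_smul,
    (h₂.factor.on_univ.liouville isOpen_univ h₂.contact h₂.exact_sympl h₂.bundle hΔ₂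
      (mem_univ _)).1, smul_zero]

theorem IsHomSympl.exists_map {Φ : P₁ ≃ₘ⟮𝓘(ℝ, V₁), 𝓘(ℝ, V₂)⟯ P₂} (h : IsHomSympl θ₁ θ₂ Φ) :
    ∃ F : M₁ → M₂, ContMDiff 𝓘(ℝ, E₁) 𝓘(ℝ, E₂) ∞ F ∧ Covers pr₁ pr₂ F Φ := by
  -- The section is merely set-theoretic; smoothness of the induced map is tested after composing
  -- with `pr₁`.
  choose s hs using h₁.surjective
  have hc : Covers pr₁ pr₂ (fun x => pr₂ (Φ (s x))) Φ := fun p =>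
    h.eq_of_pr_eq h₁ h₂ (hs (pr₁ p)).symm
  refine ⟨fun x => pr₂ (Φ (s x)), fun x => ?_, hc⟩
  obtain ⟨p, rfl⟩ := h₁.surjective x
  refine h₁.bundle.contMDiffAt_of_comp p ?_
  have : (fun p => pr₂ (Φ (s (pr₁ p)))) = fun p => pr₂ (Φ p) := (funext hc).symm
  rw [this]
  exact (h₂.bundle.1.comp Φ.contMDiff) p

/-- The factor is `σ₁ / (σ₂ ∘ Φ)`. It is constant on fibers because it is the coefficient of the
nonzero form `η₁` in `F^*η₂`. -/
theorem IsHomSympl.isContactomorphism {Φ : P₁ ≃ₘ⟮𝓘(ℝ, V₁), 𝓘(ℝ, V₂)⟯ P₂}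
    (h : IsHomSympl θ₁ θ₂ Φ) {F : M₁ ≃ₘ⟮𝓘(ℝ, E₁), 𝓘(ℝ, E₂)⟯ M₂} (hc : Covers pr₁ pr₂ F Φ) :
    IsContactomorphism η₁ η₂ F := by
  have hpull : ∀ p, pullForm F η₂ (pr₁ p) = (σ₁ p / σ₂ (Φ p)) • η₁ (pr₁ p) := by
    intro p
    ext u
    obtain ⟨v, rfl⟩ := h₁.bundle.mfderiv_surjective p u
    have h3 := pullForm_theta_of_covers h₁ h₂ Φ.contMDiff F.contMDiff hc p
    rw [h p, ← h₁.factor.eq p] at h3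
    have h4 := DFunLike.congr_fun h3 v
    have h5 : σ₁ p * η₁ (pr₁ p) (mfderiv 𝓘(ℝ, V₁) 𝓘(ℝ, E₁) pr₁ p v) =
      σ₂ (Φ p) * pullForm F η₂ (pr₁ p) (mfderiv 𝓘(ℝ, V₁) 𝓘(ℝ, E₁) pr₁ p v) := h4
    rw [smul_apply, smul_eq_mul, div_mul_eq_mul_div, h5,
      mul_div_cancel_left₀ _ (h₂.factor.ne_zero _)]
  choose s hs using h₁.surjective
  have hf : ∀ p, σ₁ (s (pr₁ p)) / σ₂ (Φ (s (pr₁ p))) = σ₁ p / σ₂ (Φ p) := by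
    intro p
    have h3 := hpull (s (pr₁ p))
    rw [hs, hpull p] at h3
    exact (smul_left_injective ℝ (h₁.contact.ne_zero _ (mem_univ _)) h3).symm
  refine ⟨fun x => σ₁ (s x) / σ₂ (Φ (s x)), ⟨fun x => ?_, fun x =>
    div_ne_zero (h₁.factor.ne_zero _) (h₂.factor.ne_zero _), fun x => ?_⟩⟩
  · obtain ⟨p, rfl⟩ := h₁.surjective x
    refine h₁.bundle.contMDiffAt_of_comp p ?_
    rw [show (fun p => σ₁ (s (pr₁ p)) / σ₂ (Φ (s (pr₁ p)))) = fun p => σ₁ p / σ₂ (Φ p) from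
      funext hf]
    exact (h₁.factor.smooth p).div₀ ((h₂.factor.smooth.comp Φ.contMDiff) p) (h₂.factor.ne_zero _)
  · have h3 := hpull (s x)
    rwa [hs] at h3

theorem IsHomSympl.exists_contactomorphism {Φ : P₁ ≃ₘ⟮𝓘(ℝ, V₁), 𝓘(ℝ, V₂)⟯ P₂}
    (h : IsHomSympl θ₁ θ₂ Φ) : ∃ F : M₁ ≃ₘ⟮𝓘(ℝ, E₁), 𝓘(ℝ, E₂)⟯ M₂,
      Covers pr₁ pr₂ F Φ ∧ IsContactomorphism η₁ η₂ F ∧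
      ∀ G : M₁ → M₂, Covers pr₁ pr₂ G Φ → G = F := by
  obtain ⟨F, hF, hFc⟩ := h.exists_map h₁ h₂
  obtain ⟨G, hG, hGc⟩ := h.symm.exists_map h₂ h₁
  let F' : M₁ ≃ₘ⟮𝓘(ℝ, E₁), 𝓘(ℝ, E₂)⟯ M₂ :=
    { toFun := F
      invFun := G
      left_inv := fun x => by
        obtain ⟨p, rfl⟩ := h₁.surjective x
        rw [← hFc, ← hGc, Φ.symm_apply_apply]
      right_inv := fun x => by
        obtain ⟨p, rfl⟩ := h₂.surjective x
        rw [← hGc, ← hFc, Φ.apply_symm_apply]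
      contMDiff_toFun := hF
      contMDiff_invFun := hG }
  have hF'c : Covers pr₁ pr₂ F' Φ := hFc
  refine ⟨F', hF'c, h.isContactomorphism h₁ h₂ hF'c, fun G hG => funext fun x => ?_⟩
  obtain ⟨p, rfl⟩ := h₁.surjective x
  rw [← hG, ← hF'c]

variable {F : M₁ ≃ₘ⟮𝓘(ℝ, E₁), 𝓘(ℝ, E₂)⟯ M₂} {f : M₁ → ℝ}

/-- Both forms are multiples of `pr₁^*η₁`, with coefficients `(σ₂ ∘ Φ)(f ∘ pr₁)` and `σ₁`, and
`pr₁^*η₁` vanishes nowhere. -/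
theorem isHomSympl_iff (hf : IsContactFactor η₁ η₂ F f) {Φ : P₁ ≃ₘ⟮𝓘(ℝ, V₁), 𝓘(ℝ, V₂)⟯ P₂}
    (hc : Covers pr₁ pr₂ F Φ) :
    IsHomSympl θ₁ θ₂ Φ ↔ ∀ p, σ₂ (Φ p) = σ₁ p / f (pr₁ p) := by
  refine forall_congr' fun p => ?_
  have h3 : pullForm Φ θ₂ p =
      (σ₂ (Φ p) * f (pr₁ p)) • pullForm (E₁ := V₁) pr₁ η₁ p := by
    rw [pullForm_theta_of_covers h₁ h₂ Φ.contMDiff F.contMDiff hc p, mul_smul]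
    congr 1
    ext v
    exact DFunLike.congr_fun (hf.pull (pr₁ p)) _
  rw [h3, ← h₁.factor.eq p, eq_div_iff (hf.ne_zero _)]
  exact (smul_left_injective ℝ
    (h₁.bundle.pullForm_ne_zero (h₁.contact.ne_zero _ (mem_univ _)))).eq_iff

theorem isLift_unique [T2Space P₂] (hf : IsContactFactor η₁ η₂ F f)
    {Φ Ψ : P₁ ≃ₘ⟮𝓘(ℝ, V₁), 𝓘(ℝ, V₂)⟯ P₂} (hΦ : IsLift θ₁ θ₂ pr₁ pr₂ F Φ)
    (hΨ : IsLift θ₁ θ₂ pr₁ pr₂ F Ψ) : Φ = Ψ := by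
  refine Diffeomorph.ext fun p => h₂.injective ?_ ?_
  · rw [hΦ.covers, hΨ.covers]
  · rw [(isHomSympl_iff h₁ h₂ hf hΦ.covers).1 hΦ.homSympl,
      (isHomSympl_iff h₁ h₂ hf hΨ.covers).1 hΨ.homSympl]

theorem exists_isLift_iff [T2Space P₁] [T2Space P₂] (hf : IsContactFactor η₁ η₂ F f) :
    (∃ Φ : P₁ ≃ₘ⟮𝓘(ℝ, V₁), 𝓘(ℝ, V₂)⟯ P₂, IsLift θ₁ θ₂ pr₁ pr₂ F Φ) ↔
      ∀ x, σ₁ '' (pr₁ ⁻¹' {x}) = (fun s => f x * s) '' (σ₂ '' (pr₂ ⁻¹' {F x})) := by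
  constructor
  · rintro ⟨Φ, hΦ⟩ x
    have hσ := (isHomSympl_iff h₁ h₂ hf hΦ.covers).1 hΦ.homSympl
    ext t
    constructor
    · rintro ⟨p, rfl, rfl⟩
      refine ⟨_, ⟨Φ p, hΦ.covers p, rfl⟩, ?_⟩
      simp only
      rw [hσ, mul_div_cancel₀ _ (hf.ne_zero _)]
    · rintro ⟨_, ⟨q, hq, rfl⟩, rfl⟩
      have hq' : pr₁ (Φ.symm q) = x := by
        refine F.injective (show F (pr₁ (Φ.symm q)) = F x from ?_)
        rw [← hΦ.covers, Φ.apply_symm_apply]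
        exact hq
      refine ⟨Φ.symm q, hq', ?_⟩
      have h3 := hσ (Φ.symm q)
      rw [Φ.apply_symm_apply, hq', eq_div_iff (hf.ne_zero _)] at h3
      simp only
      rw [← h3, mul_comm]
  · intro h
    -- One inclusion of the image condition supplies the point to which `p` must go, and the other
    -- supplies the inverse. Injectivity of `(pr, σ)` shows that they are mutually inverse.
    have hto : ∀ p, ∃ q, pr₂ q = F (pr₁ p) ∧ σ₂ q = σ₁ p / f (pr₁ p) := by
      intro p
      have hp : σ₁ p ∈ σ₁ '' (pr₁ ⁻¹' {pr₁ p}) := ⟨p, rfl, rfl⟩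
      rw [h] at hp
      obtain ⟨_, ⟨q, hq, rfl⟩, hq'⟩ := hp
      refine ⟨q, hq, ?_⟩
      rw [eq_div_iff (hf.ne_zero _), mul_comm]
      exact hq'
    have hinv : ∀ q, ∃ p, pr₁ p = F.symm (pr₂ q) ∧ σ₁ p = f (F.symm (pr₂ q)) * σ₂ q := by
      intro q
      have hq : f (F.symm (pr₂ q)) * σ₂ q ∈
          (fun s => f (F.symm (pr₂ q)) * s) '' (σ₂ '' (pr₂ ⁻¹' {F (F.symm (pr₂ q))})) :=
        ⟨_, ⟨q, by simp, rfl⟩, rfl⟩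
      rw [← h] at hq
      obtain ⟨p, hp, hp'⟩ := hq
      exact ⟨p, hp, hp'⟩
    choose Φ hΦ hΦσ using hto
    choose Ψ hΨ hΨσ using hinv
    have hFpr : ContMDiff 𝓘(ℝ, V₁) 𝓘(ℝ, E₂) ∞ fun p => F (pr₁ p) := F.contMDiff.comp h₁.bundle.1
    have hFpr' : ContMDiff 𝓘(ℝ, V₂) 𝓘(ℝ, E₁) ∞ fun q => F.symm (pr₂ q) :=
      F.symm.contMDiff.comp h₂.bundle.1
    have hfpr : ContMDiff 𝓘(ℝ, V₁) 𝓘(ℝ, ℝ) ∞ fun p => f (pr₁ p) := hf.smooth.comp h₁.bundle.1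
    have hfpr' : ContMDiff 𝓘(ℝ, V₂) 𝓘(ℝ, ℝ) ∞ fun q => f (F.symm (pr₂ q)) := hf.smooth.comp hFpr'
    have hΦsm : ContMDiff 𝓘(ℝ, V₁) 𝓘(ℝ, V₂) ∞ Φ := by
      refine h₂.contMDiff_of_comp ?_ ?_
      · rw [show (fun p => pr₂ (Φ p)) = fun p => F (pr₁ p) from funext hΦ]
        exact hFpr
      · rw [show (fun p => σ₂ (Φ p)) = fun p => σ₁ p / f (pr₁ p) from funext hΦσ]
        exact h₁.factor.smooth.div₀ hfpr fun p => hf.ne_zero _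
    have hΨsm : ContMDiff 𝓘(ℝ, V₂) 𝓘(ℝ, V₁) ∞ Ψ := by
      refine h₁.contMDiff_of_comp ?_ ?_
      · rw [show (fun q => pr₁ (Ψ q)) = fun q => F.symm (pr₂ q) from funext hΨ]
        exact hFpr'
      · rw [show (fun q => σ₁ (Ψ q)) = fun q => f (F.symm (pr₂ q)) * σ₂ q from funext hΨσ]
        exact hfpr'.mul h₂.factor.smooth
    let Φ' : P₁ ≃ₘ⟮𝓘(ℝ, V₁), 𝓘(ℝ, V₂)⟯ P₂ :=
      { toFun := Φ
        invFun := Ψ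
        left_inv := fun p => by
          refine h₁.injective (by rw [hΨ, hΦ, F.symm_apply_apply]) ?_
          rw [hΨσ, hΦ, F.symm_apply_apply, hΦσ, mul_div_cancel₀ _ (hf.ne_zero _)]
        right_inv := fun q => by
          refine h₂.injective (by rw [hΦ, hΨ, F.apply_symm_apply]) ?_
          rw [hΦσ, hΨσ, hΨ, mul_div_cancel_left₀ _ (hf.ne_zero _)]
        contMDiff_toFun := hΦsm
        contMDiff_invFun := hΨsm }
    have hc : Covers pr₁ pr₂ F Φ' := hΦ
    exact ⟨Φ', hc, (isHomSympl_iff h₁ h₂ hf hc).2 hΦσ⟩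

end PartOne

/-! ### Identity and composition of lifts -/

section Functoriality

variable {E₁ : Type*} [NormedAddCommGroup E₁] [NormedSpace ℝ E₁]
  {M₁ : Type*} [TopologicalSpace M₁] [ChartedSpace E₁ M₁] [IsManifold 𝓘(ℝ, E₁) ∞ M₁]
  {V₁ : Type*} [NormedAddCommGroup V₁] [NormedSpace ℝ V₁]
  {P₁ : Type*} [TopologicalSpace P₁] [ChartedSpace V₁ P₁] [IsManifold 𝓘(ℝ, V₁) ∞ P₁]
  {E₂ : Type*} [NormedAddCommGroup E₂] [NormedSpace ℝ E₂]
  {M₂ : Type*} [TopologicalSpace M₂] [ChartedSpace E₂ M₂] [IsManifold 𝓘(ℝ, E₂) ∞ M₂]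
  {V₂ : Type*} [NormedAddCommGroup V₂] [NormedSpace ℝ V₂]
  {P₂ : Type*} [TopologicalSpace P₂] [ChartedSpace V₂ P₂] [IsManifold 𝓘(ℝ, V₂) ∞ P₂]
  {E₃ : Type*} [NormedAddCommGroup E₃] [NormedSpace ℝ E₃]
  {M₃ : Type*} [TopologicalSpace M₃] [ChartedSpace E₃ M₃] [IsManifold 𝓘(ℝ, E₃) ∞ M₃]
  {V₃ : Type*} [NormedAddCommGroup V₃] [NormedSpace ℝ V₃]
  {P₃ : Type*} [TopologicalSpace P₃] [ChartedSpace V₃ P₃] [IsManifold 𝓘(ℝ, V₃) ∞ P₃]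

theorem isLift_refl (θ₁ : OneForm V₁ P₁) (pr₁ : P₁ → M₁) :
    IsLift θ₁ θ₁ pr₁ pr₁ (Diffeomorph.refl 𝓘(ℝ, E₁) M₁ ∞) (Diffeomorph.refl 𝓘(ℝ, V₁) P₁ ∞) where
  covers _ := rfl
  homSympl p := congrFun (pullForm_id θ₁) p

theorem IsLift.trans {θ₁ : OneForm V₁ P₁} {pr₁ : P₁ → M₁} {θ₂ : OneForm V₂ P₂} {pr₂ : P₂ → M₂}
    {θ₃ : OneForm V₃ P₃} {pr₃ : P₃ → M₃} {F : M₁ ≃ₘ⟮𝓘(ℝ, E₁), 𝓘(ℝ, E₂)⟯ M₂}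
    {G : M₂ ≃ₘ⟮𝓘(ℝ, E₂), 𝓘(ℝ, E₃)⟯ M₃} {Φ : P₁ ≃ₘ⟮𝓘(ℝ, V₁), 𝓘(ℝ, V₂)⟯ P₂}
    {Ψ : P₂ ≃ₘ⟮𝓘(ℝ, V₂), 𝓘(ℝ, V₃)⟯ P₃} (h : IsLift θ₁ θ₂ pr₁ pr₂ F Φ)
    (h' : IsLift θ₂ θ₃ pr₂ pr₃ G Ψ) : IsLift θ₁ θ₃ pr₁ pr₃ (F.trans G) (Φ.trans Ψ) where
  covers p := by
    rw [Diffeomorph.coe_trans, Diffeomorph.coe_trans, Function.comp_apply, Function.comp_apply,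
      h'.covers, h.covers]
  homSympl := h.homSympl.trans h'.homSympl

end Functoriality

/-! ### Infinitesimal contactomorphisms and their lifts -/

section PartTwo

/-- A symplectization with connected fibers of a contact distribution. -/
structure IsConnectedSymplectization {E : Type*} [NormedAddCommGroup E] [NormedSpace ℝ E]
    {M : Type*} [TopologicalSpace M] [ChartedSpace E M] [IsManifold 𝓘(ℝ, E) ∞ M]
    {V : Type*} [NormedAddCommGroup V] [NormedSpace ℝ V]
    {P : Type u} [TopologicalSpace P] [ChartedSpace V P] [IsManifold 𝓘(ℝ, V) ∞ P]
    (D : Distrib E M) (θ : OneForm V P) (pr : P → M) : Prop where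
  contact : IsContactDistribution D
  exact_sympl : IsExactSymplectic θ
  sympl : IsSymplectization D θ pr
  conn : ∀ x, IsConnected (pr ⁻¹' {x})

variable {E : Type*} [NormedAddCommGroup E] [NormedSpace ℝ E] [FiniteDimensional ℝ E]
  {M : Type*} [TopologicalSpace M] [ChartedSpace E M] [IsManifold 𝓘(ℝ, E) ∞ M]
  {V : Type*} [NormedAddCommGroup V] [NormedSpace ℝ V] [FiniteDimensional ℝ V]
  {P : Type*} [TopologicalSpace P] [ChartedSpace V P] [IsManifold 𝓘(ℝ, V) ∞ P]
  {D : Distrib E M} {θ : OneForm V P} {pr : P → M}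

theorem IsContactFormOn.exists_ne_zero {η : OneForm E M} {U : Set M} (hη : IsContactFormOn η U)
    (hb : IsSmoothFiberBundle (E := E) (V := V) pr) {p : P} (hp : pr p ∈ U) :
    ∃ w, η (pr p) (mfderiv 𝓘(ℝ, V) 𝓘(ℝ, E) pr p w) ≠ 0 := by
  by_contra! hc
  refine hη.ne_zero _ hp (ContinuousLinearMap.ext fun u => ?_)
  obtain ⟨w, rfl⟩ := hb.mfderiv_surjective p u
  exact hc w

/-- A field on the base is smooth if it is the projection of a smooth field. -/
theorem IsSmoothFiberBundle.smoothField_of_projectsTo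
    (hb : IsSmoothFiberBundle (E := E) (V := V) pr) (hsurj : ∀ x, ∃ p, pr p = x)
    {Y : VField V P} {X : VField E M} (hY : SmoothField Y) (h : ProjectsTo pr Y X) :
    SmoothField X := by
  refine smoothField_of_fieldRep fun x => ?_
  obtain ⟨p, rfl⟩ := hsurj x
  obtain ⟨U, s, hU, hpU, hs, hsec, hsp⟩ := hb.exists_section p
  have hx := mem_chart_source E (pr p)
  have hp := mem_chart_source V p
  have hs0 := hs.contMDiffAt (hU.mem_nhds hpU)
  have hz : s (pr p) ∈ (chartAt V p).source := by rwa [hsp]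
  set G := mapRep (E := E) (E' := V) s (pr p) p
  have hG : ContDiffAt ℝ ∞ G (extChartAt 𝓘(ℝ, E) (pr p) (pr p)) := contDiffAt_mapRep hx hz hs0
  have hG0 : G (extChartAt 𝓘(ℝ, E) (pr p) (pr p)) = extChartAt 𝓘(ℝ, V) p p := by
    rw [show G _ = _ from mapRep_apply s hx, hsp]
  have h1 : ContDiffAt ℝ ∞ (fderiv ℝ (mapRep (E := V) (E' := E) pr p (pr p)))
      (G (extChartAt 𝓘(ℝ, E) (pr p) (pr p))) := by
    rw [hG0]
    exact (contDiffAt_mapRep hp hx (hb.1 p)).fderiv_right (by norm_cast)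
  have h2 : ContDiffAt ℝ ∞ (fieldRep Y p) (G (extChartAt 𝓘(ℝ, E) (pr p) (pr p))) := by
    rw [hG0]
    exact hY.contDiffAt_fieldRep hp
  refine ((h1.comp _ hG).clm_apply (h2.comp _ hG)).congr_of_eventuallyEq (eventually_chart hx ?_)
  filter_upwards [hU.mem_nhds hpU, eventually_mem_source hx,
    hs0.continuousAt.eventually ((chartAt V p).open_source.mem_nhds hz)] with x' hx1 hx2 hx3
  have hx4 : pr (s x') ∈ (chartAt E (pr p)).source := by rwa [hsec x' hx1]
  simp only [Function.comp_apply]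
  rw [show G _ = _ from mapRep_apply s hx2, fieldRep_apply Y hx3, fderiv_mapRep hx3 hx4 (hb.1 _), h,
    ← fieldRep_apply X hx4, hsec x' hx1]

variable (H : IsConnectedSymplectization D θ pr)

include H

theorem IsConnectedSymplectization.surjective (x : M) : ∃ p, pr p = x :=
  (H.conn x).nonempty

theorem IsConnectedSymplectization.exists_local_factor (x : M) :
    ∃ (U : Set M) (η : OneForm E M) (σ : P → ℝ), IsOpen U ∧ x ∈ U ∧ IsContactFormOn η U ∧
      (∀ y ∈ U, D y = kerDist η y) ∧ IsConformalFactorOn η θ pr σ U := by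
  obtain ⟨U, hU, hx, η, hη, hD⟩ := H.contact x
  obtain ⟨σ, hσ⟩ := H.sympl.exists_factor hU hη H.exact_sympl hD
  exact ⟨U, η, σ, hU, hx, hη, hD, hσ⟩

/-- An infinitesimal contactomorphism lifts to an infinitesimal homogeneous symplectomorphism,
the Hamiltonian vector field of the function `θ(X)`. -/
theorem IsConnectedSymplectization.exists_lift {X : VField E M} (hX : IsInfContact D X) :
    ∃ Y : VField V P, IsInfHomSympl θ Y ∧ ProjectsTo pr Y X := by
  have hb := H.sympl.bundle
  -- The lifts are chosen pointwise, without regularity; `θ(L)` is smooth nonetheless because `θ`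
  -- depends only on the projection.
  choose L hL using fun p => hb.mfderiv_surjective p (X (pr p))
  set h : P → ℝ := fun p => θ p (L p) with hh
  have hloc : ∀ {U : Set M} {η : OneForm E M} {σ : P → ℝ}, IsOpen U →
      IsConformalFactorOn η θ pr σ U → ∀ {p}, pr p ∈ U →
      h =ᶠ[𝓝 p] fun q => σ q * η (pr q) (X (pr q)) := by
    intro U η σ hU hσ p hp
    filter_upwards [(hU.preimage hb.1.continuous).mem_nhds hp] with q hq
    rw [hh]
    simp only
    rw [hσ.apply hq, hL]
  have hsm : ContMDiff 𝓘(ℝ, V) 𝓘(ℝ, ℝ) ∞ h := by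
    intro p
    obtain ⟨U, η, σ, hU, hp, hη, -, hσ⟩ := H.exists_local_factor (pr p)
    have hg := contMDiffAt_apply_field (hη.smooth.smoothFormAt hU hp) hX.smooth
    have hg' : ContMDiffAt 𝓘(ℝ, V) 𝓘(ℝ, ℝ) ∞ (fun q => η (pr q) (X (pr q))) p :=
      ContMDiffAt.comp (g := fun x => η x (X x)) p hg (hb.1 p)
    exact ((hσ.smooth p hp).mul hg').congr_of_eventuallyEq (hloc hU hσ hp)
  obtain ⟨Y, hY, hYd⟩ := H.exact_sympl.exists_contraction
    (α := fun x => (-1 : ℝ) • dForm (E := V) h x)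
    fun x => (smoothFormAt_dForm hsm x).smul contMDiffAt_const
  have hYd : ∀ p v, extD θ p (Y p) v = -dirD h p v := fun p v => by
    rw [hYd, smul_apply, dForm_apply, smul_eq_mul, neg_one_mul]
  have hproj : ProjectsTo pr Y X := by
    intro p
    obtain ⟨U, η, σ, hU, hp, hη, hD, hσ⟩ := H.exists_local_factor (pr p)
    obtain ⟨a, ha⟩ := hX.lie U η hU hη hD
    -- The vector predicted by `Y(σ) = -aσ`. The equation `L_X η = aη` is exactly what makes it
    -- satisfy `dθ(v, ·) = -dh`, hence equal to `Y p`.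
    obtain ⟨v, hv, hvσ⟩ := hσ.exists_lift hU hη H.exact_sympl hb hp (X (pr p)) (-(a (pr p) * σ p))
    have hg := contMDiffAt_apply_field (hη.smooth.smoothFormAt hU hp) hX.smooth
    have hg' : ContMDiffAt 𝓘(ℝ, V) 𝓘(ℝ, ℝ) ∞ (fun q => η (pr q) (X (pr q))) p :=
      ContMDiffAt.comp (g := fun x => η x (X x)) p hg (hb.1 p)
    have : Y p = v := by
      refine H.exact_sympl.eq_of_extD fun w => ?_
      have hlie := ha _ hp (mfderiv 𝓘(ℝ, V) 𝓘(ℝ, E) pr p w)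
      rw [lieD] at hlie
      rw [hYd, dirD_congr (hloc hU hσ hp), dirD_mul (hσ.smooth p hp) hg',
        dirD_comp (g := fun y => η y (X y)) (hb.1 p) hg, hσ.extD_eq hU hη.smooth hb.1 hp, hv, hvσ]
      linear_combination (-σ p) * hlie
    rw [this, hv]
  refine ⟨Y, ⟨hY, fun p w => ?_⟩, hproj⟩
  have hθY : (fun q => θ q (Y q)) = h := by
    funext q
    obtain ⟨U, η, σ, hU, hq, hη, hD, hσ⟩ := H.exists_local_factor (pr q)
    rw [hh]
    simp only
    rw [hσ.apply hq, hσ.apply hq, hL, hproj]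
  rw [lieD, hθY, hYd, neg_add_cancel]

/-- Given the projection, `L_Y θ = 0` determines `Y(σ)`: evaluate it on a vector where `pr^*η` is
nonzero. -/
theorem IsConnectedSymplectization.lift_unique {X : VField E M} (hX : SmoothField X)
    {Y Y' : VField V P} (hY : IsInfHomSympl θ Y) (hY' : IsInfHomSympl θ Y')
    (h : ProjectsTo pr Y X) (h' : ProjectsTo pr Y' X) : Y = Y' := by
  have hb := H.sympl.bundle
  funext p
  obtain ⟨U, η, σ, hU, hp, hη, -, hσ⟩ := H.exists_local_factor (pr p)
  refine hσ.eq_of_eq hU hη H.exact_sympl hb hp (by rw [h, h']) ?_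
  obtain ⟨w, hw⟩ := hη.exists_ne_zero hb hp
  have h1 := hσ.lieD_eq hU hη.smooth hb.1 hX h hp w
  have h2 := hσ.lieD_eq hU hη.smooth hb.1 hX h' hp w
  rw [hY.lie] at h1
  rw [hY'.lie] at h2
  refine mul_right_cancel₀ hw ?_
  linear_combination h2 - h1

/-- The Hamiltonian `θ(Y)` of an infinitesimal homogeneous symplectomorphism is `σ` times a
function on the base. -/
theorem IsConnectedSymplectization.exists_hamiltonian {Y : VField V P} (hY : IsInfHomSympl θ Y)
    {U : Set M} {η : OneForm E M} {σ : P → ℝ} (hU : IsOpen U) (hη : IsContactFormOn η U)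
    (hσ : IsConformalFactorOn η θ pr σ U) :
    ∃ g : M → ℝ, (∀ x ∈ U, ContMDiffAt 𝓘(ℝ, E) 𝓘(ℝ, ℝ) ∞ g x) ∧
      ∀ p, pr p ∈ U → θ p (Y p) = σ p * g (pr p) := by
  have hb := H.sympl.bundle
  have hθ := H.exact_sympl
  have hθs : ∀ p, SmoothFormAt θ p := fun p => hθ.smooth.smoothFormAt isOpen_univ (mem_univ p)
  have hh : ∀ p, ContMDiffAt 𝓘(ℝ, V) 𝓘(ℝ, ℝ) ∞ (fun q => θ q (Y q)) p := fun p =>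
    contMDiffAt_apply_field (hθs p) hY.smooth
  obtain ⟨Δ, hΔ⟩ := hθ.exists_liouville
  -- Evaluating `L_Y θ = 0` on `Δ` shows that `θ(Y)` is homogeneous of degree one, like `σ`. Their
  -- quotient `k` is therefore killed by `Δ` and constant on fibers.
  have hdh : ∀ p, dirD (fun q => θ q (Y q)) p (Δ p) = θ p (Y p) := by
    intro p
    have h1 := hY.lie p (Δ p)
    rw [lieD, extD_swap (hθs p), hΔ.extD_eq] at h1
    linarith
  set k : P → ℝ := fun p => θ p (Y p) / σ p with hk
  have hksm : ∀ p, pr p ∈ U → ContMDiffAt 𝓘(ℝ, V) 𝓘(ℝ, ℝ) ∞ k p := fun p hp =>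
    (hh p).div₀ (hσ.smooth p hp) (hσ.ne_zero p hp)
  have hkσ : ∀ p, pr p ∈ U → θ p (Y p) = σ p * k p := fun p hp => by
    rw [hk]
    simp only
    rw [mul_div_cancel₀ _ (hσ.ne_zero p hp)]
  have hconst : ∀ p q, pr p ∈ U → pr q = pr p → k q = k p := by
    intro p q hp hq
    refine hb.eq_of_vertical (H.conn (pr p)).isPreconnected (ψ := k)
      (fun r hr => hksm r (by rwa [hr])) (fun r hr v hv => ?_) hq rfl
    have hrU : pr r ∈ U := by rwa [hr]
    have hv' := hσ.vertical hU hη hθ hb hΔ hrU hv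
    have hev : (fun q => θ q (Y q)) =ᶠ[𝓝 r] fun q => σ q * k q := by
      filter_upwards [(hU.preimage hb.1.continuous).mem_nhds hrU] with q hq
      exact hkσ q hq
    have h1 := hdh r
    rw [dirD_congr hev, dirD_mul (hσ.smooth r hrU) (hksm r hrU),
      (hσ.liouville hU hη hθ hb hΔ hrU).2, hkσ r hrU] at h1
    have h2 : dirD k r (Δ r) = 0 := by
      have h3 : σ r * dirD k r (Δ r) = 0 := by linarith
      exact (mul_eq_zero.1 h3).resolve_left (hσ.ne_zero r hrU)
    have h3 : mfderiv 𝓘(ℝ, V) 𝓘(ℝ, ℝ) k r (Δ r) = 0 := h2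
    rw [hv', map_smul, h3, smul_zero]
  choose s hs using H.surjective
  have hg : ∀ p, pr p ∈ U → k (s (pr p)) = k p := fun p hp => hconst p _ hp (hs _)
  refine ⟨fun x => k (s x), fun x hx => ?_, fun p hp => by simp only [hg p hp, hkσ p hp]⟩
  obtain ⟨p, rfl⟩ := H.surjective x
  refine hb.contMDiffAt_of_comp p ((hksm p hx).congr_of_eventuallyEq ?_)
  filter_upwards [(hU.preimage hb.1.continuous).mem_nhds hx] with q hq
  exact hg q hq

theorem IsConnectedSymplectization.mfderiv_eq_of_pr_eq {Y : VField V P}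
    (hY : IsInfHomSympl θ Y) (p q : P) (hpq : pr q = pr p) :
    (mfderiv 𝓘(ℝ, V) 𝓘(ℝ, E) pr q (Y q) : E) = mfderiv 𝓘(ℝ, V) 𝓘(ℝ, E) pr p (Y p) := by
  have hb := H.sympl.bundle
  obtain ⟨U, η, σ, hU, hp, hη, -, hσ⟩ := H.exists_local_factor (pr p)
  obtain ⟨g, hg, hgσ⟩ := H.exists_hamiltonian hY hU hη hσ
  -- The equations of a contact Hamiltonian field for `g`, with the multiplier `c` left free. Two
  -- solutions differ by a vector of `ker η` on which `dη` is degenerate, so at most one exists over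
  -- each base point.
  let Q : (x : M) → TangentSpace 𝓘(ℝ, E) x → Prop := fun x e =>
    η x e = g x ∧ ∃ c : ℝ, ∀ u, extD η x e u = -dirD g x u + c * η x u
  have hQ : ∀ r, pr r ∈ U → Q (pr r) (mfderiv 𝓘(ℝ, V) 𝓘(ℝ, E) pr r (Y r)) := by
    intro r hr
    have hσr := hσ.ne_zero r hr
    have hge : η (pr r) (mfderiv 𝓘(ℝ, V) 𝓘(ℝ, E) pr r (Y r)) = g (pr r) := by
      have h1 := hgσ r hr
      rw [hσ.apply hr] at h1
      exact mul_left_cancel₀ hσr h1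
    refine ⟨hge, -(dirD σ r (Y r) / σ r), fun u => ?_⟩
    obtain ⟨w, rfl⟩ := hb.mfderiv_surjective r u
    have hev : (fun q => θ q (Y q)) =ᶠ[𝓝 r] fun q => σ q * g (pr q) := by
      filter_upwards [(hU.preimage hb.1.continuous).mem_nhds hr] with q hq
      exact hgσ q hq
    have hg' : ContMDiffAt 𝓘(ℝ, V) 𝓘(ℝ, ℝ) ∞ (fun q => g (pr q)) r :=
      ContMDiffAt.comp (g := g) r (hg _ hr) (hb.1 r)
    have h1 := hY.lie r w
    rw [lieD, dirD_congr hev, dirD_mul (hσ.smooth r hr) hg', dirD_comp (hb.1 r) (hg _ hr),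
      hσ.extD_eq hU hη.smooth hb.1 hr, hge] at h1
    field_simp
    linear_combination h1
  have huniq : ∀ x ∈ U, ∀ e e', Q x e → Q x e' → e = e' := by
    rintro x hx e e' ⟨h1, c, hc⟩ ⟨h1', c', hc'⟩
    have h0 : η x (e - e') = 0 := by rw [map_sub, h1, h1', sub_self]
    refine sub_eq_zero.1 (hη.nondeg x hx _ h0 fun w hw => ?_)
    rw [extD_sub_left (hη.smooth.smoothFormAt hU hx), hc, hc', hw]
    ring
  have key : ∀ y, y = pr p → ∀ e' : TangentSpace 𝓘(ℝ, E) y, Q y e' →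
      (e' : E) = mfderiv 𝓘(ℝ, V) 𝓘(ℝ, E) pr p (Y p) := by
    rintro y rfl e' he'
    exact huniq _ hp _ _ he' (hQ p hp)
  exact key _ hpq _ (hQ q (by rwa [hpq]))

theorem IsConnectedSymplectization.exists_projection {Y : VField V P} (hY : IsInfHomSympl θ Y) :
    ∃ X : VField E M, IsInfContact D X ∧ ProjectsTo pr Y X := by
  have hb := H.sympl.bundle
  choose s hs using H.surjective
  -- The ascription to `E` identifies the tangent spaces at `pr (s x)` and at `x`.
  let X : VField E M := fun x =>
    (mfderiv 𝓘(ℝ, V) 𝓘(ℝ, E) pr (s x) (Y (s x)) : E)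
  have hYX : ProjectsTo pr Y X := fun p => (H.mfderiv_eq_of_pr_eq hY p (s (pr p)) (hs _)).symm
  have hX : SmoothField X := hb.smoothField_of_projectsTo H.surjective hY.smooth hYX
  refine ⟨X, ⟨hX, fun U η hU hη hD => ?_⟩, hYX⟩
  obtain ⟨σ, hσ⟩ := H.sympl.exists_factor hU hη H.exact_sympl hD
  have hex : ∀ x, ∃ c : ℝ, x ∈ U → ∀ v, lieD X η x v = c * η x v := by
    intro x
    obtain ⟨p, rfl⟩ := H.surjective x
    -- Any point `p` over `x` serves, since `a` is only required to be a function.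
    refine ⟨-(dirD σ p (Y p) / σ p), fun hp u => ?_⟩
    obtain ⟨w, rfl⟩ := hb.mfderiv_surjective p u
    have h1 := hσ.lieD_eq hU hη.smooth hb.1 hX hYX hp w
    have hσp := hσ.ne_zero p hp
    rw [hY.lie] at h1
    field_simp
    linear_combination -h1
  choose a ha using hex
  exact ⟨a, ha⟩

theorem IsConnectedSymplectization.exists_equiv :
    ∃ S : {X : VField E M // IsInfContact D X} ≃ {Y : VField V P // IsInfHomSympl θ Y},
      ∀ X Y, S X = Y ↔ ProjectsTo pr Y.1 X.1 := by
  choose S hS hSX using fun X : {X : VField E M // IsInfContact D X} => H.exists_lift X.2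
  have hbij : Function.Bijective
      fun X => (⟨S X, hS X⟩ : {Y : VField V P // IsInfHomSympl θ Y}) := by
    constructor
    · intro X X' h
      have h' : S X = S X' := congrArg Subtype.val h
      refine Subtype.ext (funext fun x => ?_)
      obtain ⟨p, rfl⟩ := H.surjective x
      rw [← hSX X p, ← hSX X' p, h']
    · intro Y
      obtain ⟨X, hX, hYX⟩ := H.exists_projection Y.2
      exact ⟨⟨X, hX⟩, Subtype.ext (H.lift_unique hX.smooth (hS _) Y.2 (hSX _) hYX)⟩
  refine ⟨Equiv.ofBijective _ hbij, fun X Y => ⟨?_, fun h => ?_⟩⟩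
  · rintro rfl
    exact hSX X
  · exact Subtype.ext (H.lift_unique X.2.smooth (hS X) Y.2 (hSX X) h)

/-! ### The lift relative to a global contact form -/

section Form

variable {η : OneForm E M} {σ : P → ℝ} (hη : IsContactForm η) (hσ : IsConformalFactor η θ pr σ)

include hη hσ

/-- Substituting `L_X η = aη` into the formula for `L_Y θ = 0` gives `Y(σ) = -aσ`; projection and
derivative of `σ` then determine the field. -/
theorem IsConnectedSymplectization.eq_lift_iff {X : VField E M} {Y : VField V P}
    (hX : SmoothField X) (hY : IsInfHomSympl θ Y) (hYX : ProjectsTo pr Y X) {a : M → ℝ}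
    (ha : ∀ x v, lieD X η x v = a x * η x v) (Z : VField V P) :
    Z = Y ↔ ProjectsTo pr Z X ∧ ∀ p, dirD σ p (Z p) = -a (pr p) * σ p := by
  have hb := H.sympl.bundle
  have hYσ : ∀ p, dirD σ p (Y p) = -a (pr p) * σ p := by
    intro p
    obtain ⟨w, hw⟩ := IsContactFormOn.exists_ne_zero hη hb (mem_univ (pr p))
    have h1 := hσ.on_univ.lieD_eq isOpen_univ hη.smooth hb.1 hX hYX (mem_univ _) w
    rw [hY.lie, ha] at h1
    refine mul_right_cancel₀ hw ?_
    linear_combination -h1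
  constructor
  · rintro rfl
    exact ⟨hYX, hYσ⟩
  · rintro ⟨h1, h2⟩
    exact funext fun p => hσ.on_univ.eq_of_eq isOpen_univ hη H.exact_sympl hb (mem_univ _)
      (by rw [h1, hYX]) (by rw [h2, hYσ])

theorem IsConnectedSymplectization.sigmaLift_unique {X : VField E M} {Z Z' : VField V P}
    (h : IsSigmaLift pr σ X Z) (h' : IsSigmaLift pr σ X Z') : Z = Z' :=
  funext fun p => hσ.on_univ.eq_of_eq isOpen_univ hη H.exact_sympl H.sympl.bundle (mem_univ _)
    (by rw [h.proj, h'.proj]) (by rw [h.eq_zero, h'.eq_zero])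

theorem IsConnectedSymplectization.isSigmaLift_add {X : VField E M} {Y : VField V P}
    (hX : SmoothField X) (hY : IsInfHomSympl θ Y) (hYX : ProjectsTo pr Y X) {a : M → ℝ}
    (ha : ∀ x v, lieD X η x v = a x * η x v) {Δ : VField V P} (hΔ : IsLiouville θ Δ) :
    IsSigmaLift pr σ X fun p => Y p + a (pr p) • Δ p := by
  have hb := H.sympl.bundle
  have hYσ := ((H.eq_lift_iff hη hσ hX hY hYX ha Y).1 rfl).2
  have hL := fun p => hσ.on_univ.liouville isOpen_univ hη H.exact_sympl hb hΔ (mem_univ (pr p))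
  refine ⟨hY.smooth.add_smul hΔ.smooth ?_, fun p => ?_, fun p => ?_⟩
  -- Smoothness of `a` is not assumed; it is read off upstairs from the quotient of `Y(σ)` by `σ`.
  · have h1 : (fun p => a (pr p)) = fun p => -(dirD σ p (Y p) / σ p) := by
      funext p
      rw [hYσ, mul_div_cancel_right₀ _ (hσ.ne_zero p), neg_neg]
    rw [h1]
    exact ((contMDiff_dirD hσ.smooth hY.smooth).div₀ hσ.smooth hσ.ne_zero).neg
  · rw [map_add, map_smul, (hL p).1, smul_zero, add_zero, hYX]
  · have h1 : dirD σ p (Y p + a (pr p) • Δ p) =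
        dirD σ p (Y p) + a (pr p) * dirD σ p (Δ p) := by simp [dirD]
    rw [h1, hYσ, (hL p).2]
    ring

/-- Take the Hamiltonian field of `σ`, so `dθ(Y, ·) = -dσ`. Then `θ(Y) = Δ(σ) = σ`, and `Y(σ) = 0`
because `dθ(Y, Y) = 0`. -/
theorem IsConnectedSymplectization.exists_reeb_lift :
    ∃ Y : VField V P, IsInfHomSympl θ Y ∧ (∀ p, θ p (Y p) = σ p) ∧
      ∀ p, dirD σ p (Y p) = 0 := by
  have hb := H.sympl.bundle
  have hθs : ∀ p, SmoothFormAt θ p := fun p =>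
    H.exact_sympl.smooth.smoothFormAt isOpen_univ (mem_univ p)
  obtain ⟨Δ, hΔ⟩ := H.exact_sympl.exists_liouville
  obtain ⟨Y, hY, hYd⟩ := H.exact_sympl.exists_contraction
    (α := fun x => (-1 : ℝ) • dForm (E := V) σ x)
    fun x => (smoothFormAt_dForm hσ.smooth x).smul contMDiffAt_const
  have hYd : ∀ p v, extD θ p (Y p) v = -dirD σ p v := fun p v => by
    rw [hYd, smul_apply, dForm_apply, smul_eq_mul, neg_one_mul]
  have hθY : ∀ p, θ p (Y p) = σ p := by
    intro p
    rw [← hΔ.extD_eq, extD_swap (hθs p), hYd, neg_neg,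
      (hσ.on_univ.liouville isOpen_univ hη H.exact_sympl hb hΔ (mem_univ _)).2]
  refine ⟨Y, ⟨hY, fun p w => ?_⟩, hθY, fun p => ?_⟩
  · rw [lieD, hYd, funext hθY, neg_add_cancel]
  · have h1 := hYd p (Y p)
    rw [extD_self (hθs p)] at h1
    linarith

/-- Dividing `θ(Y) = σ` by `σ` gives `η(R) = 1`. With `Y(σ) = 0` the formula for `L_Y θ` leaves `L_R
η = 0`, which is the contraction of `dη` with `R` since `η(R)` is constant. -/
theorem IsConnectedSymplectization.isReeb {R : VField E M} {Y : VField V P}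
    (hR : SmoothField R) (hY : IsInfHomSympl θ Y) (hYR : ProjectsTo pr Y R)
    (hθY : ∀ p, θ p (Y p) = σ p) (hYσ : ∀ p, dirD σ p (Y p) = 0) : IsReeb η R := by
  have hb := H.sympl.bundle
  have hone : ∀ x, η x (R x) = 1 := by
    intro x
    obtain ⟨p, rfl⟩ := H.surjective x
    have h1 := hθY p
    rw [hσ.on_univ.apply (mem_univ _), hYR] at h1
    exact (mul_eq_left₀ (hσ.ne_zero p)).1 h1
  refine ⟨hR, fun x u => ?_, hone⟩
  obtain ⟨p, rfl⟩ := H.surjective x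
  obtain ⟨w, rfl⟩ := hb.mfderiv_surjective p u
  have h1 := hσ.on_univ.lieD_eq isOpen_univ hη.smooth hb.1 hR hYR (mem_univ _) w
  rw [hY.lie, hYσ, zero_mul, zero_add, lieD, funext hone] at h1
  have h2 : dirD (E := E) (fun _ : M => (1 : ℝ)) (pr p) (mfderiv 𝓘(ℝ, V) 𝓘(ℝ, E) pr p w) = 0 := by
    simp [dirD, mvfderiv]
  rw [h2, add_zero] at h1
  exact (mul_eq_zero.1 h1.symm).resolve_left (hσ.ne_zero p)

end Form

/-- The bracket downstairs is the projection of the bracket upstairs, which preserves `θ`; so no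
computation with local contact forms is needed. -/
theorem IsConnectedSymplectization.mlieBracket {X₁ X₂ : VField E M} {Y₁ Y₂ : VField V P}
    (hX₁ : SmoothField X₁) (hX₂ : SmoothField X₂) (hY₁ : IsInfHomSympl θ Y₁)
    (hY₂ : IsInfHomSympl θ Y₂) (h₁ : ProjectsTo pr Y₁ X₁) (h₂ : ProjectsTo pr Y₂ X₂) :
    IsInfContact D (VectorField.mlieBracket 𝓘(ℝ, E) X₁ X₂) ∧
      IsInfHomSympl θ (VectorField.mlieBracket 𝓘(ℝ, V) Y₁ Y₂) ∧
      ProjectsTo pr (VectorField.mlieBracket 𝓘(ℝ, V) Y₁ Y₂)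
        (VectorField.mlieBracket 𝓘(ℝ, E) X₁ X₂) := by
  have hY : IsInfHomSympl θ (VectorField.mlieBracket 𝓘(ℝ, V) Y₁ Y₂) :=
    ⟨hY₁.smooth.mlieBracket hY₂.smooth, lieD_mlieBracket_eq_zero H.exact_sympl.smooth hY₁.smooth
      hY₂.smooth hY₁.lie hY₂.lie⟩
  have hproj := projectsTo_mlieBracket H.sympl.bundle.1 hY₁.smooth hY₂.smooth hX₁ hX₂ h₁ h₂
  obtain ⟨X, hX, hYX⟩ := H.exists_projection hY
  have : X = VectorField.mlieBracket 𝓘(ℝ, E) X₁ X₂ := by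
    funext x
    obtain ⟨p, rfl⟩ := H.surjective x
    rw [← hYX, hproj]
  exact ⟨this ▸ hX, hY, hproj⟩

end PartTwo

end ContactSymp

end

/-! ### Assembling the theorem -/

open ContactSymp in
theorem theorem4p3
    {E₁ : Type*} [NormedAddCommGroup E₁] [NormedSpace ℝ E₁] [FiniteDimensional ℝ E₁]
    {M₁ : Type*} [TopologicalSpace M₁] [ChartedSpace E₁ M₁] [IsManifold 𝓘(ℝ, E₁) ∞ M₁]
    [T2Space M₁] [SecondCountableTopology M₁]
    {V₁ : Type*} [NormedAddCommGroup V₁] [NormedSpace ℝ V₁] [FiniteDimensional ℝ V₁]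
    {P₁ : Type*} [TopologicalSpace P₁] [ChartedSpace V₁ P₁] [IsManifold 𝓘(ℝ, V₁) ∞ P₁]
    [T2Space P₁] [SecondCountableTopology P₁]
    {E₂ : Type*} [NormedAddCommGroup E₂] [NormedSpace ℝ E₂] [FiniteDimensional ℝ E₂]
    {M₂ : Type*} [TopologicalSpace M₂] [ChartedSpace E₂ M₂] [IsManifold 𝓘(ℝ, E₂) ∞ M₂]
    [T2Space M₂] [SecondCountableTopology M₂]
    {V₂ : Type*} [NormedAddCommGroup V₂] [NormedSpace ℝ V₂] [FiniteDimensional ℝ V₂]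
    {P₂ : Type*} [TopologicalSpace P₂] [ChartedSpace V₂ P₂] [IsManifold 𝓘(ℝ, V₂) ∞ P₂]
    [T2Space P₂] [SecondCountableTopology P₂]
    {E₃ : Type*} [NormedAddCommGroup E₃] [NormedSpace ℝ E₃] [FiniteDimensional ℝ E₃]
    {M₃ : Type*} [TopologicalSpace M₃] [ChartedSpace E₃ M₃] [IsManifold 𝓘(ℝ, E₃) ∞ M₃]
    [T2Space M₃] [SecondCountableTopology M₃]
    {V₃ : Type*} [NormedAddCommGroup V₃] [NormedSpace ℝ V₃] [FiniteDimensional ℝ V₃]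
    {P₃ : Type*} [TopologicalSpace P₃] [ChartedSpace V₃ P₃] [IsManifold 𝓘(ℝ, V₃) ∞ P₃]
    [T2Space P₃] [SecondCountableTopology P₃] :
    -- Part I: homogeneous symplectomorphisms and contactomorphisms
    (∀ (η₁ : OneForm E₁ M₁) (θ₁ : OneForm V₁ P₁) (pr₁ : P₁ → M₁) (σ₁ : P₁ → ℝ)
        (η₂ : OneForm E₂ M₂) (θ₂ : OneForm V₂ P₂) (pr₂ : P₂ → M₂) (σ₂ : P₂ → ℝ),
      IsContactForm η₁ → IsExactSymplectic θ₁ → IsSymplectization (kerDist η₁) θ₁ pr₁ →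
      (∀ x, IsConnected (pr₁ ⁻¹' {x})) → IsConformalFactor η₁ θ₁ pr₁ σ₁ →
      IsContactForm η₂ → IsExactSymplectic θ₂ → IsSymplectization (kerDist η₂) θ₂ pr₂ →
      (∀ x, IsConnected (pr₂ ⁻¹' {x})) → IsConformalFactor η₂ θ₂ pr₂ σ₂ →
      -- every homogeneous symplectomorphism projects onto a unique map, a contactomorphism
      (∀ Φ : P₁ ≃ₘ⟮𝓘(ℝ, V₁), 𝓘(ℝ, V₂)⟯ P₂, IsHomSympl θ₁ θ₂ Φ →
        ∃ F : M₁ ≃ₘ⟮𝓘(ℝ, E₁), 𝓘(ℝ, E₂)⟯ M₂,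
          Covers pr₁ pr₂ F Φ ∧ IsContactomorphism η₁ η₂ F ∧
          ∀ G : M₁ → M₂, Covers pr₁ pr₂ G Φ → G = F) ∧
      (∀ (F : M₁ ≃ₘ⟮𝓘(ℝ, E₁), 𝓘(ℝ, E₂)⟯ M₂) (f : M₁ → ℝ), IsContactFactor η₁ η₂ F f →
        -- characterization of the lifts of a contactomorphism
        (∀ Φ : P₁ ≃ₘ⟮𝓘(ℝ, V₁), 𝓘(ℝ, V₂)⟯ P₂, Covers pr₁ pr₂ F Φ →
          (IsHomSympl θ₁ θ₂ Φ ↔ ∀ p, σ₂ (Φ p) = σ₁ p / f (pr₁ p))) ∧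
        -- uniqueness of the lift
        (∀ Φ Ψ : P₁ ≃ₘ⟮𝓘(ℝ, V₁), 𝓘(ℝ, V₂)⟯ P₂,
          IsLift θ₁ θ₂ pr₁ pr₂ F Φ → IsLift θ₁ θ₂ pr₁ pr₂ F Ψ → Φ = Ψ) ∧
        -- existence of the lift
        ((∃ Φ : P₁ ≃ₘ⟮𝓘(ℝ, V₁), 𝓘(ℝ, V₂)⟯ P₂, IsLift θ₁ θ₂ pr₁ pr₂ F Φ) ↔
          ∀ x, σ₁ '' (pr₁ ⁻¹' {x}) = (fun s => f x * s) '' (σ₂ '' (pr₂ ⁻¹' {F x})))) ∧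
      -- functoriality
      IsLift θ₁ θ₁ pr₁ pr₁ (Diffeomorph.refl 𝓘(ℝ, E₁) M₁ ∞) (Diffeomorph.refl 𝓘(ℝ, V₁) P₁ ∞) ∧
      (∀ (η₃ : OneForm E₃ M₃) (θ₃ : OneForm V₃ P₃) (pr₃ : P₃ → M₃),
        IsContactForm η₃ → IsExactSymplectic θ₃ → IsSymplectization (kerDist η₃) θ₃ pr₃ →
        (∀ x, IsConnected (pr₃ ⁻¹' {x})) →
        ∀ (F : M₁ ≃ₘ⟮𝓘(ℝ, E₁), 𝓘(ℝ, E₂)⟯ M₂) (G : M₂ ≃ₘ⟮𝓘(ℝ, E₂), 𝓘(ℝ, E₃)⟯ M₃)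
          (FS : P₁ ≃ₘ⟮𝓘(ℝ, V₁), 𝓘(ℝ, V₂)⟯ P₂) (GS : P₂ ≃ₘ⟮𝓘(ℝ, V₂), 𝓘(ℝ, V₃)⟯ P₃),
          IsContactomorphism η₁ η₂ F → IsContactomorphism η₂ η₃ G →
          IsLift θ₁ θ₂ pr₁ pr₂ F FS → IsLift θ₂ θ₃ pr₂ pr₃ G GS →
          IsContactomorphism η₁ η₃ (F.trans G) ∧
          IsLift θ₁ θ₃ pr₁ pr₃ (F.trans G) (FS.trans GS) ∧
          ∀ HS : P₁ ≃ₘ⟮𝓘(ℝ, V₁), 𝓘(ℝ, V₃)⟯ P₃,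
            IsLift θ₁ θ₃ pr₁ pr₃ (F.trans G) HS → HS = FS.trans GS)) ∧
    -- Part II: the infinitesimal correspondence
    (∀ (D : Distrib E₁ M₁) (θ : OneForm V₁ P₁) (pr : P₁ → M₁),
      IsContactDistribution D → IsExactSymplectic θ → IsSymplectization D θ pr →
      (∀ x, IsConnected (pr ⁻¹' {x})) →
      ∃ S : {X : VField E₁ M₁ // IsInfContact D X} ≃ {Y : VField V₁ P₁ // IsInfHomSympl θ Y},
        (∀ X Y, S X = Y ↔ ProjectsTo pr Y.1 X.1) ∧
        (∀ (η : OneForm E₁ M₁) (σ : P₁ → ℝ), IsContactForm η → (∀ x, D x = kerDist η x) →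
          IsConformalFactor η θ pr σ →
          (∀ (X : {X : VField E₁ M₁ // IsInfContact D X}) (a : M₁ → ℝ),
            (∀ x v, lieD X.1 η x v = a x * η x v) →
            -- characterization by the derivative of the conformal factor
            (∀ Z : VField V₁ P₁, SmoothField Z →
              (Z = (S X).1 ↔ ProjectsTo pr Z X.1 ∧
                ∀ p, dirD σ p (Z p) = -a (pr p) * σ p)) ∧
            -- the formula in terms of the Liouville vector field
            ∃ (Δ : VField V₁ P₁) (Xσ : VField V₁ P₁), IsLiouville θ Δ ∧
              IsSigmaLift pr σ X.1 Xσ ∧ (∀ Z, IsSigmaLift pr σ X.1 Z → Z = Xσ) ∧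
              ∀ p, (S X).1 p = Xσ p - a (pr p) • Δ p) ∧
          -- the Reeb vector field
          ∃ (R : VField E₁ M₁) (hR : IsInfContact D R), IsReeb η R ∧
            IsSigmaLift pr σ R (S ⟨R, hR⟩).1) ∧
        -- Lie brackets
        ∀ X Y : {X : VField E₁ M₁ // IsInfContact D X},
          ∃ h : IsInfContact D (VectorField.mlieBracket 𝓘(ℝ, E₁) X.1 Y.1),
            (S ⟨VectorField.mlieBracket 𝓘(ℝ, E₁) X.1 Y.1, h⟩).1 =
              VectorField.mlieBracket 𝓘(ℝ, V₁) (S X).1 (S Y).1) := by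
  constructor
  · intro η₁ θ₁ pr₁ σ₁ η₂ θ₂ pr₂ σ₂ hη₁ hθ₁ hs₁ hc₁ hσ₁ hη₂ hθ₂ hs₂ hc₂ hσ₂
    have h₁ : IsSymplectizationOfForm η₁ θ₁ pr₁ σ₁ := ⟨hη₁, hθ₁, hs₁.bundle, hc₁, hσ₁⟩
    have h₂ : IsSymplectizationOfForm η₂ θ₂ pr₂ σ₂ := ⟨hη₂, hθ₂, hs₂.bundle, hc₂, hσ₂⟩
    refine ⟨fun Φ hΦ => hΦ.exists_contactomorphism h₁ h₂, fun F f hf =>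
      ⟨fun Φ hc => isHomSympl_iff h₁ h₂ hf hc, fun Φ Ψ hΦ hΨ => isLift_unique h₁ h₂ hf hΦ hΨ,
        exists_isLift_iff h₁ h₂ hf⟩, isLift_refl θ₁ pr₁, ?_⟩
    rintro η₃ θ₃ pr₃ hη₃ hθ₃ hs₃ hc₃ F G FS GS ⟨f, hf⟩ ⟨g, hg⟩ hFS hGS
    -- No factor is given for the third symplectization; uniqueness of the composite lift needs one,
    -- and it exists globally.
    obtain ⟨σ₃, hσ₃⟩ := hs₃.exists_factor isOpen_univ hη₃ hθ₃ fun _ _ => rfl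
    have h₃ : IsSymplectizationOfForm η₃ θ₃ pr₃ σ₃ :=
      ⟨hη₃, hθ₃, hs₃.bundle, hc₃, fun p => hσ₃.smooth p (mem_univ _),
        fun p => hσ₃.ne_zero p (mem_univ _), fun p => hσ₃.eq p (mem_univ _)⟩
    exact ⟨⟨_, hf.trans hg⟩, hFS.trans hGS, fun HS hHS =>
      isLift_unique h₁ h₃ (hf.trans hg) hHS (hFS.trans hGS)⟩
  · intro D θ pr hD hθ hs hc
    have H : IsConnectedSymplectization D θ pr := ⟨hD, hθ, hs, hc⟩
    obtain ⟨S, hS⟩ := H.exists_equiv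
    have hproj := fun X => (hS X (S X)).1 rfl
    refine ⟨S, hS, fun η σ hη hDη hσ => ⟨fun X a ha => ⟨fun Z _ =>
      H.eq_lift_iff hη hσ X.2.smooth (S X).2 (hproj X) ha Z, ?_⟩, ?_⟩, fun X Y => ?_⟩
    · obtain ⟨Δ, hΔ⟩ := hθ.exists_liouville
      have hadd := H.isSigmaLift_add hη hσ X.2.smooth (S X).2 (hproj X) ha hΔ
      exact ⟨Δ, _, hΔ, hadd, fun Z hZ => H.sigmaLift_unique hη hσ hZ hadd,
        fun p => (add_sub_cancel_right _ _).symm⟩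
    -- The Reeb field is found as the preimage under `S` of its lift, which makes it an
    -- infinitesimal contactomorphism at once.
    · obtain ⟨Y, hY, hθY, hYσ⟩ := H.exists_reeb_lift hη hσ
      have hSY : S (S.symm ⟨Y, hY⟩) = ⟨Y, hY⟩ := S.apply_symm_apply _
      have hYR := (hS _ _).1 hSY
      refine ⟨(S.symm ⟨Y, hY⟩).1, (S.symm ⟨Y, hY⟩).2,
        H.isReeb hη hσ (S.symm ⟨Y, hY⟩).2.smooth hY hYR hθY hYσ, ?_⟩
      rw [Subtype.coe_eta, hSY]
      exact ⟨hY.smooth, hYR, hYσ⟩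
    · obtain ⟨h1, h2, h3⟩ := H.mlieBracket X.2.smooth Y.2.smooth (S X).2 (S Y).2 (hproj X) (hproj Y)
      exact ⟨h1, congrArg Subtype.val ((hS ⟨_, h1⟩ ⟨_, h2⟩).2 h3)⟩
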